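/- Let $\mathbb F_q$ be a finite field and let $F=\mathbb F_q(x,y)$, with $x$ transcendental over $\mathbb F_q$, be an elliptic function field with one of the defining equations (1) $y^2=f(x)$, where $q$ is odd and $f\in\mathbb F_q[x]$ is square-free of degree $3$; (2) $y^2+y=f(x)$, where $q$ is even and $f\in\mathbb F_q[x]$ has degree $3$; (3) $y^2+y=x+\frac1{ax+b}$, where $q$ is even, $a,b\in\mathbb F_q$ and $a\neq0$. Put $Y=y$ for the types (1) and (2), and $Y=(ax+b)y$ for the type (3). Let $O$ be the pole of $x$, and let $P_1,\dots,P_n$ be distinct places of $F$ of degree one, all different from $O$; put $D=P_1+\dots+P_n$. For a positive integer $k$ let $\mathcal L(kO)$ be the Riemann-Roch space of $kO$, and let the elliptic curve code (ECC) be $C_{\mathcal L}(D,kO)=\{(f(P_1),\dots,f(P_n)) : f\in\mathcal L(kO)\}$. Let $\eta\in\mathbb F_q\setminus\{0\}$, and let $\ell$ be an integer with $0\le\ell\le\frac{k-3}2$ if $k$ is odd and $0\le\ell\le\frac k2$ if $k$ is even. Let $S_\ell$ be the set of all functions $$\sum_{i=0}^{(k-1)/2}a_ix^i+\sum_{j=0}^{(k-3)/2}b_jx^jY+b_\ell\,\eta\,x^{(k+1)/2}\quad(k\text{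 odd}),$$ $$\sum_{i=0}^{k/2}a_ix^i+\sum_{j=0}^{(k-4)/2}b_jx^jY+a_\ell\,\eta\,x^{(k-2)/2}Y\quad(k\text{ even}),$$ with $a_i,b_j\in\mathbb F_q$. The twisted elliptic curve code (TECC) is $C(D,kO,\ell,\eta)=\{(f(P_1),\dots,f(P_n)) : f\in S_\ell\}$. Two codes in $\mathbb F_q^n$ are monomially equivalent if one arises from the other by a permutation of the coordinates followed by componentwise multiplication by a vector in $(\mathbb F_q\setminus\{0\})^n$. A $k$-dimensional generalized Reed-Solomon (GRS) code of length $n$ is a code $\{(v_1g(\alpha_1),\dots,v_ng(\alpha_n)) : g\in\mathbb F_q[X],\ \deg g<k\}$ with distinct $\alpha_i\in\mathbb F_q$ and nonzero $v_i\in\mathbb F_q$. Suppose that $4\le k\le\frac{n-4}2$ or $\frac{n+4}2\le k\le n-4$. Then: 1. $C(D,kO,\ell,\eta)$ is not monomially equivalent to any $k$-dimensional GRS code of length $n$. 2. If $(n,k,\ell)\neq(12,8,0)$, then $C(D,kO,\ell,\eta)$ is not monomially equivalent to the ECC $C_{\mathcal L}(D,kO)$. -/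

import Mathlib

namespace EllipticCode

open Polynomial

/-! ### Elliptic function fields -/

/-- The three kinds of defining equations of an elliptic function field over `F`. -/
inductive DefEq (F : Type*) [Field F]
  /-- `y ^ 2 = f(x)` -/
  | first (f : F[X])
  /-- `y ^ 2 + y = f(x)` -/
  | second (f : F[X])
  /-- `y ^ 2 + y = x + 1 / (a x + b)` -/
  | third (a b : F)

namespace DefEq

variable {F K : Type*} [Field F] [Field K] [Algebra F K]

/-- The conditions on the characteristic and on the coefficients of the equation. -/
def IsValid : DefEq F → Prop
  | first f => ringChar F ≠ 2 ∧ f.natDegree = 3 ∧ Squarefree f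
  | second f => ringChar F = 2 ∧ f.natDegree = 3
  | third a _ => ringChar F = 2 ∧ a ≠ 0

/-- The pair `(x, y)` satisfies the equation. -/
def Holds (x y : K) : DefEq F → Prop
  | first f => y ^ 2 = aeval x f
  | second f => y ^ 2 + y = aeval x f
  | third a b => y ^ 2 + y = x + 1 / (algebraMap F K a * x + algebraMap F K b)

/-- The function that plays the role of `y` in the defining sets of the twisted codes: it is `y`
for the first two types, and `(a x + b) y` for the third one. -/
def yFun (x y : K) : DefEq F → K
  | first _ => y
  | second _ => y
  | third a b => (algebraMap F K a * x + algebraMap F K b) * y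

/-- `K = F(x, y)` is the elliptic function field with the given defining equation. -/
structure IsFunctionField (E : DefEq F) (x y : K) : Prop where
  valid : E.IsValid
  transcendental : Transcendental F x
  adjoin_eq_top : IntermediateField.adjoin F {x, y} = ⊤
  holds : E.Holds x y

end DefEq

/-- A place of `K / F`, given by its valuation ring: a valuation ring `F ⊆ 𝒪 ⊊ K`. -/
@[ext]
structure Place (F K : Type*) [Field F] [Field K] [Algebra F K] where
  ring : ValuationSubring K
  const_mem : ∀ c : F, algebraMap F K c ∈ ring
  ne_top : ring ≠ ⊤

namespace Place

variable {F K : Type*} [Field F] [Field K] [Algebra F K]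

/-- `f` is regular at `P` and its residue class modulo (the maximal ideal of) `P` is the constant
`c`, that is, `f(P) = c`. -/
def HasValue (P : Place F K) (f : K) (c : F) : Prop :=
  P.ring.valuation (f - algebraMap F K c) < 1

/-- `P` has degree one: all residue classes are constants. -/
def IsRational (P : Place F K) : Prop :=
  ∀ f ∈ P.ring, ∃ c : F, P.HasValue f c

/-- `f` has a pole of order at most `k` at `P`, that is `v_P(f) ≥ -k`: multiplication by any
element of the `k`-th power of the maximal ideal makes `f` regular at `P`. -/
def PoleOrderLE (P : Place F K) (f : K) (k : ℕ) : Prop :=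
  ∀ a ∈ (IsLocalRing.maximalIdeal P.ring) ^ k, f * (a : K) ∈ P.ring

/-- The Riemann-Roch space `ℒ(k O)`: no poles outside `O`, and a pole of order at most `k`
at `O`. -/
def riemannRoch (O : Place F K) (k : ℕ) : Submodule F K where
  carrier := {f | (∀ P : Place F K, P ≠ O → f ∈ P.ring) ∧ O.PoleOrderLE f k}
  zero_mem' := by
    refine ⟨fun P _ => P.ring.zero_mem, fun a _ => ?_⟩
    rw [zero_mul]
    exact O.ring.zero_mem
  add_mem' := by
    rintro f g ⟨hf, hf'⟩ ⟨hg, hg'⟩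
    refine ⟨fun P hP => P.ring.add_mem _ _ (hf P hP) (hg P hP), fun a ha => ?_⟩
    rw [add_mul]
    exact O.ring.add_mem _ _ (hf' a ha) (hg' a ha)
  smul_mem' := by
    rintro c f ⟨hf, hf'⟩
    refine ⟨fun P hP => ?_, fun a ha => ?_⟩
    · rw [Algebra.smul_def]
      exact P.ring.mul_mem _ _ (P.const_mem c) (hf P hP)
    · rw [Algebra.smul_def, mul_assoc]
      exact O.ring.mul_mem _ _ (O.const_mem c) (hf' a ha)

end Place

/-! ### Codes -/

section Codes

variable {F K : Type*} [Field F] [Field K] [Algebra F K] {n : ℕ}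

/-- The image of the evaluation map `f ↦ (f(P₁), …, f(Pₙ))` on the space `W`. -/
def evalCode (P : Fin n → Place F K) (W : Submodule F K) : Submodule F (Fin n → F) where
  carrier := {c | ∃ f ∈ W, ∀ i, (P i).HasValue f (c i)}
  zero_mem' := by
    refine ⟨0, W.zero_mem, fun i => ?_⟩
    simp [Place.HasValue]
  add_mem' := by
    rintro c d ⟨f, hf, hc⟩ ⟨g, hg, hd⟩
    refine ⟨f + g, W.add_mem hf hg, fun i => ?_⟩
    have h := Valuation.map_add_lt _ (hc i) (hd i)
    unfold Place.HasValue
    convert h using 2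
    simp only [Pi.add_apply, map_add]
    ring
  smul_mem' := by
    rintro r c ⟨f, hf, hc⟩
    refine ⟨r • f, W.smul_mem r hf, fun i => ?_⟩
    have h1 := ((P i).ring.valuation_le_one_iff _).2 ((P i).const_mem r)
    have h2 : (P i).ring.valuation (f - algebraMap F K (c i)) < 1 := hc i
    unfold Place.HasValue
    have h3 : r • f - algebraMap F K ((r • c) i)
        = algebraMap F K r * (f - algebraMap F K (c i)) := by
      simp only [Pi.smul_apply, smul_eq_mul, map_mul, Algebra.smul_def]
      ring
    rw [h3, map_mul]
    exact lt_of_le_of_lt (mul_le_of_le_one_left' h1) h2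

/-- The elliptic curve code `C_ℒ(D, k O)`, `D = P₁ + ⋯ + Pₙ`. -/
def ecc (P : Fin n → Place F K) (O : Place F K) (k : ℕ) : Submodule F (Fin n → F) :=
  evalCode P (O.riemannRoch k)

/-- The general element of the defining set with one twist, with coefficients `a i` of `x ^ i`
and `b j` of `x ^ j Y`.
For odd `k`: `∑_{i ≤ (k-1)/2} aᵢ xⁱ + ∑_{j ≤ (k-3)/2} bⱼ xʲ Y + b_ℓ η x^((k+1)/2)`.
For even `k`: `∑_{i ≤ k/2} aᵢ xⁱ + ∑_{j ≤ (k-4)/2} bⱼ xʲ Y + a_ℓ η x^((k-2)/2) Y`. -/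
def twistedElement (x Y : K) (k ℓ : ℕ) (η : F) (a b : ℕ → F) : K :=
  if Odd k then
    ∑ i ∈ Finset.range ((k - 1) / 2 + 1), a i • x ^ i
      + ∑ j ∈ Finset.range ((k - 3) / 2 + 1), b j • (x ^ j * Y)
      + (b ℓ * η) • x ^ ((k + 1) / 2)
  else
    ∑ i ∈ Finset.range (k / 2 + 1), a i • x ^ i
      + ∑ j ∈ Finset.range ((k - 4) / 2 + 1), b j • (x ^ j * Y)
      + (a ℓ * η) • (x ^ ((k - 2) / 2) * Y)

theorem twistedElement_add (x Y : K) (k ℓ : ℕ) (η : F) (a b a' b' : ℕ → F) :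
    twistedElement x Y k ℓ η (a + a') (b + b')
      = twistedElement x Y k ℓ η a b + twistedElement x Y k ℓ η a' b' := by
  unfold twistedElement
  split_ifs <;>
  · simp only [Pi.add_apply, add_smul, add_mul, Finset.sum_add_distrib]
    ring

theorem twistedElement_smul (x Y : K) (k ℓ : ℕ) (η r : F) (a b : ℕ → F) :
    twistedElement x Y k ℓ η (r • a) (r • b) = r • twistedElement x Y k ℓ η a b := by
  unfold twistedElement
  split_ifs <;>
  · simp only [Pi.smul_apply, smul_eq_mul, mul_smul, smul_add, Finset.smul_sum]

/-- The defining set `S_ℓ` (for `k ≥ 3` and fixed `η`). -/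
def definingSet (x Y : K) (k ℓ : ℕ) (η : F) : Submodule F K where
  carrier := {f | ∃ a b : ℕ → F, f = twistedElement x Y k ℓ η a b}
  zero_mem' := by
    refine ⟨0, 0, ?_⟩
    unfold twistedElement
    split_ifs <;> simp
  add_mem' := by
    rintro f g ⟨a, b, rfl⟩ ⟨a', b', rfl⟩
    exact ⟨a + a', b + b', (twistedElement_add x Y k ℓ η a b a' b').symm⟩
  smul_mem' := by
    rintro r f ⟨a, b, rfl⟩
    exact ⟨r • a, r • b, (twistedElement_smul x Y k ℓ η r a b).symm⟩

/-- The twisted elliptic curve code `C(D, k O, ℓ, η)`, `D = P₁ + ⋯ + Pₙ`. -/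
def tecc (E : DefEq F) (x y : K) (P : Fin n → Place F K) (k ℓ : ℕ) (η : F) :
    Submodule F (Fin n → F) :=
  evalCode P (definingSet x (E.yFun x y) k ℓ η)

/-- The generalized Reed-Solomon code with evaluation points `α` and multipliers `v`. -/
noncomputable def grs (k : ℕ) (α v : Fin n → F) : Submodule F (Fin n → F) :=
  (degreeLT F k).map
    (LinearMap.pi fun i => v i • (Polynomial.leval (α i) : F[X] →ₗ[F] F))

/-- Monomial equivalence: `C₂` arises from `C₁` by a permutation of the coordinates and a
componentwise multiplication by a vector with nonzero entries. -/
def MonomiallyEquivalent (C₁ C₂ : Submodule F (Fin n → F)) : Prop :=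
  ∃ (σ : Equiv.Perm (Fin n)) (v : Fin n → F), (∀ i, v i ≠ 0) ∧
    (C₂ : Set (Fin n → F)) = (fun c i => v i * c (σ i)) '' (C₁ : Set (Fin n → F))

end Codes

end EllipticCode

/-! After scaling `x` and `Y`, the function field has a smooth Weierstrass model. The pole order at
`O` filters its coordinate ring by spaces `V m ⊆ ℒ(m O)`, with one monomial for every order except
1. Rational places other than `O` become distinct affine points, and the twisted code becomes the
set of values of those functions in `V (k + 1)` whose coefficients at two orders `t` and `k + 1` are
proportional; here `t ≤ k`, `t ≠ 1` and `t` has the parity of `k`.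

The invariant is the dimension of the componentwise square of a code, or of its dual; monomial
equivalence preserves both. A GRS code of dimension `k` has a square of dimension at most `2 k - 1`,
and its dual is again GRS. An elliptic curve code gives at most `2 k`, and the square of its dual
has dimension at most `2 (n - k)` (`finrank_orth_code_mul_le`). It remains to see that twisting
pushes the dimension up to `2 k + 1`, respectively `2 (n - k) + 1`.

In low rate this is a count of pole orders: the orders occurring in the twisted space are `0, 2, …,
k + 1` without `t`, and sums of two of them, together with a few explicit products for `t = 0`, give
enough orders (`le_finrank_twistSpace_mul`).

In high rate put `j = n - k` and `m = k + 2 - j`. The dual of the square of the dual code is the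
conductor, the set of vectors that multiply the dual code into the code (`mem_orth_mul`), so the
claim becomes: the conductor has dimension at most `m - 3`. Dual codes are described by a vector `v`
that acts like the residues of a differential. If `D` is equivalent to `n O`, the functions times
`v` give everything. Otherwise `D` is equivalent to `(n - 1) O` plus a point, and a second vector
`w` fills the gap at order 1 (`isPrincipal_or`, `exists_isDual`). In both cases the conductor embeds
into an explicit space of dimension `m`: functions of order at most `m`, or functions in the ideal
of the extra point. Three independent linear conditions on it are then exhibited, most of them
saying that products with low order functions satisfy the twist relation, the others using the dual
word that sees the twist.

Two situations escape. For `t = 0`, `n = 12`, `k = 8` only two conditions may be found; this still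
excludes GRS codes and is the exception of the theorem. For `t = 2`, `j = 4` on a curve `y (y - b) =
x² (x - a)` in characteristic 2, a conductor of dimension `m - 2` leads to a contradiction unless `m
= 6` and `a = 0`. There the cubes decide: the cube of the dual of the elliptic curve code is the
whole space (`mul_mul_eq_top`), the cube of the dual of the twisted code is not (`mul_mul_ne_top`).
-/

namespace EllipticCode

open Polynomial

/-! ### The affine coordinate ring of a Weierstrass curve, filtered by the pole order at infinity -/

section CoordinateRing

variable {F : Type*} [Field F]

/-- The right hand side of the Weierstrass equation. -/
noncomputable def cubic (W : WeierstrassCurve F) : F[X] :=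
  X ^ 3 + C W.a₂ * X ^ 2 + C W.a₄ * X + C W.a₆

/-- The coefficient of `y` in the Weierstrass equation. -/
noncomputable def linear (W : WeierstrassCurve F) : F[X] := C W.a₁ * X + C W.a₃

/-- The affine coordinate ring `F[x, y]` of the curve
`y² + (a₁ x + a₃) y = x³ + a₂ x² + a₄ x + a₆`. The element `p + q y` is the pair `⟨p, q⟩`. -/
abbrev CoordRing (W : WeierstrassCurve F) : Type _ :=
  QuadraticAlgebra F[X] (cubic W) (-linear W)

namespace CoordRing

variable (W : WeierstrassCurve F)

/-- The coefficient of the monomial of pole order `m`, which is `x ^ i` if `m = 2 i`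
and `x ^ i y` if `m = 2 i + 3`. There is none of order `1`. -/
noncomputable def coef (m : ℕ) : CoordRing W →ₗ[F] F where
  toFun g := if m % 2 = 0 then g.re.coeff (m / 2) else if m = 1 then 0
    else g.im.coeff ((m - 3) / 2)
  map_add' g h := by split_ifs <;> simp
  map_smul' c g := by split_ifs <;> simp

/-- The monomial of pole order `m`. -/
noncomputable def mon (m : ℕ) : CoordRing W :=
  if m % 2 = 0 then ⟨X ^ (m / 2), 0⟩ else if m = 1 then 0 else ⟨0, X ^ ((m - 3) / 2)⟩

variable {W}

theorem coef_even (i : ℕ) (g : CoordRing W) : coef W (2 * i) g = g.re.coeff i := by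
  simp [coef]

theorem coef_odd (i : ℕ) (g : CoordRing W) : coef W (2 * i + 3) g = g.im.coeff i := by
  have h1 : (2 * i + 3) % 2 = 1 := by omega
  simp [coef, h1]

@[simp] theorem coef_one (g : CoordRing W) : coef W 1 g = 0 := by
  simp [coef]

theorem mon_even (i : ℕ) : mon W (2 * i) = ⟨X ^ i, 0⟩ := by
  simp [mon]

theorem mon_odd (i : ℕ) : mon W (2 * i + 3) = ⟨0, X ^ i⟩ := by
  have h1 : (2 * i + 3) % 2 = 1 := by omega
  simp [mon, h1]

theorem mon_one : mon W 1 = 0 := by simp [mon]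

theorem mon_zero : mon W 0 = 1 := by
  simp only [mon, Nat.zero_mod, if_true, Nat.zero_div, pow_zero]
  rfl

theorem order_cases (m : ℕ) : (∃ i, m = 2 * i) ∨ m = 1 ∨ ∃ i, m = 2 * i + 3 := by
  rcases Nat.even_or_odd' m with ⟨i, h | h⟩
  · exact Or.inl ⟨i, h⟩
  · rcases i with _ | i
    · exact Or.inr (Or.inl (by omega))
    · exact Or.inr (Or.inr ⟨i, by omega⟩)

theorem coef_mon (m l : ℕ) (hl : l ≠ 1) : coef W m (mon W l) = if m = l then 1 else 0 := by
  rcases order_cases m with ⟨i, rfl⟩ | rfl | ⟨i, rfl⟩ <;>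
    rcases order_cases l with ⟨s, rfl⟩ | rfl | ⟨s, rfl⟩
  all_goals first | exact absurd rfl hl | skip
  · simp [coef_even, mon_even, coeff_X_pow]
  · rw [if_neg (by omega)]; simp [coef_even, mon_odd]
  · rw [if_neg (by omega)]; simp
  · rw [if_neg (by omega)]; simp
  · rw [if_neg (by omega)]; simp [coef_odd, mon_even]
  · simp [coef_odd, mon_odd, coeff_X_pow]

theorem ext_coef {g h : CoordRing W} (H : ∀ m, coef W m g = coef W m h) : g = h := by
  ext i
  · simpa [coef_even] using H (2 * i)
  · simpa [coef_odd] using H (2 * i + 3)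

variable (W)

/-- The functions with a pole of order at most `m` at infinity. -/
noncomputable def V (m : ℕ) : Submodule F (CoordRing W) where
  carrier := {g | ∀ j, m < j → coef W j g = 0}
  zero_mem' j _ := by simp
  add_mem' {g h} hg hh j hj := by rw [map_add, hg j hj, hh j hj, add_zero]
  smul_mem' c g hg j hj := by rw [map_smul, hg j hj, smul_zero]

variable {W}

theorem V_mono {m l : ℕ} (h : m ≤ l) : V W m ≤ V W l := fun _ hg j hj => hg j (h.trans_lt hj)

theorem mem_V_of_coef_eq_zero {m : ℕ} {g : CoordRing W} (hg : g ∈ V W (m + 1))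
    (h : coef W (m + 1) g = 0) : g ∈ V W m := fun j hj => by
  rcases Nat.lt_or_ge (m + 1) j with h' | h'
  · exact hg j h'
  · obtain rfl : j = m + 1 := by omega
    exact h

/-- Order 1 is a gap, which is how genus one enters. The gap causes most of the case distinctions
below. -/
theorem V_one : V W 1 = V W 0 :=
  le_antisymm (fun _ hg => mem_V_of_coef_eq_zero hg (coef_one _)) (V_mono zero_le_one)

theorem mon_mem {m l : ℕ} (h : l ≤ m) : mon W l ∈ V W m := fun j hj => by
  by_cases hl : l = 1
  · simp [hl, mon_one]
  · rw [coef_mon _ _ hl, if_neg (by omega)]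

theorem exists_mem_V (g : CoordRing W) : ∃ m, g ∈ V W m := by
  refine ⟨2 * g.re.natDegree + 2 * g.im.natDegree + 3, fun j hj => ?_⟩
  rcases order_cases j with ⟨i, rfl⟩ | rfl | ⟨i, rfl⟩
  · rw [coef_even]; exact coeff_eq_zero_of_natDegree_lt (by omega)
  · simp
  · rw [coef_odd]; exact coeff_eq_zero_of_natDegree_lt (by omega)

/-- A nonzero function in `V m` has an exact pole order. -/
theorem exists_order {m : ℕ} {g : CoordRing W} (hg : g ∈ V W m) (h0 : g ≠ 0) :
    ∃ d, d ≤ m ∧ d ≠ 1 ∧ g ∈ V W d ∧ coef W d g ≠ 0 := by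
  induction m with
  | zero =>
    refine ⟨0, le_rfl, by omega, hg, fun h => h0 (ext_coef fun j => ?_)⟩
    rcases Nat.eq_zero_or_pos j with rfl | hj
    · simpa using h
    · simpa using hg j hj
  | succ m ih =>
    by_cases h : coef W (m + 1) g = 0
    · obtain ⟨d, h1, h2⟩ := ih (mem_V_of_coef_eq_zero hg h)
      exact ⟨d, by omega, h2⟩
    · exact ⟨m + 1, le_rfl, fun h1 => h (by rw [h1]; simp), hg, h⟩

/-- A count with `x` of weight 2: in each term of the convolution one factor exceeds its bound. The
shifts `s`, `t` carry the weight of an accompanying power of `y`. -/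
theorem coeff_mul_eq_zero_of_weight {p q : F[X]} {a b s t : ℕ}
    (hp : ∀ i, a < 2 * i + s → p.coeff i = 0) (hq : ∀ i, b < 2 * i + t → q.coeff i = 0) {i : ℕ}
    (hi : a + b < 2 * i + s + t) : (p * q).coeff i = 0 := by
  rw [coeff_mul]
  refine Finset.sum_eq_zero fun x hx => ?_
  rw [Finset.HasAntidiagonal.mem_antidiagonal] at hx
  by_cases h : a < 2 * x.1 + s
  · rw [hp _ h, zero_mul]
  · rw [hq x.2 (by omega), mul_zero]

theorem coeff_mul_of_weight {p q : F[X]} {s t i l : ℕ}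
    (hp : ∀ i', 2 * i + s < 2 * i' + s → p.coeff i' = 0)
    (hq : ∀ i', 2 * l + t < 2 * i' + t → q.coeff i' = 0) :
    (p * q).coeff (i + l) = p.coeff i * q.coeff l := by
  rw [coeff_mul, Finset.sum_eq_single (i, l)]
  · rintro ⟨x, y⟩ hx hne
    rw [Finset.HasAntidiagonal.mem_antidiagonal] at hx
    simp only at hx
    by_cases h : i < x
    · rw [hp _ (by omega), zero_mul]
    · have : x ≠ i := by
        rintro rfl
        exact hne (by ext <;> simp; omega)
      rw [hq y (by omega), mul_zero]
  · intro h
    exact (h (by simp)).elim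

theorem re_weight {m : ℕ} {g : CoordRing W} (hg : g ∈ V W m) (i : ℕ) (h : m < 2 * i + 0) :
    g.re.coeff i = 0 := by
  simpa [coef_even] using hg (2 * i) h

theorem im_weight {m : ℕ} {g : CoordRing W} (hg : g ∈ V W m) (i : ℕ) (h : m < 2 * i + 3) :
    g.im.coeff i = 0 := by
  simpa [coef_odd] using hg (2 * i + 3) h

theorem mem_V_iff {m : ℕ} {g : CoordRing W} : g ∈ V W m ↔
    (∀ i, m < 2 * i → g.re.coeff i = 0) ∧ ∀ i, m < 2 * i + 3 → g.im.coeff i = 0 := by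
  refine ⟨fun hg => ⟨re_weight hg, im_weight hg⟩, fun ⟨h1, h2⟩ j hj => ?_⟩
  rcases order_cases j with ⟨i, rfl⟩ | rfl | ⟨i, rfl⟩
  · rw [coef_even]; exact h1 i hj
  · simp
  · rw [coef_odd]; exact h2 i hj

theorem cubic_weight (i : ℕ) (h : 6 < 2 * i + 0) :
    (cubic W).coeff i = 0 := by
  simp only [cubic, coeff_add, coeff_C_mul, coeff_X_pow, coeff_X, coeff_C]
  rw [if_neg (by omega), if_neg (by omega), if_neg (by omega), if_neg (by omega)]
  simp

theorem linear_weight (i : ℕ) (h : 2 < 2 * i + 0) :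
    (-linear W).coeff i = 0 := by
  simp only [linear, coeff_neg, coeff_add, coeff_C_mul, coeff_X, coeff_C]
  rw [if_neg (by omega), if_neg (by omega)]
  simp

/-- Reducing `y²` does not raise the order: the cubic has weight 6, twice the order 3 of `y`, and
the term with the linear factor has weight 2 + 3. -/
theorem mul_mem {a b : ℕ} {g h : CoordRing W} (hg : g ∈ V W a) (hh : h ∈ V W b) :
    g * h ∈ V W (a + b) := by
  rw [mem_V_iff]
  refine ⟨fun i hi => ?_, fun i hi => ?_⟩
  · rw [QuadraticAlgebra.re_mul, coeff_add,
      coeff_mul_eq_zero_of_weight (re_weight hg) (re_weight hh) (by omega), zero_add, mul_assoc]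
    exact coeff_mul_eq_zero_of_weight (s := 0) (t := 6) cubic_weight
      (fun i hi => coeff_mul_eq_zero_of_weight (im_weight hg) (im_weight hh) (by omega))
      (a := 6) (b := a + b) (by omega)
  · rw [QuadraticAlgebra.im_mul, coeff_add, coeff_add,
      coeff_mul_eq_zero_of_weight (re_weight hg) (im_weight hh) (by omega),
      coeff_mul_eq_zero_of_weight (im_weight hg) (re_weight hh) (by omega), zero_add, zero_add,
      mul_assoc]
    exact coeff_mul_eq_zero_of_weight (s := 0) (t := 6) linear_weight
      (fun i hi => coeff_mul_eq_zero_of_weight (im_weight hg) (im_weight hh) (by omega))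
      (a := 2) (b := a + b) (by omega)

/-- Leading coefficients multiply, so the pole order behaves like a valuation. For two odd orders
the leading term comes from `y² = x³ + ⋯`, and the cubic is monic. -/
theorem coef_mul {a b : ℕ} {g h : CoordRing W} (hg : g ∈ V W a) (hh : h ∈ V W b) :
    coef W (a + b) (g * h) = coef W a g * coef W b h := by
  have hzero : ∀ {a b : ℕ} {g h : CoordRing W}, a = 1 → g ∈ V W a → h ∈ V W b →
      coef W (a + b) (g * h) = coef W a g * coef W b h := by
    rintro a b g h rfl hg hh
    rw [coef_one, zero_mul]
    rw [V_one] at hg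
    exact mul_mem hg hh _ (by omega)
  rcases order_cases a with ⟨i, rfl⟩ | rfl | ⟨i, rfl⟩
  · rcases order_cases b with ⟨l, rfl⟩ | rfl | ⟨l, rfl⟩
    · rw [← mul_add, coef_even, coef_even, coef_even, QuadraticAlgebra.re_mul, coeff_add,
        coeff_mul_of_weight (s := 0) (t := 0) (re_weight hg) (re_weight hh), add_eq_left,
        mul_assoc]
      -- Parity gains one unit: under an even bound the `y`-part has order strictly below the bound,
      -- so the shifts are 4 and 7 instead of 3 and 6.
      exact coeff_mul_eq_zero_of_weight (s := 0) (t := 7) cubic_weight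
        (fun i' hi => coeff_mul_eq_zero_of_weight (s := 4) (t := 3) (a := 2 * i) (b := 2 * l)
          (fun i'' h => im_weight hg _ (by omega)) (im_weight hh) (by omega))
        (a := 6) (b := 2 * i + 2 * l) (by omega)
    · rw [add_comm _ 1, mul_comm g, hzero rfl hh hg, mul_comm (coef W 1 h)]
    · rw [show 2 * i + (2 * l + 3) = 2 * (i + l) + 3 by ring, coef_even, coef_odd, coef_odd,
        QuadraticAlgebra.im_mul, coeff_add, coeff_add,
        coeff_mul_of_weight (s := 0) (t := 3) (re_weight hg) (im_weight hh), add_assoc,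
        add_eq_left, coeff_mul_eq_zero_of_weight (s := 4) (t := 0) (a := 2 * i) (b := 2 * l + 3)
          (fun i'' h => im_weight hg _ (by omega)) (re_weight hh) (by omega), zero_add, mul_assoc]
      exact coeff_mul_eq_zero_of_weight (s := 0) (t := 6) linear_weight
        (fun i' hi => coeff_mul_eq_zero_of_weight (im_weight hg) (im_weight hh) (by omega))
        (a := 2) (b := 2 * i + (2 * l + 3)) (by omega)
  · exact hzero rfl hg hh
  · rcases order_cases b with ⟨l, rfl⟩ | rfl | ⟨l, rfl⟩
    · rw [show 2 * i + 3 + 2 * l = 2 * (i + l) + 3 by ring, coef_even, coef_odd, coef_odd,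
        QuadraticAlgebra.im_mul, coeff_add, coeff_add,
        coeff_mul_of_weight (s := 3) (t := 0) (im_weight hg) (re_weight hh),
        coeff_mul_eq_zero_of_weight (s := 0) (t := 4) (a := 2 * i + 3) (b := 2 * l)
          (re_weight hg) (fun i'' h => im_weight hh _ (by omega)) (by omega), zero_add,
        add_eq_left, mul_assoc]
      exact coeff_mul_eq_zero_of_weight (s := 0) (t := 6) linear_weight
        (fun i' hi => coeff_mul_eq_zero_of_weight (im_weight hg) (im_weight hh) (by omega))
        (a := 2) (b := 2 * i + 3 + 2 * l) (by omega)
    · rw [add_comm _ 1, mul_comm g, hzero rfl hh hg, mul_comm (coef W 1 h)]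
    · have h3 : (cubic W).coeff 3 = 1 := by
        simp [cubic]
      rw [show 2 * i + 3 + (2 * l + 3) = 2 * (3 + (i + l)) by ring, coef_even, coef_odd, coef_odd,
        QuadraticAlgebra.re_mul, coeff_add,
        coeff_mul_eq_zero_of_weight (s := 1) (t := 0) (a := 2 * i + 3) (b := 2 * l + 3)
          (fun i'' h => re_weight hg _ (by omega)) (re_weight hh) (by omega), zero_add, mul_assoc,
        coeff_mul_of_weight (s := 0) (t := 0) (by simpa using cubic_weight (W := W)), h3, one_mul,
        coeff_mul_of_weight (s := 3) (t := 3) (im_weight hg) (im_weight hh)]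
      exact fun i' hi => coeff_mul_eq_zero_of_weight (im_weight hg) (im_weight hh) (by omega)

/-- One factor must be a pure power of `x`, since `y²` is not a monomial. -/
theorem mon_mul_mon {a b : ℕ} (ha : a % 2 = 0) (hb : b ≠ 1) :
    mon W a * mon W b = mon W (a + b) := by
  obtain ⟨i, rfl⟩ : ∃ i, a = 2 * i := ⟨a / 2, by omega⟩
  rcases order_cases b with ⟨l, rfl⟩ | rfl | ⟨l, rfl⟩
  · rw [← mul_add, mon_even, mon_even, mon_even]
    ext1 <;> simp [pow_add]
  · exact absurd rfl hb
  · rw [show 2 * i + (2 * l + 3) = 2 * (i + l) + 3 by ring, mon_even, mon_odd, mon_odd]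
    ext1 <;> simp [pow_add]

theorem mul_ne_zero' {g h : CoordRing W} (hg : g ≠ 0) (hh : h ≠ 0) : g * h ≠ 0 := by
  obtain ⟨m, hm⟩ := exists_mem_V g
  obtain ⟨l, hl⟩ := exists_mem_V h
  obtain ⟨a, -, -, ha, ha'⟩ := exists_order hm hg
  obtain ⟨b, -, -, hb, hb'⟩ := exists_order hl hh
  intro h
  have := coef_mul ha hb
  rw [h, map_zero] at this
  exact mul_ne_zero ha' hb' this.symm

instance : IsDomain (CoordRing W) :=
  have : NoZeroDivisors (CoordRing W) :=
    ⟨fun {a b} h => by by_contra! hab; exact mul_ne_zero' hab.1 hab.2 h⟩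
  NoZeroDivisors.to_isDomain _

end CoordRing

end CoordinateRing

end EllipticCode

/-! ### Codimension from triangular systems of functionals -/

namespace EllipticCode

open Polynomial Module

section LinearAlgebra

variable {F M : Type*} [Field F] [AddCommGroup M] [Module F M]

theorem finrank_inf_ker_add_one {J : Submodule F M} [FiniteDimensional F J] (φ : M →ₗ[F] F)
    {u : M} (hu : u ∈ J) (h : φ u ≠ 0) :
    finrank F (J ⊓ LinearMap.ker φ : Submodule F M) + 1 = finrank F J := by
  have h1 := (φ.domRestrict J).finrank_range_add_finrank_ker
  have h2 : LinearMap.range (φ.domRestrict J) = ⊤ :=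
    LinearMap.range_eq_top.2 (LinearMap.surjective (f := φ.domRestrict J)
      fun h0 => h (by simpa using LinearMap.congr_fun h0 ⟨u, hu⟩))
  have h3 : (LinearMap.ker (φ.domRestrict J)).map J.subtype = J ⊓ LinearMap.ker φ := by
    rw [LinearMap.ker_domRestrict, Submodule.map_comap_subtype]
  rw [h2, finrank_top, finrank_self] at h1
  rw [← h3, LinearEquiv.finrank_eq
    (Submodule.equivMapOfInjective J.subtype (Submodule.injective_subtype J) _).symm]
  omega

theorem finrank_le_finrank_inf_ker_add_one (J : Submodule F M) [FiniteDimensional F J]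
    (φ : M →ₗ[F] F) :
    finrank F J ≤ finrank F (J ⊓ LinearMap.ker φ : Submodule F M) + 1 := by
  by_cases h : ∃ u ∈ J, φ u ≠ 0
  · obtain ⟨u, hu, hu'⟩ := h
    exact (finrank_inf_ker_add_one φ hu hu').ge
  · push Not at h
    rw [inf_eq_left.2 fun u hu => h u hu]
    omega

/-- A subspace killed by a functional that is not zero on the ambient space is smaller. -/
theorem finrank_add_one_le {J X : Submodule F M} [FiniteDimensional F X] (hJX : J ≤ X)
    (φ : M →ₗ[F] F) (hφ : ∀ g ∈ J, φ g = 0) {u : M} (hu : u ∈ X) (h : φ u ≠ 0) :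
    finrank F J + 1 ≤ finrank F X := by
  rw [← finrank_inf_ker_add_one φ hu h]
  have : FiniteDimensional F (X ⊓ LinearMap.ker φ : Submodule F M) :=
    Submodule.finiteDimensional_of_le inf_le_left
  exact Nat.add_le_add_right (Submodule.finrank_mono (le_inf hJX hφ)) 1

theorem finrank_add_two_le {J X : Submodule F M} [FiniteDimensional F X] (hJX : J ≤ X)
    (φ₁ φ₂ : M →ₗ[F] F) (h₁ : ∀ g ∈ J, φ₁ g = 0) (h₂ : ∀ g ∈ J, φ₂ g = 0) {u₁ u₂ : M}
    (hu₁ : u₁ ∈ X) (hu₂ : u₂ ∈ X) (h₁₁ : φ₁ u₁ ≠ 0) (h₁₂ : φ₁ u₂ = 0) (h₂₂ : φ₂ u₂ ≠ 0) :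
    finrank F J + 2 ≤ finrank F X := by
  have : FiniteDimensional F (X ⊓ LinearMap.ker φ₁ : Submodule F M) :=
    Submodule.finiteDimensional_of_le inf_le_left
  have := finrank_add_one_le (X := X ⊓ LinearMap.ker φ₁)
    (le_inf hJX h₁ : J ≤ X ⊓ LinearMap.ker φ₁) φ₂ h₂ (u := u₂) (Submodule.mem_inf.2 ⟨hu₂, h₁₂⟩) h₂₂
  have := finrank_inf_ker_add_one φ₁ hu₁ h₁₁
  omega

/-- The matrix of the values `φᵢ uⱼ` is triangular with nonzero diagonal, so the functionals are
independent on `X`. This produces most of the codimension three bounds for conductors. -/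
theorem finrank_add_three_le {J X : Submodule F M} [FiniteDimensional F X] (hJX : J ≤ X)
    (φ₁ φ₂ φ₃ : M →ₗ[F] F) (h₁ : ∀ g ∈ J, φ₁ g = 0) (h₂ : ∀ g ∈ J, φ₂ g = 0)
    (h₃ : ∀ g ∈ J, φ₃ g = 0) {u₁ u₂ u₃ : M}
    (hu₁ : u₁ ∈ X) (hu₂ : u₂ ∈ X) (hu₃ : u₃ ∈ X) (h₁₁ : φ₁ u₁ ≠ 0) (h₁₂ : φ₁ u₂ = 0)
    (h₁₃ : φ₁ u₃ = 0) (h₂₂ : φ₂ u₂ ≠ 0) (h₂₃ : φ₂ u₃ = 0) (h₃₃ : φ₃ u₃ ≠ 0) :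
    finrank F J + 3 ≤ finrank F X := by
  have : FiniteDimensional F (X ⊓ LinearMap.ker φ₁ : Submodule F M) :=
    Submodule.finiteDimensional_of_le inf_le_left
  have := finrank_add_two_le (X := X ⊓ LinearMap.ker φ₁)
    (le_inf hJX h₁ : J ≤ X ⊓ LinearMap.ker φ₁) φ₂ φ₃ h₂ h₃ (u₁ := u₂) (u₂ := u₃)
    (Submodule.mem_inf.2 ⟨hu₂, h₁₂⟩) (Submodule.mem_inf.2 ⟨hu₃, h₁₃⟩) h₂₂ h₂₃ h₃₃
  have := finrank_inf_ker_add_one φ₁ hu₁ h₁₁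
  omega

end LinearAlgebra

/-! ### Dimensions of the filtration, evaluation at points and counting of zeros -/

namespace CoordRing

variable {F : Type*} [Field F] {W : WeierstrassCurve F}

instance (m : ℕ) : FiniteDimensional F (V W m) := by
  let φ : CoordRing W →ₗ[F] (Fin (m + 1) → F) := LinearMap.pi fun i => coef W i
  refine FiniteDimensional.of_injective (φ.domRestrict (V W m)) ?_
  rw [injective_iff_map_eq_zero]
  rintro ⟨g, hg⟩ h
  ext1
  refine ext_coef fun j => ?_
  rcases Nat.lt_or_ge m j with hj | hj
  · simpa using hg j hj
  · exact (congrFun h (⟨j, by omega⟩ : Fin (m + 1))).trans (map_zero (coef W j)).symm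

theorem V_succ_inf_ker (m : ℕ) : V W (m + 1) ⊓ LinearMap.ker (coef W (m + 1)) = V W m :=
  le_antisymm (fun _ hg => mem_V_of_coef_eq_zero hg.1 hg.2)
    (le_inf (V_mono m.le_succ) fun _ hg => hg _ m.lt_succ_self)

/-- Riemann-Roch in genus one: every order from 0 to `m` contributes a monomial except the gap 1,
which is why the dimension is `m` and not `m + 1`. -/
theorem finrank_V : ∀ m, 1 ≤ m → finrank F (V W m) = m
  | 1, _ => by
    rw [V_one]
    have h0 : V W 0 ⊓ LinearMap.ker (coef W 0) = ⊥ := by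
      rw [eq_bot_iff]
      rintro g ⟨hg, hg'⟩
      refine ext_coef fun j => ?_
      rcases Nat.eq_zero_or_pos j with rfl | hj
      · simpa using hg'
      · simpa using hg j hj
    rw [← finrank_inf_ker_add_one (coef W 0) (mon_mem (le_refl 0))
      (by rw [coef_mon _ _ (by omega)]; simp), h0, finrank_bot]
  | m + 2, _ => by
    rw [← finrank_inf_ker_add_one (coef W (m + 2)) (mon_mem (le_refl (m + 2)))
      (by rw [coef_mon _ _ (by omega)]; simp), V_succ_inf_ker, finrank_V (m + 1) (by omega)]

/-- The affine point `(a, b)` lies on the curve. -/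
def OnCurve (W : WeierstrassCurve F) (a b : F) : Prop :=
  b ^ 2 + (W.a₁ * a + W.a₃) * b = a ^ 3 + W.a₂ * a ^ 2 + W.a₄ * a + W.a₆

/-- Evaluation at a point of the curve. -/
noncomputable def evalAt {a b : F} (h : OnCurve W a b) : CoordRing W →ₐ[F] F where
  toFun g := g.re.eval a + g.im.eval a * b
  map_one' := by
    have h1 : (1 : CoordRing W).re = 1 := rfl
    have h2 : (1 : CoordRing W).im = 0 := rfl
    simp [h1, h2]
  map_mul' g g' := by
    unfold OnCurve at h
    simp only [QuadraticAlgebra.re_mul, QuadraticAlgebra.im_mul, cubic, linear, eval_add, eval_mul, eval_neg,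
      eval_pow, eval_X, eval_C]
    linear_combination (-g.im.eval a * g'.im.eval a) * h
  map_zero' := by simp
  map_add' g g' := by simp; ring
  commutes' c := by
    have h1 : (algebraMap F (CoordRing W) c).re = C c := rfl
    have h2 : (algebraMap F (CoordRing W) c).im = 0 := rfl
    simp [h1, h2]

theorem evalAt_apply {a b : F} (h : OnCurve W a b) (g : CoordRing W) :
    evalAt h g = g.re.eval a + g.im.eval a * b := rfl

end CoordRing

open CoordRing

/-- Distinct affine points of the curve. -/
structure Points {F : Type*} [Field F] (W : WeierstrassCurve F) (n : ℕ) where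
  fst : Fin n → F
  snd : Fin n → F
  onCurve : ∀ i, OnCurve W (fst i) (snd i)
  inj : ∀ i j, fst i = fst j → snd i = snd j → i = j

namespace Points

variable {F : Type*} [Field F] {W : WeierstrassCurve F} {n : ℕ} (D : Points W n)

/-- Evaluation at all the points. -/
noncomputable def ev : CoordRing W →ₐ[F] (Fin n → F) :=
  AlgHom.pi fun i => evalAt (D.onCurve i)

theorem ev_apply (g : CoordRing W) (i : Fin n) :
    D.ev g i = g.re.eval (D.fst i) + g.im.eval (D.fst i) * D.snd i := rfl

/-- Orders add under multiplication and `x - a` has order exactly 2. -/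
theorem coef_shift {g g' : CoordRing W} {a : F}
    (h : g = ⟨X - C a, 0⟩ * g') {m : ℕ} (hg : g ∈ V W (m + 2)) : g' ∈ V W m := by
  by_cases h0 : g' = 0
  · rw [h0]; exact zero_mem _
  obtain ⟨l, hl⟩ := exists_mem_V g'
  obtain ⟨d, -, -, hd, hd'⟩ := exists_order hl h0
  have hx : (⟨X - C a, 0⟩ : CoordRing W) ∈ V W 2 := by
    rw [mem_V_iff]
    refine ⟨fun i hi => ?_, fun i _ => by simp⟩
    simp only [coeff_sub, coeff_X, coeff_C]
    rw [if_neg (by omega), if_neg (by omega), sub_zero]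
  have hx1 : coef W 2 (⟨X - C a, 0⟩ : CoordRing W) = 1 := by
    rw [show 2 = 2 * 1 by rfl, coef_even]; simp
  have h2 := coef_mul hx hd
  rw [← h, hx1, one_mul] at h2
  refine V_mono ?_ hd
  by_contra! hlt
  exact hd' (by rw [← h2, hg _ (by omega)])

/-- A nonzero function with a pole of order at most `m` has at most `m` zeros. -/
theorem card_zeros_le (m : ℕ) : ∀ (g : CoordRing W), g ∈ V W m → g ≠ 0 →
    ∀ Z : Finset (Fin n), (∀ i ∈ Z, D.ev g i = 0) → Z.card ≤ m := by
  classical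
  induction m using Nat.strong_induction_on with
  | _ m ih =>
  intro g hg h0 Z hZ
  -- If the zeros have distinct first coordinates, these are roots of the norm of `g`, a polynomial
  -- of degree at most `m`. Otherwise a factor `x - a` splits off and takes two zeros with it.
  by_cases hinj : Set.InjOn D.fst Z
  · set N := g.norm with hN
    have hN0 : N ≠ 0 := by
      intro h
      have h1 := QuadraticAlgebra.algebraMap_norm_eq_mul_star g
      rw [← hN, h, map_zero] at h1
      rcases mul_eq_zero.1 h1.symm with h2 | h2
      · exact h0 h2
      · exact h0 (star_eq_zero.1 h2)
    have hdeg : N.natDegree ≤ m := by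
      rw [natDegree_le_iff_coeff_eq_zero]
      intro i hi
      rw [hN, QuadraticAlgebra.norm_def, coeff_sub, coeff_add,
        coeff_mul_eq_zero_of_weight (re_weight hg) (re_weight hg) (by omega), mul_assoc, mul_assoc,
        coeff_mul_eq_zero_of_weight (s := 0) (t := 3) (a := 2) (b := m + m) linear_weight
          (fun i hi => coeff_mul_eq_zero_of_weight (re_weight hg) (im_weight hg) (by omega))
          (by omega),
        coeff_mul_eq_zero_of_weight (s := 0) (t := 6) (a := 6) (b := m + m) cubic_weight
          (fun i hi => coeff_mul_eq_zero_of_weight (im_weight hg) (im_weight hg) (by omega))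
          (by omega)]
      simp
    have hroot : Z.image D.fst ⊆ N.roots.toFinset := by
      intro a ha
      obtain ⟨i, hi, rfl⟩ := Finset.mem_image.1 ha
      rw [Multiset.mem_toFinset, mem_roots hN0, IsRoot.def, hN, QuadraticAlgebra.norm_def]
      have h1 := hZ i hi
      have h2 := D.onCurve i
      rw [ev_apply] at h1
      unfold OnCurve at h2
      simp only [cubic, linear, eval_add, eval_sub, eval_mul, eval_neg, eval_pow, eval_X, eval_C]
      linear_combination (g.re.eval (D.fst i) - g.im.eval (D.fst i) * D.snd i
        - (W.a₁ * D.fst i + W.a₃) * g.im.eval (D.fst i)) * h1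
        + (g.im.eval (D.fst i)) ^ 2 * h2
    calc Z.card = (Z.image D.fst).card := (Finset.card_image_of_injOn hinj).symm
      _ ≤ N.roots.toFinset.card := Finset.card_le_card hroot
      _ ≤ N.roots.card := N.roots.toFinset_card_le
      _ ≤ N.natDegree := N.card_roots'
      _ ≤ m := hdeg
  · simp only [Set.InjOn, Finset.mem_coe, not_forall] at hinj
    obtain ⟨i, hi, l, hl, hil, hne⟩ := hinj
    have hsnd : D.snd i ≠ D.snd l := fun h => hne (D.inj _ _ hil h)
    have e1 := hZ i hi
    have e2 := hZ l hl
    rw [ev_apply] at e1 e2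
    rw [← hil] at e2
    -- Two distinct second coordinates over the same `a` force both components of `g` to vanish at
    -- `a`.
    have him : g.im.eval (D.fst i) = 0 := by
      have : g.im.eval (D.fst i) * (D.snd i - D.snd l) = 0 := by linear_combination e1 - e2
      exact (mul_eq_zero.1 this).resolve_right (sub_ne_zero.2 hsnd)
    have hre : g.re.eval (D.fst i) = 0 := by rw [him, zero_mul, add_zero] at e1; exact e1
    obtain ⟨p, hp⟩ := dvd_iff_isRoot.2 (show IsRoot g.re (D.fst i) from hre)
    obtain ⟨q, hq⟩ := dvd_iff_isRoot.2 (show IsRoot g.im (D.fst i) from him)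
    have hg' : g = ⟨X - C (D.fst i), 0⟩ * (⟨p, q⟩ : CoordRing W) := by
      ext1 <;> simp [hp, hq]
    have hg0 : (⟨p, q⟩ : CoordRing W) ≠ 0 := fun h => h0 (by rw [hg', h, mul_zero])
    -- Below order 2 only constants remain, and a constant with a zero is zero.
    have hm : 2 ≤ m := by
      by_contra! hm
      have : g ∈ V W 0 := by
        rw [← V_one]; exact V_mono (by omega) hg
      have h2 := coef_shift hg' (m := 0) (V_mono (by omega) hg)
      have h3 : g.im = 0 := by
        ext i'; simpa [coef_odd] using this (2 * i' + 3) (by omega)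
      obtain ⟨c, hc⟩ : ∃ c, g.re = C c := ⟨g.re.coeff 0, by
        ext i'
        rcases i' with _ | i'
        · simp
        · have := this (2 * (i' + 1)) (by omega)
          rw [coef_even] at this
          rw [this, coeff_C, if_neg (by omega)]⟩
      rw [hc, eval_C] at hre
      exact h0 (by ext1 <;> simp [hc, hre, h3])
    -- The equation is quadratic in `y`, so no third point lies over the same first coordinate and
    -- `x - a` is nonzero at the other zeros.
    have hZ' : ∀ s ∈ (Z.erase i).erase l, D.ev ⟨p, q⟩ s = 0 := by
      intro s hs
      rw [Finset.mem_erase, Finset.mem_erase] at hs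
      have h1 := hZ s hs.2.2
      rw [hg', map_mul, Pi.mul_apply] at h1
      refine (mul_eq_zero.1 h1).resolve_left fun h2 => ?_
      rw [ev_apply] at h2
      simp only [eval_sub, eval_X, eval_C, eval_zero, zero_mul, add_zero] at h2
      have h3 : D.fst s = D.fst i := sub_eq_zero.1 h2
      have c1 := D.onCurve s
      have c2 := D.onCurve i
      have c3 := D.onCurve l
      unfold OnCurve at c1 c2 c3
      rw [h3] at c1
      rw [← hil] at c3
      have n1 : D.snd s - D.snd i ≠ 0 := sub_ne_zero.2 fun h => hs.2.1 (D.inj _ _ h3 h)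
      have n2 : D.snd i - D.snd l ≠ 0 := sub_ne_zero.2 hsnd
      have n3 : D.snd s - D.snd l ≠ 0 := sub_ne_zero.2 fun h => hs.1 (D.inj _ _ (h3.trans hil) h)
      have f1 : D.snd s + D.snd i + (W.a₁ * D.fst i + W.a₃) = 0 :=
        (mul_eq_zero.1 (by linear_combination c1 - c2 :
          (D.snd s - D.snd i) * (D.snd s + D.snd i + (W.a₁ * D.fst i + W.a₃)) = 0)).resolve_left n1
      have f2 : D.snd i + D.snd l + (W.a₁ * D.fst i + W.a₃) = 0 :=
        (mul_eq_zero.1 (by linear_combination c2 - c3 :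
          (D.snd i - D.snd l) * (D.snd i + D.snd l + (W.a₁ * D.fst i + W.a₃)) = 0)).resolve_left n2
      exact n3 (by linear_combination f1 - f2)
    have h1 := ih (m - 2) (by omega) ⟨p, q⟩ (coef_shift hg' (by rwa [Nat.sub_add_cancel hm])) hg0
      _ hZ'
    rw [Finset.card_erase_of_mem (Finset.mem_erase.2 ⟨fun h => hne h.symm, hl⟩),
      Finset.card_erase_of_mem hi] at h1
    omega

theorem eq_zero_of_ev_eq_zero {m : ℕ} (hm : m < n) {g : CoordRing W} (hg : g ∈ V W m)
    (h : D.ev g = 0) : g = 0 := by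
  by_contra h0
  have := D.card_zeros_le m g hg h0 Finset.univ fun i _ => by rw [h]; rfl
  rw [Finset.card_univ, Fintype.card_fin] at this
  omega

theorem eq_of_ev_eq {m : ℕ} (hm : m < n) {g g' : CoordRing W} (hg : g ∈ V W m)
    (hg' : g' ∈ V W m) (h : D.ev g = D.ev g') : g = g' :=
  sub_eq_zero.1 (D.eq_zero_of_ev_eq_zero hm (sub_mem hg hg') (by rw [map_sub, h, sub_self]))

/-- Functions separate a point from the others. -/
theorem exists_separating (i : Fin n) : ∃ g : CoordRing W, D.ev g i ≠ 0 ∧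
    ∀ l, l ≠ i → D.ev g l = 0 := by
  classical
  have h : ∀ l, ∃ g : CoordRing W, l ≠ i → D.ev g i ≠ 0 ∧ D.ev g l = 0 := by
    intro l
    by_cases hl : D.fst i = D.fst l
    · refine ⟨⟨-C (D.snd l), 1⟩, fun hne => ⟨?_, ?_⟩⟩
      · rw [ev_apply]
        simp only [eval_neg, eval_C, eval_one, one_mul, neg_add_eq_sub]
        exact sub_ne_zero.2 fun h => hne (D.inj _ _ hl h).symm
      · rw [ev_apply]; simp
    · refine ⟨⟨X - C (D.fst l), 0⟩, fun hne => ⟨?_, ?_⟩⟩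
      · rw [ev_apply]; simpa using sub_ne_zero.2 hl
      · rw [ev_apply]; simp
  choose s hs using h
  refine ⟨∏ l ∈ Finset.univ.erase i, s l, ?_, fun l hl => ?_⟩
  · rw [map_prod, Finset.prod_apply]
    exact Finset.prod_ne_zero_iff.2 fun l hl => (hs l (Finset.ne_of_mem_erase hl)).1
  · rw [map_prod, Finset.prod_apply]
    exact Finset.prod_eq_zero (Finset.mem_erase.2 ⟨hl, Finset.mem_univ _⟩) (hs l hl).2

end Points

end EllipticCode

namespace EllipticCode

open Polynomial Module

/-! ### The dual code -/

section Dual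

variable {F : Type*} [Field F] {n : ℕ}

/-- The dual code. -/
def orth (C : Submodule F (Fin n → F)) : Submodule F (Fin n → F) where
  carrier := {c | ∀ d ∈ C, c ⬝ᵥ d = 0}
  zero_mem' d _ := zero_dotProduct d
  add_mem' ha hb d hd := by rw [add_dotProduct, ha d hd, hb d hd, add_zero]
  smul_mem' r a ha d hd := by rw [smul_dotProduct, ha d hd, smul_zero]

theorem mem_orth {C : Submodule F (Fin n → F)} {c : Fin n → F} :
    c ∈ orth C ↔ ∀ d ∈ C, c ⬝ᵥ d = 0 := Iff.rfl

theorem orth_eq_orthogonal (C : Submodule F (Fin n → F)) :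
    orth C = LinearMap.BilinForm.orthogonal (dotProductBilin F F) C := by
  ext c
  rw [mem_orth, LinearMap.BilinForm.mem_orthogonal_iff]
  refine forall₂_congr fun d _ => ?_
  rw [dotProduct_comm]
  rfl

theorem dotProductBilin_nondegenerate :
    (dotProductBilin F F : LinearMap.BilinForm F (Fin n → F)).Nondegenerate := by
  classical
  have h : ∀ c : Fin n → F, (∀ d, c ⬝ᵥ d = 0) → c = 0 := fun c hc => by
    ext i
    simpa using hc (Pi.single i 1)
  exact ⟨fun c hc => h c hc, fun c hc => h c fun d => by rw [dotProduct_comm]; exact hc d⟩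

theorem dotProductBilin_isRefl :
    LinearMap.BilinForm.IsRefl (dotProductBilin F F : LinearMap.BilinForm F (Fin n → F)) :=
  fun c d h => by
    rw [← h]
    exact dotProduct_comm d c

theorem finrank_orth (C : Submodule F (Fin n → F)) : finrank F (orth C) = n - finrank F C := by
  rw [orth_eq_orthogonal, LinearMap.BilinForm.finrank_orthogonal dotProductBilin_nondegenerate,
    finrank_fin_fun]

theorem orth_orth (C : Submodule F (Fin n → F)) : orth (orth C) = C := by
  rw [orth_eq_orthogonal, orth_eq_orthogonal,
    LinearMap.BilinForm.orthogonal_orthogonal dotProductBilin_nondegenerate dotProductBilin_isRefl]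

theorem finrank_le (C : Submodule F (Fin n → F)) : finrank F C ≤ n := by
  simpa using C.finrank_le

theorem orth_anti {A B : Submodule F (Fin n → F)} (h : A ≤ B) : orth B ≤ orth A :=
  fun _ hc d hd => hc d (h hd)

theorem mul_dotProduct_eq (a b c : Fin n → F) : (a * b) ⬝ᵥ c = a ⬝ᵥ (b * c) := by
  simp [dotProduct, mul_assoc]

/-- Componentwise multiplication is self-adjoint for the dot product. This turns the dual of a
product of codes into a condition on multipliers. -/
theorem mem_orth_mul {A B : Submodule F (Fin n → F)} {f : Fin n → F} :
    f ∈ orth (A * B) ↔ ∀ a ∈ A, f * a ∈ orth B := by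
  constructor
  · intro h a ha b hb
    rw [mul_dotProduct_eq]
    exact h _ (Submodule.mul_mem_mul ha hb)
  · intro h d hd
    induction hd using Submodule.mul_induction_on' with
    | mem_mul_mem a ha b hb => rw [← mul_dotProduct_eq]; exact h a ha b hb
    | add x _ y _ hx hy => rw [dotProduct_add, hx, hy, add_zero]

theorem orth_top : orth (⊤ : Submodule F (Fin n → F)) = ⊥ := by
  have h := finrank_orth (⊤ : Submodule F (Fin n → F))
  rw [finrank_top, finrank_fin_fun, Nat.sub_self] at h
  exact Submodule.finrank_eq_zero.1 h

theorem eq_top_of_orth_eq_bot {C : Submodule F (Fin n → F)} (h : orth C = ⊥) : C = ⊤ := by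
  rw [← orth_orth C, h, eq_top_iff]
  intro c _ d hd
  rw [(Submodule.mem_bot F).1 hd, dotProduct_zero]

end Dual

/-! ### Vectors as functionals on the coordinate ring -/

namespace CoordRing

variable {F : Type*} [Field F] {W : WeierstrassCurve F}

theorem sub_coef_smul_mem {m : ℕ} {g u : CoordRing W} (hg : g ∈ V W (m + 1))
    (hu : u ∈ V W (m + 1)) (hu1 : coef W (m + 1) u = 1) :
    g - coef W (m + 1) g • u ∈ V W m :=
  mem_V_of_coef_eq_zero (sub_mem hg (Submodule.smul_mem _ _ hu)) (by
    rw [map_sub, map_smul, hu1, smul_eq_mul, mul_one, sub_self])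

theorem coef_mon_self {m : ℕ} (h1 : m ≠ 1) : coef W m (mon W m) = 1 := by
  rw [coef_mon _ _ h1, if_pos rfl]

/-- The quotient of `V (m + 1)` by `V m` is a line, spanned by the class of the monomial of order `m
+ 1`. -/
theorem eq_coef_mul_of_eq_zero (φ : CoordRing W →ₗ[F] F) {m : ℕ} (hm : ∀ g ∈ V W m, φ g = 0)
    (h1 : m + 1 ≠ 1) {g : CoordRing W} (hg : g ∈ V W (m + 1)) :
    φ g = coef W (m + 1) g * φ (mon W (m + 1)) := by
  have h4 := hm _ (sub_coef_smul_mem hg (mon_mem le_rfl) (coef_mon_self h1))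
  rw [map_sub, map_smul, smul_eq_mul] at h4
  exact sub_eq_zero.1 h4

end CoordRing

open CoordRing

namespace Points

variable {F : Type*} [Field F] {W : WeierstrassCurve F} {n : ℕ} (D : Points W n)

/-- The functional on the coordinate ring given by a vector. -/
noncomputable def pair (c : Fin n → F) : CoordRing W →ₗ[F] F :=
  (dotProductBilin F F c : (Fin n → F) →ₗ[F] F) ∘ₗ D.ev.toLinearMap

theorem pair_apply (c : Fin n → F) (g : CoordRing W) : D.pair c g = c ⬝ᵥ D.ev g := rfl

theorem pair_ev_mul (c : Fin n → F) (f g : CoordRing W) :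
    D.pair (D.ev f * c) g = D.pair c (f * g) := by
  rw [pair_apply, pair_apply, mul_comm, mul_dotProduct_eq, ← map_mul]

theorem pair_sub (c d : Fin n → F) (g : CoordRing W) :
    D.pair (c - d) g = D.pair c g - D.pair d g := by
  simp [pair_apply, sub_dotProduct]

theorem pair_add (c d : Fin n → F) (g : CoordRing W) :
    D.pair (c + d) g = D.pair c g + D.pair d g := by
  simp [pair_apply, add_dotProduct]

theorem pair_smul (r : F) (c : Fin n → F) (g : CoordRing W) :
    D.pair (r • c) g = r * D.pair c g := by
  simp [pair_apply, smul_dotProduct]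

theorem eq_zero_of_pair_eq_zero {c : Fin n → F} (h : ∀ g, D.pair c g = 0) : c = 0 := by
  ext i
  obtain ⟨g, hg, hg'⟩ := D.exists_separating i
  have h1 := h g
  rw [pair_apply, dotProduct, Finset.sum_eq_single i (fun l _ hl => by rw [hg' l hl, mul_zero])
    (fun h => absurd (Finset.mem_univ i) h)] at h1
  exact (mul_eq_zero.1 h1).resolve_right hg

/-- Every functional on the functions of small pole order is given by a vector. -/
theorem exists_pair_eq {m : ℕ} (hm : m < n) (φ : CoordRing W →ₗ[F] F) :
    ∃ c : Fin n → F, ∀ g ∈ V W m, D.pair c g = φ g := by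
  classical
  obtain ⟨s, hs⟩ := LinearMap.exists_leftInverse_of_injective
    (D.ev.toLinearMap.domRestrict (V W m)) (by
      rw [LinearMap.ker_eq_bot, injective_iff_map_eq_zero]
      rintro ⟨g, hg⟩ h
      ext1
      exact D.eq_zero_of_ev_eq_zero hm hg h)
  let ψ : (Fin n → F) →ₗ[F] F := φ ∘ₗ (V W m).subtype ∘ₗ s
  refine ⟨fun i => ψ (Pi.single i 1), fun g hg => ?_⟩
  have h1 : s (D.ev g) = ⟨g, hg⟩ := LinearMap.congr_fun hs ⟨g, hg⟩
  have h2 : ψ (D.ev g) = φ g := by simp [ψ, h1]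
  rw [← h2, pair_apply, dotProduct]
  conv_rhs => rw [← Finset.univ_sum_single (D.ev g), map_sum]
  refine Finset.sum_congr rfl fun i _ => ?_
  have h3 : (Pi.single i (D.ev g i) : Fin n → F) = D.ev g i • Pi.single i 1 := by
    ext l; by_cases h : l = i <;> simp [h]
  rw [h3, map_smul, smul_eq_mul, mul_comm]

theorem mem_orth_map {S : Submodule F (CoordRing W)} {c : Fin n → F} :
    c ∈ orth (S.map D.ev.toLinearMap) ↔ ∀ g ∈ S, D.pair c g = 0 := by
  rw [mem_orth]
  constructor
  · exact fun h g hg => h _ (Submodule.mem_map_of_mem hg)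
  · rintro h _ ⟨g, hg, rfl⟩
    exact h g hg

theorem finrank_map_ev {m : ℕ} (hm : m < n) {S : Submodule F (CoordRing W)} (hS : S ≤ V W m) :
    finrank F (S.map D.ev.toLinearMap) = finrank F S := by
  have hinj : Function.Injective (D.ev.toLinearMap.domRestrict S) := by
    rw [injective_iff_map_eq_zero]
    rintro ⟨g, hg⟩ h
    ext1
    exact D.eq_zero_of_ev_eq_zero hm (hS hg) h
  rw [← LinearMap.finrank_range_of_inj hinj, LinearMap.range_domRestrict]

/-- `D` is equivalent to `n` times the point at infinity: there is a function with divisor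
`D - n O`. The vector `v` is the residue vector of the differential with divisor `n O - D`. -/
structure IsPrincipal (v : Fin n → F) : Prop where
  pair_eq : ∀ g ∈ V W (n + 1), D.pair v g = coef W (n + 1) g
  exists_zero : ∃ h ∈ V W n, coef W n h = 1 ∧ D.ev h = 0

/-- Multiples of `h` have zero values, and their orders are `n` and everything from `n + 2` on.
Hence the functions up to order `n + 1` already decide whether the functional vanishes. -/
theorem pair_eq_zero_of_order {c : Fin n → F} (hn : 2 ≤ n) {h : CoordRing W} (hh : h ∈ V W n)
    (hh1 : coef W n h = 1) (hh0 : D.ev h = 0) (hc : ∀ g ∈ V W (n + 1), D.pair c g = 0) :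
    c = 0 := by
  have key : ∀ m, ∀ g ∈ V W (n + 1 + m), D.pair c g = 0 := by
    intro m
    induction m with
    | zero => exact hc
    | succ m ih =>
      intro g hg
      set r := coef W (n + 1 + (m + 1)) g
      -- The cofactor starts at order 2 because of the gap, which is why the induction begins above
      -- `n + 1`.
      have h1 : h * mon W (m + 2) ∈ V W (n + 1 + (m + 1)) := by
        rw [show n + 1 + (m + 1) = n + (m + 2) by ring]
        exact mul_mem hh (mon_mem le_rfl)
      have h2 : coef W (n + 1 + (m + 1)) (h * mon W (m + 2)) = 1 := by
        rw [show n + 1 + (m + 1) = n + (m + 2) by ring,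
          coef_mul hh (mon_mem le_rfl), hh1, coef_mon _ _ (by omega), if_pos rfl, one_mul]
      have h3 : g - r • (h * mon W (m + 2)) ∈ V W (n + 1 + m) :=
        mem_V_of_coef_eq_zero (sub_mem hg (Submodule.smul_mem _ _ h1)) (by
          rw [map_sub, map_smul]
          change r - r • coef W (n + 1 + (m + 1)) (h * mon W (m + 2)) = 0
          rw [h2, smul_eq_mul, mul_one, sub_self])
      have h4 := ih _ h3
      rwa [map_sub, map_smul, D.pair_apply c (h * _), map_mul, hh0, zero_mul, dotProduct_zero,
        smul_zero, sub_zero] at h4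
  refine D.eq_zero_of_pair_eq_zero fun g => ?_
  obtain ⟨m, hm⟩ := exists_mem_V g
  exact key m g (V_mono (by omega) hm)

/-- Either `D` is equivalent to a multiple of the point at infinity, or there is a vector `v`
which is the coefficient functional of order `n`. -/
theorem isPrincipal_or (hn : 2 ≤ n) : (∃ v, D.IsPrincipal v) ∨
    ∃ v, ∀ g ∈ V W n, D.pair v g = coef W n g := by
  -- The values of `V (n - 1)` form a hyperplane, so some nonzero vector is orthogonal to them.
  have hpos : 0 < finrank F (orth ((V W (n - 1)).map D.ev.toLinearMap)) := by
    rw [finrank_orth, D.finrank_map_ev (Nat.sub_lt (by omega) one_pos) le_rfl,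
      finrank_V _ (by omega)]
    omega
  have : Nontrivial (orth ((V W (n - 1)).map D.ev.toLinearMap)) := finrank_pos_iff.1 hpos
  obtain ⟨⟨v, hv⟩, hv0⟩ := exists_ne (0 : orth ((V W (n - 1)).map D.ev.toLinearMap))
  rw [mem_orth_map] at hv
  have hv0 : v ≠ 0 := fun h => hv0 (Subtype.ext h)
  obtain ⟨N, rfl⟩ : ∃ N, n = N + 1 := ⟨n - 1, by omega⟩
  simp only [Nat.add_sub_cancel] at hv
  have red : ∀ m, (∀ g ∈ V W m, D.pair v g = 0) → m + 1 ≠ 1 → ∀ g ∈ V W (m + 1),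
      D.pair v g = coef W (m + 1) g * D.pair v (mon W (m + 1)) := fun m hm h1 g hg =>
    eq_coef_mul_of_eq_zero (D.pair v) hm h1 hg
  -- The alternative is whether this vector also annihilates the functions of order `n`.
  by_cases hc : D.pair v (mon W (N + 1)) = 0
  · left
    have hvN : ∀ g ∈ V W (N + 1), D.pair v g = 0 := fun g hg => by
      rw [red N hv (by omega) g hg, hc, mul_zero]
    -- If `v` annihilates `V n`, then evaluation on this `n`-dimensional space is not surjective,
    -- hence not injective. A kernel element has order exactly `n`, because lower orders are
    -- determined by their values.
    obtain ⟨h, hh, hh1, hh0⟩ : ∃ h ∈ V W (N + 1), coef W (N + 1) h = 1 ∧ D.ev h = 0 := by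
      have hni : ¬ Function.Injective (D.ev.toLinearMap.domRestrict (V W (N + 1))) := by
        intro hinj
        have h1 := LinearMap.finrank_range_of_inj hinj
        rw [finrank_V _ (by omega), LinearMap.range_domRestrict] at h1
        have h2 : (V W (N + 1)).map D.ev.toLinearMap = ⊤ :=
          Submodule.eq_top_of_finrank_eq (by rw [h1, finrank_fin_fun])
        have h3 : v ∈ orth ((V W (N + 1)).map D.ev.toLinearMap) := (D.mem_orth_map).2 hvN
        rw [h2, orth_top] at h3
        exact hv0 ((Submodule.mem_bot F).1 h3)
      rw [injective_iff_map_eq_zero] at hni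
      push Not at hni
      obtain ⟨⟨h, hh⟩, hh0, hne⟩ := hni
      have hh0 : D.ev h = 0 := hh0
      have hne : h ≠ 0 := fun h0 => hne (Subtype.ext h0)
      have hl : coef W (N + 1) h ≠ 0 := fun hl =>
        hne (D.eq_zero_of_ev_eq_zero N.lt_succ_self (mem_V_of_coef_eq_zero hh hl) hh0)
      refine ⟨(coef W (N + 1) h)⁻¹ • h, Submodule.smul_mem _ _ hh, ?_, ?_⟩
      · rw [map_smul, smul_eq_mul, inv_mul_cancel₀ hl]
      · rw [map_smul, hh0, smul_zero]
    have hc' : D.pair v (mon W (N + 1 + 1)) ≠ 0 := fun h0 =>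
      hv0 (D.pair_eq_zero_of_order hn hh hh1 hh0 fun g hg => by
        rw [red (N + 1) hvN (by omega) g hg, h0, mul_zero])
    refine ⟨(D.pair v (mon W (N + 1 + 1)))⁻¹ • v, fun g hg => ?_, h, hh, hh1, hh0⟩
    rw [pair_smul, red (N + 1) hvN (by omega) g hg]
    field_simp
  · right
    refine ⟨(D.pair v (mon W (N + 1)))⁻¹ • v, fun g hg => ?_⟩
    rw [pair_smul, red N hv (by omega) g hg]
    field_simp

end Points

end EllipticCode

/-! ### The structure of the dual codes and the point that completes the divisor -/

namespace EllipticCode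

open Polynomial Module CoordRing

namespace CoordRing

variable {F : Type*} [Field F] (W : WeierstrassCurve F)

/-- The function `x - a`. -/
noncomputable def xSub (a : F) : CoordRing W := ⟨X - C a, 0⟩

/-- The function `y - b`. -/
noncomputable def ySub (b : F) : CoordRing W := ⟨-C b, 1⟩

/-- The function `(y - b) (y - b') / (x - a)` for conjugate points `(a, b)` and `(a, b')`. -/
noncomputable def cofactor (a : F) : CoordRing W :=
  ⟨X ^ 2 + C (a + W.a₂) * X + C (a ^ 2 + W.a₂ * a + W.a₄), -C W.a₁⟩

/-- The second coordinate of the opposite of the point `(a, b)`. -/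
def negY (a b : F) : F := -b - (W.a₁ * a + W.a₃)

variable {W}

/-- Subtracting the equation at `(a, b)` from the generic equation leaves a multiple of `x - a`. The
identity gives two expressions for the function `(y - b') / (x - a)`. -/
theorem xSub_mul_cofactor {a b : F} (h : OnCurve W a b) :
    xSub W a * cofactor W a = ySub W b * ySub W (negY W a b) := by
  unfold OnCurve at h
  have h' := congrArg (C : F → F[X]) h
  simp only [map_add, map_mul, map_pow] at h'
  ext1
  · simp only [xSub, cofactor, ySub, QuadraticAlgebra.re_mul]
    simp only [negY, cubic, map_add, map_sub, map_mul, map_neg, map_pow]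
    linear_combination h'
  · simp only [xSub, cofactor, ySub, QuadraticAlgebra.im_mul]
    simp only [negY, linear, map_add, map_sub, map_mul, map_neg, map_pow]
    ring

theorem xSub_mem (a : F) : xSub W a ∈ V W 2 := by
  rw [mem_V_iff]
  refine ⟨fun i hi => ?_, fun i _ => by simp [xSub]⟩
  simp only [xSub, coeff_sub, coeff_X, coeff_C]
  rw [if_neg (by omega), if_neg (by omega), sub_zero]

theorem ySub_mem (b : F) : ySub W b ∈ V W 3 := by
  rw [mem_V_iff]
  refine ⟨fun i hi => ?_, fun i hi => ?_⟩
  · simp only [ySub, coeff_neg, coeff_C]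
    rw [if_neg (by omega), neg_zero]
  · simp only [ySub, coeff_one]
    rw [if_neg (by omega)]

theorem cofactor_mem (a : F) : cofactor W a ∈ V W 4 := by
  rw [mem_V_iff]
  refine ⟨fun i hi => ?_, fun i hi => ?_⟩
  · simp only [cofactor, coeff_add, coeff_C_mul, coeff_X_pow, coeff_X, coeff_C]
    rw [if_neg (by omega), if_neg (by omega), if_neg (by omega)]
    simp
  · simp only [cofactor, coeff_neg, coeff_C]
    rw [if_neg (by omega), neg_zero]

theorem coef_two (g : CoordRing W) : coef W 2 g = g.re.coeff 1 := coef_even 1 g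
theorem coef_three (g : CoordRing W) : coef W 3 g = g.im.coeff 0 := coef_odd 0 g
theorem coef_zero (g : CoordRing W) : coef W 0 g = g.re.coeff 0 := coef_even 0 g
theorem coef_four (g : CoordRing W) : coef W 4 g = g.re.coeff 2 := coef_even 2 g

theorem coef_xSub (a : F) : coef W 2 (xSub W a) = 1 := by simp [coef_two, xSub]

theorem coef_ySub (b : F) : coef W 3 (ySub W b) = 1 := by simp [coef_three, ySub]

theorem coef_cofactor (a : F) : coef W 4 (cofactor W a) = 1 := by
  simp only [coef_four, cofactor, coeff_add, coeff_C_mul, coeff_X_pow, coeff_X, coeff_C]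
  simp

theorem mon_two : mon W 2 = ⟨X, 0⟩ := by simpa using mon_even (W := W) 1
theorem mon_three : mon W 3 = ⟨0, 1⟩ := by simpa using mon_odd (W := W) 0

theorem eq_of_mem_V_zero {g : CoordRing W} (hg : g ∈ V W 0) : g = algebraMap F _ (coef W 0 g) := by
  refine ext_coef fun j => ?_
  have h1 : algebraMap F (CoordRing W) (coef W 0 g) = coef W 0 g • mon W 0 := by
    rw [mon_zero, Algebra.algebraMap_eq_smul_one]
  rw [h1, map_smul, coef_mon _ _ (by omega)]
  rcases Nat.eq_zero_or_pos j with rfl | hj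
  · simp
  · rw [hg j hj, if_neg (by omega), smul_zero]

end CoordRing

namespace Points

variable {F : Type*} [Field F] {W : WeierstrassCurve F} {n : ℕ} {D : Points W n}

/-- On products of complementary orders the pairing reads only the leading coefficients, as a
residue at infinity would. -/
theorem pair_mul_eq_coef {v : Fin n → F} {m : ℕ} (hv : ∀ g ∈ V W m, D.pair v g = coef W m g)
    {a b : ℕ} (hab : a + b = m) {f g : CoordRing W} (hf : f ∈ V W a) (hg : g ∈ V W b) :
    D.pair v (f * g) = coef W a f * coef W b g := by
  subst hab
  rw [hv _ (mul_mem hf hg), coef_mul hf hg]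

/-- Functions of order at most 1 are constant. These words supported on two coordinates serve to
detect zero entries of `v` and `w`. -/
theorem pair_single_sub_single (i l : Fin n) :
    ∀ g ∈ V W 1, D.pair (Pi.single i 1 - Pi.single l 1) g = 0 := by
  classical
  intro g hg
  rw [V_one] at hg
  rw [eq_of_mem_V_zero hg, D.pair_sub, D.pair_apply, D.pair_apply, AlgHom.commutes]
  simp

namespace IsPrincipal

variable {v : Fin n → F}

/-- Descending induction on `N`: a multiple of `v` by the monomial of the complementary order
cancels the pairing of `c` at order `N + 1`. Thus the dual of the values of `V N` comes from `V (n -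
N)`. -/
theorem exists_eq_mul (hv : D.IsPrincipal v) (hn : 2 ≤ n) : ∀ (i N : ℕ), N + i = n → 1 ≤ N →
    ∀ c : Fin n → F, (∀ g ∈ V W N, D.pair c g = 0) → ∃ g ∈ V W i, c = D.ev g * v := by
  obtain ⟨hv1, h, hh, hh1, hh0⟩ := hv
  have base : ∀ c : Fin n → F, (∀ g ∈ V W n, D.pair c g = 0) → ∃ g ∈ V W 0, c = D.ev g * v := by
    intro c hc
    refine ⟨D.pair c (mon W (n + 1)) • 1, Submodule.smul_mem _ _
      (by rw [← mon_zero]; exact mon_mem le_rfl), ?_⟩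
    rw [map_smul, map_one, smul_mul_assoc, one_mul]
    refine sub_eq_zero.1 (D.pair_eq_zero_of_order hn hh hh1 hh0 fun g hg => ?_)
    rw [pair_sub, pair_smul, hv1 g hg, eq_coef_mul_of_eq_zero (D.pair c) hc (by omega) hg, mul_comm,
      sub_self]
  intro i
  induction i with
  | zero =>
    rintro N rfl - c hc
    exact base c hc
  | succ i ih =>
    rintro N rfl hN c hc
    -- The first step would need a monomial of order 1. Instead `h`, whose values vanish, shows that
    -- annihilating `V (n - 1)` already implies annihilating `V n`.
    rcases Nat.eq_zero_or_pos i with rfl | hi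
    · obtain ⟨g, hg, rfl⟩ := base c fun g hg => by
        have h3 := hc _ (sub_coef_smul_mem hg hh hh1)
        rw [map_sub, map_smul, pair_apply, pair_apply, hh0, dotProduct_zero, smul_zero,
          sub_zero] at h3
        exact h3
      exact ⟨g, V_mono (by omega) hg, rfl⟩
    · set γ := D.pair c (mon W (N + 1))
      have hm : mon W (i + 1) ∈ V W (i + 1) := mon_mem le_rfl
      obtain ⟨g, hg, hg'⟩ := ih (N + 1) (by ring) (by omega) (c - γ • (D.ev (mon W (i + 1)) * v))
        fun g hg => by
          rw [pair_sub, pair_smul, pair_ev_mul,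
            pair_mul_eq_coef hv1 (by omega) hm hg, coef_mon_self (by omega),
            eq_coef_mul_of_eq_zero (D.pair c) hc (by omega) hg]
          ring
      refine ⟨g + γ • mon W (i + 1), add_mem (V_mono (by omega) hg) (Submodule.smul_mem _ _ hm), ?_⟩
      rw [map_add, map_smul, add_mul, ← hg', smul_mul_assoc, sub_add_cancel]

/-- A zero entry of `v` would be a zero entry of every word orthogonal to the constants, and a
difference of two unit vectors contradicts this. -/
theorem ne_zero (hv : D.IsPrincipal v) (hn : 2 ≤ n) (i : Fin n) : v i ≠ 0 := by
  classical
  have : Nontrivial (Fin n) := Fin.nontrivial_iff_two_le.2 hn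
  obtain ⟨l, hl⟩ := exists_ne i
  obtain ⟨g, -, hg⟩ := hv.exists_eq_mul hn (n - 1) 1 (by omega) le_rfl _
    (pair_single_sub_single (D := D) i l)
  intro h0
  have := congrFun hg i
  simp [h0, hl.symm] at this

end IsPrincipal

/-- `v` and `w` are the coefficient functionals of order `n` and `n - 1`, and the divisor `D` is
equivalent to `(n - 1) O` plus the point `(a, b)`. -/
structure IsDual (D : Points W n) (v w : Fin n → F) (a b : F) : Prop where
  pair_left : ∀ g ∈ V W n, D.pair v g = coef W n g
  pair_right : ∀ g ∈ V W (n - 1), D.pair w g = coef W (n - 1) g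
  onCurve : OnCurve W a b
  xSub_mul : D.ev (xSub W a) * w = D.ev (ySub W (negY W a b)) * v
  ySub_mul : D.ev (ySub W b) * w = D.ev (cofactor W a) * v

section

variable {v w : Fin n → F} (hv : ∀ g ∈ V W n, D.pair v g = coef W n g)
  (hw : ∀ g ∈ V W (n - 1), D.pair w g = coef W (n - 1) g)

include hv

/-- Pairing with `v` reads the coefficient of order `n` off the values, so evaluation is injective,
hence bijective, on `V n`. -/
theorem eq_zero_of_pair_eq_zero' (hn : 2 ≤ n) {c : Fin n → F} (hc : ∀ g ∈ V W n, D.pair c g = 0) :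
    c = 0 := by
  obtain ⟨N, rfl⟩ : ∃ N, n = N + 1 := ⟨n - 1, by omega⟩
  have hinj : Function.Injective (D.ev.toLinearMap.domRestrict (V W (N + 1))) := by
    rw [injective_iff_map_eq_zero]
    rintro ⟨g, hg⟩ h
    have h : D.ev g = 0 := h
    ext1
    have h1 := hv g hg
    rw [pair_apply, h, dotProduct_zero] at h1
    exact D.eq_zero_of_ev_eq_zero N.lt_succ_self (mem_V_of_coef_eq_zero hg h1.symm) h
  have h1 := LinearMap.finrank_range_of_inj hinj
  rw [finrank_V _ (by omega), LinearMap.range_domRestrict] at h1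
  have h2 : (V W (N + 1)).map D.ev.toLinearMap = ⊤ :=
    Submodule.eq_top_of_finrank_eq (by rw [h1, finrank_fin_fun])
  have h3 : c ∈ orth ((V W (N + 1)).map D.ev.toLinearMap) := (D.mem_orth_map).2 hc
  rw [h2, orth_top] at h3
  exact (Submodule.mem_bot F).1 h3

include hw

/-- The same descending induction as in the principal case, with `w` replacing the missing monomial
of order 1 times `v`. -/
theorem exists_eq_mul_add_smul (hn : 3 ≤ n) : ∀ (i N : ℕ), N + (i + 2) = n → 1 ≤ N →
    ∀ c : Fin n → F, (∀ g ∈ V W N, D.pair c g = 0) →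
      ∃ g ∈ V W (i + 1), ∃ r : F, c = D.ev g * v + r • w := by
  have base : ∀ c : Fin n → F, (∀ g ∈ V W (n - 1), D.pair c g = 0) →
      ∃ g ∈ V W 0, c = D.ev g * v := by
    intro c hc
    obtain ⟨N, rfl⟩ : ∃ N, n = N + 1 := ⟨n - 1, by omega⟩
    rw [Nat.add_sub_cancel] at hc
    refine ⟨D.pair c (mon W (N + 1)) • 1, Submodule.smul_mem _ _
      (by rw [← mon_zero]; exact mon_mem le_rfl), ?_⟩
    rw [map_smul, map_one, smul_mul_assoc, one_mul]
    refine sub_eq_zero.1 (eq_zero_of_pair_eq_zero' hv (by omega) fun g hg => ?_)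
    rw [pair_sub, pair_smul, hv g hg, eq_coef_mul_of_eq_zero (D.pair c) hc (by omega) hg, mul_comm,
      sub_self]
  have comb : ∀ {c f g h : Fin n → F}, c - f = g + h → c = g + f + h := fun h => by
    rw [sub_eq_iff_eq_add.1 h]; ring
  intro i
  induction i with
  | zero =>
    rintro N rfl hN c hc
    obtain ⟨g, hg, hg'⟩ := base (c - D.pair c (mon W (N + 1)) • w) fun g hg => by
      rw [show N + (0 + 2) - 1 = N + 1 by omega] at hg hw
      rw [pair_sub, pair_smul, hw g hg,
        eq_coef_mul_of_eq_zero (D.pair c) hc (by omega) hg, mul_comm, sub_self]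
    exact ⟨g, V_mono (by omega) hg, D.pair c (mon W (N + 1)), by rw [← hg', sub_add_cancel]⟩
  | succ i ih =>
    rintro N rfl hN c hc
    set γ := D.pair c (mon W (N + 1))
    have hm : mon W (i + 2) ∈ V W (i + 2) := mon_mem le_rfl
    obtain ⟨g, hg, r, hg'⟩ := ih (N + 1) (by ring) (by omega) (c - γ • (D.ev (mon W (i + 2)) * v))
      fun g hg => by
        rw [pair_sub, pair_smul, pair_ev_mul,
          pair_mul_eq_coef hv (by omega) hm hg, coef_mon_self (by omega),
          eq_coef_mul_of_eq_zero (D.pair c) hc (by omega) hg]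
        ring
    refine ⟨g + γ • mon W (i + 2), add_mem (V_mono (by omega) hg) (Submodule.smul_mem _ _ hm), r, ?_⟩
    rw [map_add, map_smul, add_mul, smul_mul_assoc]
    exact comb hg'

/-- Testing against the monomial complementary to the leading term of `B` isolates its leading
coefficient, while `w` reacts only at order `n - 1`, complementary to the gap. -/
theorem smul_eq_ev_mul {m : ℕ} (hn : 3 ≤ n) (hm : m + 2 ≤ n) {B : CoordRing W} (hB : B ∈ V W m) {r : F}
    (h : r • w = D.ev B * v) : r = 0 ∧ B = 0 := by
  have key : ∀ u, D.pair (r • w) u = D.pair v (B * u) := fun u => by rw [h, pair_ev_mul]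
  have hB0 : B = 0 := by
    by_contra h0
    obtain ⟨d, hd, hd1, hBd, hBd'⟩ := exists_order hB h0
    have hdn : d + (n - d) = n := by omega
    have h1 := key (mon W (n - d))
    rw [pair_mul_eq_coef hv (a := d) (b := n - d) hdn hBd (mon_mem le_rfl),
      coef_mon_self (by omega), mul_one] at h1
    -- For a constant `B` the complementary order is `n`, where `w` is not controlled; the test at
    -- order `n - 1` first gives `r = 0`.
    rcases Nat.eq_zero_or_pos d with rfl | hd0
    · have h2 := key (mon W (n - 1))
      rw [pair_smul, hw _ (mon_mem le_rfl), coef_mon_self (m := n - 1) (by omega),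
        hv _ (V_mono (by omega) (mul_mem hBd (mon_mem (le_refl (n - 1))))),
        mul_mem hBd (mon_mem (le_refl (n - 1))) n (by omega), mul_one] at h2
      rw [h2, zero_smul, pair_apply, zero_dotProduct] at h1
      exact hBd' h1.symm
    · rw [pair_smul, hw _ (mon_mem (by omega)), coef_mon _ _ (by omega), if_neg (by omega),
        mul_zero] at h1
      exact hBd' h1.symm
  refine ⟨?_, hB0⟩
  have h2 := key (mon W (n - 1))
  rw [pair_smul, hw _ (mon_mem le_rfl), coef_mon_self (m := n - 1) (by omega), hB0, zero_mul, map_zero,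
    mul_one] at h2
  exact h2

end

/-- The words `x w - y v` and `y w - x² v` annihilate large spaces, so they are small combinations
of `v` and `w`. After normalising `w` this gives multiplication rules for `x` and `y` on `w`, whose
compatibility forces their constants to be a point of the curve and its opposite. -/
theorem exists_isDual {v : Fin n → F} (hn : 9 ≤ n) (hv : ∀ g ∈ V W n, D.pair v g = coef W n g) :
    ∃ w a b, D.IsDual v w a b := by
  obtain ⟨N, rfl⟩ : ∃ N, n = N + 9 := ⟨n - 9, by omega⟩
  obtain ⟨w₀, hw₀⟩ := D.exists_pair_eq (m := N + 9 - 1) (by omega) (coef W (N + 9 - 1))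
  obtain ⟨g, hg, r, hgr⟩ := exists_eq_mul_add_smul hv hw₀ (by omega) 1 (N + 6) (by ring) (by omega)
    (D.ev (mon W 2) * w₀ - D.ev (mon W 3) * v) fun g hg => by
      rw [pair_sub, pair_ev_mul, pair_ev_mul, hw₀ _ (V_mono (by omega) (mul_mem (mon_mem le_rfl) hg)),
        pair_mul_eq_coef hv (a := 3) (b := N + 6) (by ring) (mon_mem le_rfl) hg,
        show N + 9 - 1 = 2 + (N + 6) by omega, coef_mul (mon_mem le_rfl) hg,
        coef_mon_self (by omega), coef_mon_self (by omega), sub_self]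
  set c := coef W 2 g
  set d := coef W 0 g
  have hge : g = c • mon W 2 + d • 1 := by
    have h1 : g - c • mon W 2 ∈ V W 1 :=
      sub_coef_smul_mem hg (mon_mem le_rfl) (coef_mon_self (by omega))
    rw [V_one] at h1
    have h2 := eq_of_mem_V_zero h1
    rw [map_sub, map_smul, coef_mon _ _ (by omega), if_neg (by omega), smul_zero, sub_zero,
      Algebra.algebraMap_eq_smul_one, sub_eq_iff_eq_add'] at h2
    exact h2
  -- Subtracting `c v` removes the multiple of `x v` from the product of `x` with `w₀`.
  set w := w₀ - c • v with hwdef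
  have hw : ∀ g ∈ V W (N + 9 - 1), D.pair w g = coef W (N + 9 - 1) g := fun g hg => by
    rw [hwdef, pair_sub, pair_smul, hw₀ g hg, hv g (V_mono (Nat.sub_le _ _) hg),
      hg (N + 9) (by omega), mul_zero, sub_zero]
  set b' := -(d + r * c) with hb'
  have e1 : D.ev (xSub W r) * w = D.ev (ySub W b') * v := by
    have e1 : xSub W r = mon W 2 - r • 1 := by
      rw [mon_two, ← mon_zero, mon]
      ext1 <;> simp [xSub, smul_eq_C_mul]
    have e2 : ySub W b' = mon W 3 - b' • 1 := by
      rw [mon_three, ← mon_zero, mon]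
      ext1 <;> simp [ySub, smul_eq_C_mul]
    rw [hge, sub_eq_iff_eq_add] at hgr
    rw [e1, e2, hwdef, hb']
    ext i
    have := congrFun hgr i
    simp only [map_sub, map_add, map_smul, map_one, Pi.mul_apply, Pi.add_apply, Pi.sub_apply,
      Pi.smul_apply, smul_eq_mul, Pi.one_apply] at this ⊢
    linear_combination this
  obtain ⟨l, hl, b, hlb⟩ := exists_eq_mul_add_smul hv hw (by omega) 2 (N + 5) (by ring) (by omega)
    (D.ev (mon W 3) * w - D.ev (mon W 4) * v) fun g hg => by
      rw [pair_sub, pair_ev_mul, pair_ev_mul, hw _ (V_mono (by omega) (mul_mem (mon_mem le_rfl) hg)),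
        pair_mul_eq_coef hv (a := 4) (b := N + 5) (by ring) (mon_mem le_rfl) hg,
        show N + 9 - 1 = 3 + (N + 5) by omega, coef_mul (mon_mem le_rfl) hg,
        coef_mon_self (by omega), coef_mon_self (by omega), sub_self]
  have e2 : D.ev (ySub W b) * w = D.ev (mon W 4 + l) * v := by
    have e2 : ySub W b = mon W 3 - b • 1 := by
      rw [mon_three, ← mon_zero, mon]
      ext1 <;> simp [ySub, smul_eq_C_mul]
    rw [sub_eq_iff_eq_add] at hlb
    rw [e2]
    ext i
    have := congrFun hlb i
    simp only [map_sub, map_add, map_smul, map_one, Pi.mul_apply, Pi.add_apply, Pi.sub_apply,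
      Pi.smul_apply, smul_eq_mul, Pi.one_apply] at this ⊢
    linear_combination this
  have hl4 : mon W 4 + l ∈ V W 4 := add_mem (mon_mem le_rfl) (V_mono (by omega) hl)
  -- Both sides agree after multiplication by `v`, since the two rules express `(x - r) (y - b) w`
  -- in two ways; the uniqueness lemma removes `v`.
  have e3 : xSub W r * (mon W 4 + l) = ySub W b * ySub W b' := by
    refine sub_eq_zero.1 (smul_eq_ev_mul hv hw (m := 6) (r := 0) (by omega) (by omega)
      (sub_mem (mul_mem (xSub_mem r) hl4) (mul_mem (ySub_mem b) (ySub_mem b'))) ?_).2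
    rw [zero_smul, map_sub, map_mul, map_mul, sub_mul, mul_assoc, ← e2, mul_assoc, ← e1]
    ring
  have e3r := congrArg QuadraticAlgebra.re e3
  have e3i := congrArg QuadraticAlgebra.im e3
  simp only [xSub, ySub, mon_even 2, QuadraticAlgebra.re_mul, QuadraticAlgebra.im_mul,
    QuadraticAlgebra.re_add, QuadraticAlgebra.im_add] at e3r e3i
  simp only [linear, cubic] at e3r e3i
  -- Substituting `x = r` kills the left side; the coefficient of `y` and the constant part then
  -- give the opposite point and the equation of the curve.
  have hb : b' = negY W r b := by
    have := congrArg (eval r) e3i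
    simp only [eval_add, eval_mul, eval_sub, eval_neg, eval_C, eval_X, eval_one, eval_zero] at this
    rw [negY]
    linear_combination this
  have hon : OnCurve W r b := by
    have := congrArg (eval r) e3r
    simp only [eval_add, eval_mul, eval_sub, eval_neg, eval_C, eval_X, eval_one, eval_zero,
      eval_pow] at this
    rw [hb, negY] at this
    unfold OnCurve
    linear_combination this
  refine ⟨w, r, b, hv, hw, hon, hb ▸ e1, ?_⟩
  rw [e2, ← mul_left_cancel₀ (a := xSub W r) (b := mon W 4 + l) (c := cofactor W r) ?_ ?_]
  · intro h
    have := coef_xSub (W := W) r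
    rw [h, map_zero] at this
    exact zero_ne_one this
  · rw [e3, xSub_mul_cofactor hon, hb]

/-- The vectors `v` and `w` have no common zero, by the test words supported on two coordinates. -/
theorem IsDual.ne_zero {v w : Fin n → F} {a b : F} (h : D.IsDual v w a b) (hn : 3 ≤ n) (i : Fin n)
    (hvi : v i = 0) : w i ≠ 0 := by
  classical
  have : Nontrivial (Fin n) := Fin.nontrivial_iff_two_le.2 (by omega)
  obtain ⟨l, hl⟩ := exists_ne i
  obtain ⟨g, -, r, hg⟩ := exists_eq_mul_add_smul h.pair_left h.pair_right hn (n - 3) 1 (by omega)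
    le_rfl _ (pair_single_sub_single (D := D) i l)
  intro h0
  have := congrFun hg i
  simp [hvi, h0, hl.symm] at this

end Points

end EllipticCode

/-! ### The conductor of a twisted code when `D` is equivalent to `n O` -/

namespace EllipticCode

open Polynomial Module CoordRing

namespace CoordRing

variable {F : Type*} [Field F] {W : WeierstrassCurve F}

theorem mem_V_of_mul_mem {b c : ℕ} {g u : CoordRing W} (hu : u ∈ V W b) (hu1 : coef W b u ≠ 0)
    (h : g * u ∈ V W (c + b)) : g ∈ V W c := by
  by_cases h0 : g = 0
  · rw [h0]; exact zero_mem _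
  obtain ⟨l, hl⟩ := exists_mem_V g
  obtain ⟨d, -, -, hd, hd'⟩ := exists_order hl h0
  refine V_mono ?_ hd
  by_contra! hlt
  have h1 := h (d + b) (by omega)
  rw [coef_mul hd hu] at h1
  exact mul_ne_zero hd' hu1 h1

theorem mon_two_mul (g : CoordRing W) : mon W 2 * g = ⟨X * g.re, X * g.im⟩ := by
  rw [mon_two]
  ext1 <;> simp

theorem coef_zero_mon_two_mul (g : CoordRing W) : coef W 0 (mon W 2 * g) = 0 := by
  rw [mon_two_mul, coef_zero]; simp

theorem coef_mon_two_mul (m : ℕ) (g : CoordRing W) :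
    coef W (m + 2) (mon W 2 * g) = coef W m g := by
  rw [mon_two_mul]
  rcases order_cases m with ⟨i, rfl⟩ | rfl | ⟨i, rfl⟩
  · rw [show 2 * i + 2 = 2 * (i + 1) by ring, coef_even, coef_even, coeff_X_mul]
  · rw [coef_three]; simp
  · rw [show 2 * i + 3 + 2 = 2 * (i + 1) + 3 by ring, coef_odd, coef_odd, coeff_X_mul]

theorem coef_three_mon_two_mul (g : CoordRing W) : coef W 3 (mon W 2 * g) = 0 := by
  rw [coef_mon_two_mul 1, coef_one]

/-- Divisibility by `x` means that both components have no constant term, and these terms sit at the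
orders 0 and 3. -/
theorem exists_eq_mon_two_mul {m : ℕ} {g : CoordRing W} (hg : g ∈ V W (m + 2))
    (h0 : coef W 0 g = 0) (h3 : coef W 3 g = 0) : ∃ g₁ ∈ V W m, g = mon W 2 * g₁ := by
  have h : g = mon W 2 * ⟨g.re.divX, g.im.divX⟩ := by
    rw [mon_two_mul]
    have e1 := X_mul_divX_add g.re
    have e2 := X_mul_divX_add g.im
    rw [← coef_zero, h0, C_0, add_zero] at e1
    rw [← coef_three, h3, C_0, add_zero] at e2
    ext1
    · exact e1.symm
    · exact e2.symm
  refine ⟨_, mem_V_of_mul_mem (mon_mem le_rfl) ?_ (b := 2) ?_, h⟩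
  · rw [coef_mon_self (by omega)]; exact one_ne_zero
  · rwa [mul_comm, ← h]

/-- The coefficient functional whose kernel is the defining set of a twisted code. -/
noncomputable def twist (W : WeierstrassCurve F) (k t : ℕ) (η : F) : CoordRing W →ₗ[F] F :=
  coef W t - η • coef W (k + 1)

variable {k t : ℕ} {η : F}

theorem twist_apply (g : CoordRing W) : twist W k t η g = coef W t g - η * coef W (k + 1) g := rfl

theorem twist_of_mem {g : CoordRing W} (hg : g ∈ V W k) : twist W k t η g = coef W t g := by
  rw [twist_apply, hg (k + 1) k.lt_succ_self, mul_zero, sub_zero]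

/-- The space of functions that defines a twisted code. -/
noncomputable def twistSpace (W : WeierstrassCurve F) (k t : ℕ) (η : F) :
    Submodule F (CoordRing W) :=
  V W (k + 1) ⊓ LinearMap.ker (twist W k t η)

end CoordRing

namespace Points

variable {F : Type*} [Field F] {W : WeierstrassCurve F} {n : ℕ} (D : Points W n)

/-- The twisted code. -/
noncomputable def twistCode (k t : ℕ) (η : F) : Submodule F (Fin n → F) :=
  (twistSpace W k t η).map D.ev.toLinearMap

variable {D}
variable {k t : ℕ} {η : F}

theorem mem_orth_twistCode {c : Fin n → F} :
    c ∈ orth (D.twistCode k t η) ↔ ∀ g ∈ twistSpace W k t η, D.pair c g = 0 :=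
  D.mem_orth_map

theorem exists_pair_eq_twist (hk : k + 1 < n) :
    ∃ z, ∀ g ∈ V W (k + 1), D.pair z g = twist W k t η g :=
  D.exists_pair_eq hk _

theorem mem_orth_twistCode_of_pair_eq {z : Fin n → F}
    (hz : ∀ g ∈ V W (k + 1), D.pair z g = twist W k t η g) : z ∈ orth (D.twistCode k t η) :=
  mem_orth_twistCode.2 fun g hg => by rw [hz g hg.1]; exact hg.2

/-- The vectors that multiply the dual of the twisted code into the twisted code. -/
noncomputable def conductor (D : Points W n) (k t : ℕ) (η : F) : Submodule F (Fin n → F) :=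
  orth (orth (D.twistCode k t η) * orth (D.twistCode k t η))

theorem exists_eq_ev_of_mem_conductor {f c : Fin n → F} (hf : f ∈ D.conductor k t η)
    (hc : c ∈ orth (D.twistCode k t η)) :
    ∃ s ∈ V W (k + 1), twist W k t η s = 0 ∧ f * c = D.ev s := by
  have h := mem_orth_mul.1 hf c hc
  rw [orth_orth] at h
  obtain ⟨s, ⟨hs, hs'⟩, h⟩ := h
  exact ⟨s, hs, hs', h.symm⟩

theorem dotProduct_eq_zero_of_mem_conductor {f c d : Fin n → F} (hf : f ∈ D.conductor k t η)
    (hc : c ∈ orth (D.twistCode k t η)) (hd : d ∈ orth (D.twistCode k t η)) :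
    f ⬝ᵥ (c * d) = 0 :=
  hf _ (Submodule.mul_mem_mul hc hd)

/-- The numerical conditions on the length `n`, the dimension `k` and the order `t` of the twist
of a twisted code of high rate; `j` is the dimension of the dual code. -/
structure HighRate (n k t j m : ℕ) : Prop where
  hn : n + 2 = 2 * j + m
  hk : k + 2 = j + m
  hj : 4 ≤ j
  hm : 6 ≤ m
  ht : t ≤ k
  ht1 : t ≠ 1
  par : t % 2 = k % 2

variable {j m : ℕ}

namespace IsPrincipal

variable {v : Fin n → F}

/-- The products have order at most `(j - 1) + (k + 1) = n`, below the order `n + 1` that `v` reads.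
These words span all but one dimension of the dual code. -/
theorem ev_mul_mem_orth (hv : D.IsPrincipal v) (hr : HighRate n k t j m) {u : CoordRing W}
    (hu : u ∈ V W (j - 1)) : D.ev u * v ∈ orth (D.twistCode k t η) := by
  obtain ⟨hn, hk, hj, hm, ht, ht1, par⟩ := hr
  refine mem_orth_twistCode.2 fun g hg => ?_
  have h := mul_mem hu hg.1
  rw [pair_ev_mul, hv.pair_eq _ (V_mono (by omega) h)]
  exact h _ (by omega)

/-- Since `v` lies in the dual code, `f v` is the value vector of some `g`. Comparing values of `g
u` with the code for further `u` bounds the order of `g` and transfers the twist relation to the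
products. -/
theorem exists_of_mem_conductor (hv : D.IsPrincipal v) (hr : HighRate n k t j m)
    {f : Fin n → F} (hf : f ∈ D.conductor k t η) :
    ∃ g ∈ V W m, f * v = D.ev g ∧ ∀ u ∈ V W (j - 1), twist W k t η (g * u) = 0 := by
  have hv' := @ev_mul_mem_orth _ _ _ _ _ _ _ η _ _ _ hv hr
  obtain ⟨hn, hk, hj, hm, ht, ht1, par⟩ := hr
  have step : ∀ u ∈ V W (j - 1), ∃ s ∈ V W (k + 1), twist W k t η s = 0 ∧
      f * (D.ev u * v) = D.ev s := fun u hu => exists_eq_ev_of_mem_conductor hf (hv' hu)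
  obtain ⟨g, hg, -, hfg⟩ := step (mon W 0) (mon_mem (by omega))
  rw [mon_zero, map_one, one_mul] at hfg
  have step : ∀ l, ∀ u ∈ V W (j - 1), l < n → g * u ∈ V W l →
      g * u ∈ V W (k + 1) ∧ twist W k t η (g * u) = 0 := fun l u hu hl hgu => by
    obtain ⟨s, hs, hs', h⟩ := step u hu
    have h1 : g * u = s := D.eq_of_ev_eq (m := max l (k + 1)) (by omega)
      (V_mono (le_max_left _ _) hgu) (V_mono (le_max_right _ _) hs) (by
        rw [map_mul, ← h, ← hfg]; ring)
    rw [h1]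
    exact ⟨hs, hs'⟩
  -- The largest `u` cannot be used at once: its product with `g` might have order `n`, where values
  -- no longer determine functions. Multiplying by `x` first saves two orders.
  have h2 : g ∈ V W (k - 1) := by
    have := (step (k + 3) (mon W 2) (mon_mem (by omega)) (by omega)
      (V_mono (by omega) (mul_mem hg (mon_mem (le_refl 2))))).1
    rw [show k + 1 = k - 1 + 2 by omega] at this
    exact mem_V_of_mul_mem (mon_mem le_rfl) (by rw [coef_mon_self (by omega)]; exact one_ne_zero) this
  have h3 : g ∈ V W m := by
    have := (step (k - 1 + (j - 1)) (mon W (j - 1)) (mon_mem le_rfl) (by omega)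
      (mul_mem h2 (mon_mem (le_refl (j - 1))))).1
    rw [show k + 1 = m + (j - 1) by omega] at this
    exact mem_V_of_mul_mem (mon_mem le_rfl) (by rw [coef_mon_self (by omega)]; exact one_ne_zero) this
  exact ⟨g, h3, hfg, fun u hu => (step (m + (j - 1)) u hu (by omega) (mul_mem h3 hu)).2⟩

/-- The functions that correspond to the elements of the conductor. -/
noncomputable def conductorFun (D : Points W n) (v : Fin n → F) (k t : ℕ) (η : F) (m : ℕ) :
    Submodule F (CoordRing W) :=
  V W m ⊓ ((D.conductor k t η).map (LinearMap.mulRight F v)).comap D.ev.toLinearMap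

theorem mem_conductorFun {g : CoordRing W} :
    g ∈ conductorFun D v k t η m ↔ g ∈ V W m ∧ ∃ f ∈ D.conductor k t η, f * v = D.ev g := Iff.rfl

theorem finrank_conductor_le (hv : D.IsPrincipal v) (hr : HighRate n k t j m) :
    finrank F (D.conductor k t η) ≤ finrank F (conductorFun D v k t η m) := by
  have hn : 2 ≤ n := by have := hr.hn; have := hr.hj; omega
  have hinj : Function.Injective (LinearMap.mulRight F v : (Fin n → F) →ₗ[F] _) := fun a b h => by
    ext i
    exact mul_right_cancel₀ (hv.ne_zero hn i) (congrFun h i)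
  rw [(Submodule.equivMapOfInjective _ hinj (D.conductor k t η)).finrank_eq]
  have : FiniteDimensional F (conductorFun D v k t η m) :=
    Submodule.finiteDimensional_of_le inf_le_left
  refine (Submodule.finrank_mono ?_).trans
    (Submodule.finrank_map_le D.ev.toLinearMap (conductorFun D v k t η m))
  rintro _ ⟨f, hf, rfl⟩
  obtain ⟨g, hg, hfg, -⟩ := hv.exists_of_mem_conductor hr hf
  exact ⟨g, ⟨hg, f, hf, hfg⟩, hfg.symm⟩

theorem twist_mul_eq_zero (hv : D.IsPrincipal v) (hr : HighRate n k t j m) {g : CoordRing W}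
    (hg : g ∈ conductorFun D v k t η m) {u : CoordRing W} (hu : u ∈ V W (j - 1)) :
    twist W k t η (g * u) = 0 := by
  obtain ⟨hg, f, hf, hfg⟩ := mem_conductorFun.1 hg
  obtain ⟨g', hg', hfg', h⟩ := hv.exists_of_mem_conductor hr hf
  rw [D.eq_of_ev_eq (by have := hr.hn; have := hr.hj; omega) hg hg' (hfg.symm.trans hfg')]
  exact h u hu

variable (W k t η) in
/-- The functional `g ↦ twist (g * u)` for the monomial `u` of order `b`. -/
noncomputable def twistMul (b : ℕ) : CoordRing W →ₗ[F] F :=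
  twist W k t η ∘ₗ LinearMap.mulRight F (mon W b)

theorem twistMul_apply (b : ℕ) (g : CoordRing W) :
    twistMul W k t η b g = twist W k t η (g * mon W b) := rfl

theorem twistMul_of_lt {a b : ℕ} {g : CoordRing W} (hg : g ∈ V W a) (hab : a + b < t)
    (htk : t ≤ k) : twistMul W k t η b g = 0 := by
  have h := mul_mem hg (mon_mem (le_refl b))
  rw [twistMul_apply, twist_of_mem (V_mono (by omega) h), h _ hab]

theorem twistMul_of_eq {a b : ℕ} {g : CoordRing W} (hg : g ∈ V W a) (hg1 : coef W a g = 1)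
    (hb : b ≠ 1) (hab : a + b = t) (htk : t ≤ k) : twistMul W k t η b g = 1 := by
  have hm : mon W b ∈ V W b := mon_mem le_rfl
  rw [twistMul_apply, twist_of_mem (V_mono (by omega) (mul_mem hg hm)), ← hab, coef_mul hg hm, hg1,
    coef_mon_self hb, one_mul]

section

variable (hv : D.IsPrincipal v) (hr : HighRate n k t j m)
include hv hr

/-- Monomials of complementary orders make the functionals triangular: orders with sum below `t`
give 0, orders with sum `t` give 1. -/
theorem finrank_conductorFun_add_three_le {b₁ b₂ b₃ a₁ a₂ a₃ : ℕ} (h₁ : a₁ + b₁ = t)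
    (h₂ : a₂ + b₂ = t) (h₃ : a₃ + b₃ = t) (hb₁ : b₁ < b₂) (hb₂ : b₂ < b₃) (hb₃ : b₃ < j)
    (ha₁ : a₁ ≤ m) (ha : a₁ ≠ 1 ∧ a₂ ≠ 1 ∧ a₃ ≠ 1) (hb : b₁ ≠ 1 ∧ b₂ ≠ 1 ∧ b₃ ≠ 1) :
    finrank F (conductorFun D v k t η m) + 3 ≤ m := by
  have key : ∀ b < j, ∀ g ∈ conductorFun D v k t η m, twistMul W k t η b g = 0 :=
    fun b hb g hg => hv.twist_mul_eq_zero hr hg (mon_mem (by omega))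
  have ht := hr.ht
  conv_rhs => rw [← finrank_V (W := W) m (by have := hr.hm; omega)]
  refine finrank_add_three_le inf_le_left (twistMul W k t η b₁) (twistMul W k t η b₂)
    (twistMul W k t η b₃) (key _ (by omega)) (key _ (by omega)) (key _ hb₃) (u₁ := mon W a₁)
    (u₂ := mon W a₂) (u₃ := mon W a₃) (mon_mem ha₁) (mon_mem (by omega)) (mon_mem (by omega))
    ?_ ?_ ?_ ?_ ?_ ?_
  · rw [twistMul_of_eq (mon_mem le_rfl) (coef_mon_self ha.1) hb.1 h₁ ht]; exact one_ne_zero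
  · exact twistMul_of_lt (mon_mem le_rfl) (by omega) ht
  · exact twistMul_of_lt (mon_mem le_rfl) (by omega) ht
  · rw [twistMul_of_eq (mon_mem le_rfl) (coef_mon_self ha.2.1) hb.2.1 h₂ ht]; exact one_ne_zero
  · exact twistMul_of_lt (mon_mem le_rfl) (by omega) ht
  · rw [twistMul_of_eq (mon_mem le_rfl) (coef_mon_self ha.2.2) hb.2.2 h₃ ht]; exact one_ne_zero

/-- The case of a twist at the order `k`. -/
theorem finrank_conductorFun_of_eq (htk : t = k) :
    finrank F (conductorFun D v k t η m) + 3 ≤ m := by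
  have key : ∀ b < j, ∀ g ∈ conductorFun D v k t η m, twistMul W k t η b g = 0 :=
    fun b hb g hg => hv.twist_mul_eq_zero hr hg (mon_mem (by omega))
  obtain ⟨hn, hk, hj, hm, ht, ht1, par⟩ := hr
  -- The remaining dual word represents the twist functional. Here it annihilates `V (k - 1)`, so it
  -- is `p v` with `p` of order `j + 1`.
  obtain ⟨z, hz⟩ := exists_pair_eq_twist (D := D) (k := k) (t := t) (η := η) (by omega)
  obtain ⟨p, hp, rfl⟩ := hv.exists_eq_mul (by omega) (j + 1) (k - 1) (by omega) (by omega) z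
    fun g hg => by
      rw [hz g (V_mono (by omega) hg), twist_of_mem (V_mono (by omega) hg), hg _ (by omega)]
  have hp1 : coef W (j + 1) p = 1 := by
    have h1 := hz (mon W k) (mon_mem (by omega))
    rw [pair_ev_mul, pair_mul_eq_coef hv.pair_eq (a := j + 1) (b := k) (by omega) hp
      (mon_mem le_rfl), twist_of_mem (mon_mem le_rfl), htk, coef_mon_self (by omega), mul_one] at h1
    exact h1
  -- Only the multipliers of orders `j - 2` and `j - 1` reach the order `t = k`. The third condition
  -- is orthogonality of `f` to the square of the extra word, which is visible on order `m - 3`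
  -- because `m - 3 + 2 (j + 1) = n + 1`.
  let Ψ : CoordRing W →ₗ[F] F := D.pair v ∘ₗ LinearMap.mulRight F (p * p)
  conv_rhs => rw [← finrank_V (W := W) m (by omega)]
  refine finrank_add_three_le inf_le_left (twistMul W k t η (j - 2)) (twistMul W k t η (j - 1)) Ψ
    (key _ (by omega)) (key _ (by omega)) ?_ (u₁ := mon W m)
    (u₂ := mon W (m - 1)) (u₃ := mon W (m - 3)) (mon_mem le_rfl) (mon_mem (by omega))
    (mon_mem (by omega)) ?_ ?_ ?_ ?_ ?_ ?_
  · intro g hg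
    obtain ⟨hg, f, hf, hfg⟩ := mem_conductorFun.1 hg
    have h1 := dotProduct_eq_zero_of_mem_conductor hf (mem_orth_twistCode_of_pair_eq hz)
      (mem_orth_twistCode_of_pair_eq hz)
    rw [← h1]
    change v ⬝ᵥ D.ev (g * (p * p)) = _
    rw [map_mul, map_mul, ← hfg]
    simp only [dotProduct, Pi.mul_apply]
    exact Finset.sum_congr rfl fun i _ => by ring
  · rw [twistMul_of_eq (mon_mem le_rfl) (coef_mon_self (m := m) (by omega)) (by omega) (by omega) ht]
    exact one_ne_zero
  · exact twistMul_of_lt (mon_mem le_rfl) (by omega) ht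
  · exact twistMul_of_lt (mon_mem le_rfl) (by omega) ht
  · rw [twistMul_of_eq (mon_mem le_rfl) (coef_mon_self (m := m - 1) (by omega)) (by omega)
      (by omega) ht]
    exact one_ne_zero
  · exact twistMul_of_lt (mon_mem le_rfl) (by omega) ht
  · change D.pair v (mon W (m - 3) * (p * p)) ≠ 0
    rw [pair_mul_eq_coef hv.pair_eq (a := m - 3) (b := j + 1 + (j + 1)) (by omega) (mon_mem le_rfl)
      (mul_mem hp hp), coef_mul hp hp, hp1, coef_mon_self (by omega), one_mul, one_mul]
    exact one_ne_zero

/-- Twists at the orders `2` and `4`. -/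
theorem finrank_conductorFun_of_two_or_four (hη : η ≠ 0) (h : t = 2 ∨ (t = 4 ∧ j = 4)) (htk : t < k) :
    finrank F (conductorFun D v k t η m) + 3 ≤ m := by
  have key : ∀ b < j, ∀ g ∈ conductorFun D v k t η m, twistMul W k t η b g = 0 :=
    fun b hb g hg => hv.twist_mul_eq_zero hr hg (mon_mem (by omega))
  obtain ⟨hn, hk, hj, hm, ht, ht1, par⟩ := hr
  -- The number `k` is even here, so `m` and `j` have equal parity and one of the two factors is a
  -- power of `x`.
  have hmul : mon W m * mon W (j - 1) = mon W (k + 1) := by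
    rcases Nat.mod_two_eq_zero_or_one m with h0 | h0
    · rw [mon_mul_mon h0 (by omega)]; congr 1; omega
    · rw [mul_comm, mon_mul_mon (by omega) (by omega)]; congr 1; omega
  conv_rhs => rw [← finrank_V (W := W) m (by omega)]
  -- Two conditions come from the coefficient at `t`. The third comes from the coefficient at `k +
  -- 1`, with value `-η` on the monomial of order `m`.
  refine finrank_add_three_le inf_le_left (twistMul W k t η 0) (twistMul W k t η 2)
    (twistMul W k t η (j - 1))
    (key _ (by omega)) (key _ (by omega)) (key _ (by omega)) (u₁ := mon W t)
    (u₂ := mon W (t - 2)) (u₃ := mon W m) (mon_mem (by omega)) (mon_mem (by omega))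
    (mon_mem (by omega)) ?_ ?_ ?_ ?_ ?_ ?_
  · rw [twistMul_of_eq (mon_mem le_rfl) (coef_mon_self ht1) (by omega) (by omega) ht]
    exact one_ne_zero
  · exact twistMul_of_lt (mon_mem le_rfl) (by omega) ht
  · rw [twistMul_apply, mon_zero, mul_one, twist_of_mem (mon_mem (by omega)),
      coef_mon _ _ (by omega), if_neg (by omega)]
  · rw [twistMul_of_eq (mon_mem le_rfl) (coef_mon_self (by omega)) (by omega) (by omega) ht]
    exact one_ne_zero
  · rw [twistMul_apply, mul_comm, mon_mul_mon (by omega) (by omega),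
      twist_of_mem (mon_mem (by omega)), coef_mon _ _ (by omega), if_neg (by omega)]
  · rw [twistMul_apply, hmul, twist_apply, coef_mon_self (by omega), coef_mon _ _ (by omega),
      if_neg (by omega), mul_one, zero_sub]
    exact neg_ne_zero.2 hη

/-- Twists at the orders `0` and `3`. -/
theorem finrank_conductorFun_of_zero_or_three (hη : η ≠ 0) (h : t = 0 ∨ t = 3) :
    finrank F (conductorFun D v k t η m) + 3 ≤ m ∨
      (t = 0 ∧ n = 12 ∧ k = 8 ∧ finrank F (conductorFun D v k t η m) + 2 ≤ m) := by
  have hfd : FiniteDimensional F (conductorFun D v k t η m) :=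
    Submodule.finiteDimensional_of_le inf_le_left
  have key := fun b (hb : b < j) g hg => hv.twist_mul_eq_zero (η := η) hr (g := g) hg
    (mon_mem (W := W) (show b ≤ j - 1 by omega))
  obtain ⟨hn, hk, hj, hm, ht, ht1, par⟩ := hr
  have hx : ∀ g : CoordRing W, coef W t (mon W 2 * g) = 0 := by
    rcases h with rfl | rfl
    exacts [coef_zero_mon_two_mul, coef_three_mon_two_mul]
  -- The multiplier 1 makes the coefficient at `t` vanish. The orders 0 and 3 are the two that
  -- control divisibility by `x`, and `3 - t` is the other one.
  have hJt : ∀ g ∈ conductorFun D v k t η m, coef W t g = 0 := fun g hg => by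
    have := key 0 (by omega) g hg
    rwa [mon_zero, mul_one, twist_of_mem (V_mono (by omega) hg.1)] at this
  -- a function in `J` divisible by `x`
  have hdiv : ∀ g ∈ conductorFun D v k t η m, coef W (3 - t) g = 0 →
      ∃ g₁ ∈ V W (m - 3), g = mon W 2 * g₁ := fun g hg h0 => by
    have hm' : m = m - 2 + 2 := by omega
    obtain ⟨g₁, hg₁, rfl⟩ : ∃ g₁ ∈ V W (m - 2), g = mon W 2 * g₁ := by
      rcases h with rfl | rfl
      · exact exists_eq_mon_two_mul (by rw [← hm']; exact hg.1) (hJt g hg) h0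
      · exact exists_eq_mon_two_mul (by rw [← hm']; exact hg.1) h0 (hJt g hg)
    refine ⟨g₁, ?_, rfl⟩
    -- For a multiple of `x`, the multiplier of top order sees only the coefficient at `k + 1`, so
    -- the leading coefficient of the quotient vanishes.
    have h1 := key (j - 1) (by omega) _ hg
    have h2 : coef W (k + 1) (mon W 2 * g₁ * mon W (j - 1)) = coef W (m - 2) g₁ := by
      have h3 : mon W (j - 1) ∈ V W (j - 1) := mon_mem le_rfl
      rw [mul_assoc, show k + 1 = m - 2 + (j - 1) + 2 by omega, coef_mon_two_mul,
        coef_mul hg₁ h3, coef_mon_self (by omega), mul_one]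
    rw [twist_apply, h2, mul_assoc, hx, zero_sub, neg_eq_zero] at h1
    rw [show m - 2 = m - 3 + 1 by omega] at h1 hg₁
    exact mem_V_of_coef_eq_zero hg₁ ((mul_eq_zero.1 h1).resolve_left hη)
  have hfin := finrank_le_finrank_inf_ker_add_one (conductorFun D v k t η m) (coef W (3 - t))
  set J' := conductorFun D v k t η m ⊓ LinearMap.ker (coef W (3 - t)) with hJ'
  have hmap : ∀ X : Submodule F (CoordRing W), FiniteDimensional F X →
      (∀ g ∈ J', ∃ g₁ ∈ X, g = mon W 2 * g₁) → finrank F J' ≤ finrank F X := fun X _ hX => by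
    refine (Submodule.finrank_mono ?_).trans
      (Submodule.finrank_map_le (LinearMap.mulLeft F (mon W 2)) X)
    intro g hg
    obtain ⟨g₁, hg₁, rfl⟩ := hX g hg
    exact ⟨g₁, hg₁, rfl⟩
  -- The bound found so far is `m - 2`. One more condition comes from the extra dual word, provided
  -- that its product with the monomial of order `m - 3` has no coefficient at `t`.
  by_cases hcase : 7 ≤ m ∨ (t = 0 ∧ W.a₆ = 0)
  · left
    obtain ⟨z, hz⟩ := exists_pair_eq_twist (D := D) (k := k) (t := t) (η := η) (by omega)
    -- Multiplying the extra word by `x` removes the coefficient at `t`, so the product is an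
    -- explicit multiple `r v`.
    have hxz : ∀ g ∈ V W (k - 1), D.pair (D.ev (mon W 2) * z) g = - η * coef W (k - 1) g :=
      fun g hg => by
        have hx1 : mon W 2 ∈ V W 2 := mon_mem le_rfl
        rw [pair_ev_mul, hz _ (V_mono (by omega) (mul_mem hx1 hg)), twist_apply, hx,
          show k + 1 = k - 1 + 2 by omega, coef_mon_two_mul]
        ring
    obtain ⟨r, hr, hxr⟩ := hv.exists_eq_mul (by omega) (j + 2) (k - 2) (by omega) (by omega) _
      fun g hg => by
        rw [hxz g (V_mono (by omega) hg), hg _ (by omega), mul_zero]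
    have hr1 : coef W (j + 2) r = -η := by
      have h1 := hxz (mon W (k - 1)) (mon_mem le_rfl)
      rw [hxr, pair_ev_mul, pair_mul_eq_coef hv.pair_eq (a := j + 2) (b := k - 1) (by omega) hr
        (mon_mem le_rfl), coef_mon_self (by omega), mul_one, mul_one] at h1
      exact h1
    -- If `f v` comes from `x g₁`, then `f z` comes from `r g₁`, because both agree after
    -- multiplication by `x`. Membership in the code imposes the twist relation on `r g₁`.
    let Ψ : CoordRing W →ₗ[F] F := twist W k t η ∘ₗ LinearMap.mulLeft F r
    have hΨ : Ψ (mon W (m - 3)) ≠ 0 := by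
      change twist W k t η (r * mon W (m - 3)) ≠ 0
      have h3 : mon W (m - 3) ∈ V W (m - 3) := mon_mem le_rfl
      have h1 : coef W t (r * mon W (m - 3)) = 0 := by
        by_cases hm7 : 7 ≤ m
        · have : mon W (m - 3) = mon W 2 * mon W (m - 5) := by
            rw [mon_mul_mon (by omega) (by omega)]; congr 1; omega
          rw [this, mul_left_comm]
          exact hx _
        · obtain ⟨rfl, h6⟩ := hcase.resolve_left hm7
          rw [show m - 3 = 3 by omega, mon_three, coef_zero, QuadraticAlgebra.re_mul]
          simp [cubic, h6]
      rw [twist_apply, h1, show k + 1 = j + 2 + (m - 3) by omega, coef_mul hr h3, hr1,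
        coef_mon_self (by omega)]
      simpa using hη
    have h1 := finrank_inf_ker_add_one (J := V W (m - 3)) Ψ (mon_mem le_rfl) hΨ
    rw [finrank_V _ (by omega)] at h1
    have h2 := hmap (V W (m - 3) ⊓ LinearMap.ker Ψ)
      (Submodule.finiteDimensional_of_le inf_le_left) fun g hg => by
        obtain ⟨g₁, hg₁, rfl⟩ := hdiv g hg.1 hg.2
        refine ⟨g₁, ⟨hg₁, ?_⟩, rfl⟩
        obtain ⟨-, f, hf, hfg⟩ := mem_conductorFun.1 hg.1
        obtain ⟨s, hs, hs', hfs⟩ := exists_eq_ev_of_mem_conductor hf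
          (mem_orth_twistCode_of_pair_eq hz)
        have hrg := mul_mem hr hg₁
        have h3 : mon W 2 * s = mon W 2 * (r * g₁) := by
          refine D.eq_of_ev_eq (m := k + 3) (by omega)
            (V_mono (by omega) (mul_mem (mon_mem (le_refl 2)) hs))
            (V_mono (by omega) (mul_mem (mon_mem (le_refl 2)) hrg)) ?_
          rw [map_mul, ← hfs, map_mul, map_mul, mul_left_comm, hxr, mul_left_comm, hfg, map_mul]
          ring
        have h4 : mon W 2 ≠ 0 := fun h0 => by
          have := coef_mon_self (W := W) (m := 2) (by omega)
          rw [h0, map_zero] at this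
          exact zero_ne_one this
        have h5 := mul_left_cancel₀ h4 h3
        change twist W k t η (r * g₁) = 0
        rw [← h5, hs']
    omega
  · have h2 := hmap (V W (m - 3)) inferInstance fun g hg => hdiv g hg.1 hg.2
    rw [finrank_V _ (by omega)] at h2
    -- Here `m = 6`. The value `j = 4` gives `n = 12` and `k = 8`, hence `t = 0` by parity, and only
    -- two conditions are proved.
    by_cases hj4 : j = 4
    · right
      have : t = 0 := by omega
      exact ⟨this, by omega, by omega, by omega⟩
    · left
      have h3 : J' = conductorFun D v k t η m := by
        rw [hJ', inf_eq_left]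
        intro g hg
        -- For `j ≥ 5` the multiplier `y` stays below order `k + 1` and forces the coefficient at `3
        -- - t` to vanish.
        have h4 := key 3 (by omega) g hg
        have h5 := hJt g hg
        have h6 : g * mon W 3 ∈ V W k := V_mono (by omega) (mul_mem hg.1 (mon_mem (le_refl 3)))
        rw [twist_of_mem h6, mon_three] at h4
        rw [LinearMap.mem_ker]
        rcases h with rfl | rfl
        · have h7 : W.a₆ ≠ 0 := fun h => hcase (Or.inr ⟨rfl, h⟩)
          rw [coef_zero, QuadraticAlgebra.re_mul] at h4
          simp only [mul_coeff_zero, coeff_add, coeff_zero, coeff_one_zero] at h4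
          rw [coef_three]
          simp [cubic] at h4
          exact h4.resolve_left h7
        · rw [coef_three, QuadraticAlgebra.im_mul] at h4
          rw [coef_three] at h5
          simp [coeff_add, mul_coeff_zero, h5] at h4
          rw [coef_zero]
          exact h4
      rw [← h3]
      omega

/-- Generically there are three ways to write `t` as a sum of an order at most `m` and an order
below `j`, both different from 1. The orders 0, 2, 3, `k`, and 4 with `j = 4`, are treated by the
preceding lemmas. -/
theorem finrank_conductor (hη : η ≠ 0) :
    finrank F (D.conductor k t η) + 3 ≤ m ∨
      (t = 0 ∧ n = 12 ∧ k = 8 ∧ finrank F (D.conductor k t η) + 2 ≤ m) := by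
  have hle := hv.finrank_conductor_le (η := η) hr
  suffices h : finrank F (conductorFun D v k t η m) + 3 ≤ m ∨
      (t = 0 ∧ n = 12 ∧ k = 8 ∧ finrank F (conductorFun D v k t η m) + 2 ≤ m) by
    rcases h with h | ⟨h1, h2, h3, h4⟩
    · exact Or.inl (by omega)
    · exact Or.inr ⟨h1, h2, h3, by omega⟩
  by_cases h03 : t = 0 ∨ t = 3
  · exact hv.finrank_conductorFun_of_zero_or_three hr hη h03
  left
  have hr' := hr
  obtain ⟨hn, hk, hj, hm, ht, ht1, par⟩ := hr'
  by_cases htk : t = k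
  · exact hv.finrank_conductorFun_of_eq hr htk
  by_cases h24 : t = 2 ∨ (t = 4 ∧ j = 4)
  · exact hv.finrank_conductorFun_of_two_or_four hr hη h24 (by omega)
  by_cases h1 : j = 4 ∨ t = 5
  · exact hv.finrank_conductorFun_add_three_le hr (b₁ := 0) (b₂ := 2) (b₃ := 3) (a₁ := t)
      (a₂ := t - 2) (a₃ := t - 3) (by omega) (by omega) (by omega) (by omega) (by omega)
      (by omega) (by omega) (by omega) (by omega)
  by_cases h4 : t = 4
  · exact hv.finrank_conductorFun_add_three_le hr (b₁ := 0) (b₂ := 2) (b₃ := 4) (a₁ := 4)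
      (a₂ := 2) (a₃ := 0) (by omega) (by omega) (by omega) (by omega) (by omega)
      (by omega) (by omega) (by omega) (by omega)
  -- The multipliers are the largest available ones; the first choice keeps the complementary orders
  -- at 2, 3, 4.
  by_cases htj : t ≤ j
  · exact hv.finrank_conductorFun_add_three_le hr (b₁ := t - 4) (b₂ := t - 3) (b₃ := t - 2)
      (a₁ := 4) (a₂ := 3) (a₃ := 2) (by omega) (by omega) (by omega) (by omega) (by omega)
      (by omega) (by omega) (by omega) (by omega)
  · exact hv.finrank_conductorFun_add_three_le hr (b₁ := j - 3) (b₂ := j - 2) (b₃ := j - 1)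
      (a₁ := t - (j - 3)) (a₂ := t - (j - 2)) (a₃ := t - (j - 1)) (by omega) (by omega) (by omega)
      (by omega) (by omega) (by omega) (by omega) (by omega) (by omega)

end

end IsPrincipal

end Points

end EllipticCode

/-! ### The ideal of the extra point and the conductor when `D` is not equivalent to `n O` -/

namespace EllipticCode

open Polynomial Module CoordRing

namespace CoordRing

variable {F : Type*} [Field F] (W : WeierstrassCurve F) (a b : F)

/-- The function of order `i + 2` in a basis of the maximal ideal of the point `(a, b)`. -/
noncomputable def idealBasis (i : ℕ) : CoordRing W :=
  if i % 2 = 0 then mon W i * xSub W a else mon W (i - 1) * ySub W b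

/-- The quotient of `(y - b') * idealBasis i` by `x - a`, where `(a, b')` is the point opposite to
`(a, b)`. -/
noncomputable def idealBasis' (i : ℕ) : CoordRing W :=
  if i % 2 = 0 then mon W i * ySub W (negY W a b) else mon W (i - 1) * cofactor W a

variable {W}

theorem idealBasis_mem (i : ℕ) : idealBasis W a b i ∈ V W (i + 2) := by
  unfold idealBasis
  split_ifs with h
  · exact mul_mem (mon_mem le_rfl) (xSub_mem a)
  · exact V_mono (by omega) (mul_mem (mon_mem (le_refl (i - 1))) (ySub_mem b))

/-- Every order from 2 on occurs exactly once: the ideal of a point has no gap. This is why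
polynomials can parametrise it. -/
theorem coef_idealBasis (i : ℕ) : coef W (i + 2) (idealBasis W a b i) = 1 := by
  unfold idealBasis
  split_ifs with h
  · rw [coef_mul (mon_mem le_rfl) (xSub_mem a), coef_mon_self (by omega), coef_xSub, one_mul]
  · rw [show i + 2 = i - 1 + 3 by omega, coef_mul (mon_mem le_rfl) (ySub_mem b),
      coef_mon_self (by omega), coef_ySub, one_mul]

theorem idealBasis'_mem (i : ℕ) : idealBasis' W a b i ∈ V W (i + 3) := by
  unfold idealBasis'
  split_ifs with h
  · exact mul_mem (mon_mem le_rfl) (ySub_mem _)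
  · exact V_mono (by omega) (mul_mem (mon_mem (le_refl (i - 1))) (cofactor_mem a))

theorem coef_idealBasis' (i : ℕ) : coef W (i + 3) (idealBasis' W a b i) = 1 := by
  unfold idealBasis'
  split_ifs with h
  · rw [coef_mul (mon_mem le_rfl) (ySub_mem _), coef_mon_self (by omega), coef_ySub, one_mul]
  · rw [show i + 3 = i - 1 + 4 by omega, coef_mul (mon_mem le_rfl) (cofactor_mem a),
      coef_mon_self (by omega), coef_cofactor, one_mul]

theorem idealBasis_add_two (i : ℕ) :
    idealBasis W a b (i + 2) = mon W 2 * idealBasis W a b i := by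
  unfold idealBasis
  rw [Nat.add_mod_right]
  split_ifs with h
  · rw [← mul_assoc, mon_mul_mon (by omega) (by omega), add_comm 2 i]
  · rw [← mul_assoc, mon_mul_mon (by omega) (by omega)]
    congr 2; omega

theorem idealBasis'_add_two (i : ℕ) :
    idealBasis' W a b (i + 2) = mon W 2 * idealBasis' W a b i := by
  unfold idealBasis'
  rw [Nat.add_mod_right]
  split_ifs with h
  · rw [← mul_assoc, mon_mul_mon (by omega) (by omega), add_comm 2 i]
  · rw [← mul_assoc, mon_mul_mon (by omega) (by omega)]
    congr 2; omega

variable (W) in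
/-- A parametrisation of the maximal ideal of the point `(a, b)`. -/
noncomputable def toIdeal : F[X] →ₗ[F] CoordRing W :=
  lsum fun i => LinearMap.toSpanSingleton F _ (idealBasis W a b i)

variable (W) in
/-- The map `toIdeal`, followed by multiplication by `(y - b') / (x - a)`. -/
noncomputable def toIdeal' : F[X] →ₗ[F] CoordRing W :=
  lsum fun i => LinearMap.toSpanSingleton F _ (idealBasis' W a b i)

variable {a b}

@[simp] theorem toIdeal_X_pow (i : ℕ) : toIdeal W a b (X ^ i) = idealBasis W a b i := by
  rw [X_pow_eq_monomial, toIdeal, lsum_apply, sum_monomial_index] <;> simp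

@[simp] theorem toIdeal'_X_pow (i : ℕ) : toIdeal' W a b (X ^ i) = idealBasis' W a b i := by
  rw [X_pow_eq_monomial, toIdeal', lsum_apply, sum_monomial_index] <;> simp

theorem linearMap_ext {M : Type*} [AddCommGroup M] [Module F M] {f g : F[X] →ₗ[F] M}
    (h : ∀ i, f (X ^ i) = g (X ^ i)) : f = g :=
  lhom_ext' fun i => LinearMap.ext_ring (by simpa [X_pow_eq_monomial] using h i)

theorem toIdeal_X_sq_mul (P : F[X]) : toIdeal W a b (X ^ 2 * P) = mon W 2 * toIdeal W a b P := by
  have : toIdeal W a b ∘ₗ LinearMap.mulLeft F (X ^ 2) =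
      LinearMap.mulLeft F (mon W 2) ∘ₗ toIdeal W a b := linearMap_ext fun i => by
    simp [← pow_add, add_comm 2 i, idealBasis_add_two]
  exact LinearMap.congr_fun this P

theorem toIdeal'_X_sq_mul (P : F[X]) :
    toIdeal' W a b (X ^ 2 * P) = mon W 2 * toIdeal' W a b P := by
  have : toIdeal' W a b ∘ₗ LinearMap.mulLeft F (X ^ 2) =
      LinearMap.mulLeft F (mon W 2) ∘ₗ toIdeal' W a b := linearMap_ext fun i => by
    simp [← pow_add, add_comm 2 i, idealBasis'_add_two]
  exact LinearMap.congr_fun this P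

/-- On basis elements containing `x - a` the quotient is immediate; on those containing `y - b` it
is the relation with the cofactor. -/
theorem xSub_mul_toIdeal' (h : OnCurve W a b) (P : F[X]) :
    xSub W a * toIdeal' W a b P = ySub W (negY W a b) * toIdeal W a b P := by
  have : LinearMap.mulLeft F (xSub W a) ∘ₗ toIdeal' W a b =
      LinearMap.mulLeft F (ySub W (negY W a b)) ∘ₗ toIdeal W a b := linearMap_ext fun i => by
    simp only [LinearMap.comp_apply, toIdeal'_X_pow, toIdeal_X_pow, LinearMap.mulLeft_apply,
      idealBasis, idealBasis']
    split_ifs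
    · ring
    · rw [mul_left_comm, xSub_mul_cofactor h]; ring
  exact LinearMap.congr_fun this P

theorem xSub_ne_zero (a : F) : xSub W a ≠ 0 := fun h => by
  have := coef_xSub (W := W) a
  rw [h, map_zero] at this
  exact zero_ne_one this

theorem toIdeal_mem {m : ℕ} {P : F[X]} (hP : P ∈ degreeLT F m) : toIdeal W a b P ∈ V W (m + 1) := by
  classical
  rw [degreeLT_eq_span_X_pow] at hP
  induction hP using Submodule.span_induction with
  | mem p hp =>
    obtain ⟨i, hi, rfl⟩ := Finset.mem_image.1 (Finset.mem_coe.1 hp)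
    rw [toIdeal_X_pow]
    exact V_mono (by have := Finset.mem_range.1 hi; omega) (idealBasis_mem a b i)
  | zero => rw [map_zero]; exact zero_mem _
  | add p q _ _ hp hq => rw [map_add]; exact add_mem hp hq
  | smul c p _ hp => rw [map_smul]; exact Submodule.smul_mem _ _ hp

theorem toIdeal'_mem {m : ℕ} {P : F[X]} (hP : P ∈ degreeLT F m) :
    toIdeal' W a b P ∈ V W (m + 2) := by
  classical
  rw [degreeLT_eq_span_X_pow] at hP
  induction hP using Submodule.span_induction with
  | mem p hp =>
    obtain ⟨i, hi, rfl⟩ := Finset.mem_image.1 (Finset.mem_coe.1 hp)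
    rw [toIdeal'_X_pow]
    exact V_mono (by have := Finset.mem_range.1 hi; omega) (idealBasis'_mem a b i)
  | zero => rw [map_zero]; exact zero_mem _
  | add p q _ _ hp hq => rw [map_add]; exact add_mem hp hq
  | smul c p _ hp => rw [map_smul]; exact Submodule.smul_mem _ _ hp

theorem X_pow_mem_degreeLT {m i : ℕ} (h : i < m) : (X ^ i : F[X]) ∈ degreeLT F m := by
  rw [mem_degreeLT, degree_X_pow]; exact_mod_cast h

variable (W a b) in
theorem exists_eq_toIdeal_add {m : ℕ} {g : CoordRing W} (hg : g ∈ V W (m + 1)) :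
    ∃ P ∈ degreeLT F m, ∃ c : F, g = toIdeal W a b P + algebraMap F _ c := by
  induction m generalizing g with
  | zero => 
    rw [V_one] at hg
    exact ⟨0, zero_mem _, _, by rw [map_zero, zero_add]; exact eq_of_mem_V_zero hg⟩
  | succ m ih =>
    obtain ⟨P, hP, c, h⟩ := ih (sub_coef_smul_mem hg (idealBasis_mem a b m) (coef_idealBasis a b m))
    refine ⟨P + coef W (m + 1 + 1) g • X ^ m, add_mem (degreeLT_mono m.le_succ hP)
      (Submodule.smul_mem _ _ (X_pow_mem_degreeLT m.lt_succ_self)), c, ?_⟩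
    rw [map_add, map_smul, toIdeal_X_pow, add_right_comm, ← h, sub_add_cancel]

variable (a b) in
-- The relation forces `g` to vanish at `(a, b)`, and then determines `g'`.
theorem exists_eq_toIdeal (h : OnCurve W a b) {m : ℕ} {g g' : CoordRing W} (hg : g ∈ V W (m + 1))
    (hgg' : xSub W a * g' = ySub W (negY W a b) * g) :
    ∃ P ∈ degreeLT F m, g = toIdeal W a b P ∧ g' = toIdeal' W a b P := by
  obtain ⟨P, hP, c, rfl⟩ := exists_eq_toIdeal_add W a b hg
  have h1 : xSub W a * (g' - toIdeal' W a b P) = ySub W (negY W a b) * algebraMap F _ c := by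
    rw [mul_sub, hgg', xSub_mul_toIdeal' h]; ring
  have hc : c = 0 := by
    -- At `x = a` the coefficient of `y` vanishes on the left and equals `c` on the right.
    have h2 := congrArg (fun g : CoordRing W => g.im.eval a) h1
    rw [Algebra.algebraMap_eq_smul_one, mul_smul_comm, mul_one] at h2
    simpa [xSub, ySub] using h2.symm
  rw [hc, map_zero, mul_zero] at h1
  refine ⟨P, hP, by rw [hc, map_zero, add_zero], ?_⟩
  exact sub_eq_zero.1 ((mul_eq_zero.1 h1).resolve_left (xSub_ne_zero a))

theorem finrank_degreeLT (m : ℕ) : finrank F (degreeLT F m) = m := by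
  rw [(degreeLTEquiv F m).finrank_eq, finrank_fin_fun]

instance (m : ℕ) : FiniteDimensional F (degreeLT F m) :=
  (degreeLTEquiv F m).symm.finiteDimensional

end CoordRing

namespace Points

variable {F : Type*} [Field F] {W : WeierstrassCurve F} {n : ℕ} {D : Points W n}
variable {k t : ℕ} {η : F} {j m : ℕ}

namespace IsDual

variable {v w : Fin n → F} {a b : F}

/-- The products have order at most `(j - 2) + (k + 1) = n - 1`, below the order read by `v`.
Together with `w` this leaves one dual word, the one representing the twist. -/
theorem ev_mul_mem_orth (hd : D.IsDual v w a b) (hr : HighRate n k t j m) {u : CoordRing W}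
    (hu : u ∈ V W (j - 2)) : D.ev u * v ∈ orth (D.twistCode k t η) := by
  obtain ⟨hn, hk, hj, hm, ht, ht1, par⟩ := hr
  refine mem_orth_twistCode.2 fun g hg => ?_
  have h := mul_mem hu hg.1
  rw [pair_ev_mul, hd.pair_left _ (V_mono (by omega) h)]
  exact h _ (by omega)

theorem mem_orth (hd : D.IsDual v w a b) (hr : HighRate n k t j m) :
    w ∈ orth (D.twistCode k t η) := by
  obtain ⟨hn, hk, hj, hm, ht, ht1, par⟩ := hr
  refine mem_orth_twistCode.2 fun g hg => ?_
  rw [hd.pair_right _ (V_mono (by omega) hg.1)]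
  exact hg.1 _ (by omega)

/-- The vectors that multiply a subspace of the dual code into the twisted code come from the
maximal ideal of the point `(a, b)`. -/
theorem exists_of_mul_mem (hd : D.IsDual v w a b) (hr : HighRate n k t j m)
    {f : Fin n → F} (hfv : ∀ u ∈ V W (j - 2), f * (D.ev u * v) ∈ D.twistCode k t η)
    (hfw : f * w ∈ D.twistCode k t η) :
    ∃ P ∈ degreeLT F m, f * v = D.ev (toIdeal W a b P) ∧ f * w = D.ev (toIdeal' W a b P) ∧
      (∀ u ∈ V W (j - 2), twist W k t η (toIdeal W a b P * u) = 0) ∧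
      twist W k t η (toIdeal' W a b P) = 0 := by
  obtain ⟨hn, hk, hj, hm, ht, ht1, par⟩ := hr
  have step : ∀ u ∈ V W (j - 2), ∃ s ∈ V W (k + 1), twist W k t η s = 0 ∧
      f * (D.ev u * v) = D.ev s := fun u hu => by
    obtain ⟨s, ⟨hs, hs'⟩, h⟩ := hfv u hu
    exact ⟨s, hs, hs', h.symm⟩
  obtain ⟨g, hg, -, hfg⟩ := step (mon W 0) (mon_mem (by omega))
  rw [mon_zero, map_one, one_mul] at hfg
  have step : ∀ l, ∀ u ∈ V W (j - 2), l < n → g * u ∈ V W l →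
      g * u ∈ V W (k + 1) ∧ twist W k t η (g * u) = 0 := fun l u hu hl hgu => by
    obtain ⟨s, hs, hs', h⟩ := step u hu
    have h1 : g * u = s := D.eq_of_ev_eq (m := max l (k + 1)) (by omega)
      (V_mono (le_max_left _ _) hgu) (V_mono (le_max_right _ _) hs) (by
        rw [map_mul, ← h, ← hfg]; ring)
    rw [h1]
    exact ⟨hs, hs'⟩
  have h2 : g ∈ V W (k - 1) := by
    have := (step (k + 3) (mon W 2) (mon_mem (by omega)) (by omega)
      (V_mono (by omega) (mul_mem hg (mon_mem (le_refl 2))))).1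
    rw [show k + 1 = k - 1 + 2 by omega] at this
    exact mem_V_of_mul_mem (mon_mem le_rfl) (by rw [coef_mon_self (by omega)]; exact one_ne_zero) this
  have h3 : g ∈ V W (m + 1) := by
    have := (step (k - 1 + (j - 2)) (mon W (j - 2)) (mon_mem le_rfl) (by omega)
      (mul_mem h2 (mon_mem (le_refl (j - 2))))).1
    rw [show k + 1 = m + 1 + (j - 2) by omega] at this
    exact mem_V_of_mul_mem (mon_mem le_rfl) (by rw [coef_mon_self (by omega)]; exact one_ne_zero) this
  obtain ⟨g', ⟨hg', hg'0⟩, hfg'⟩ := hfw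
  replace hfg' : f * w = D.ev g' := hfg'.symm
  -- The rule for `(x - a) w` becomes a relation between the functions behind `f v` and `f w`,
  -- because their orders are small enough for values to determine them.
  have h4 : xSub W a * g' = ySub W (negY W a b) * g := by
    refine D.eq_of_ev_eq (m := k + 3) (by omega) (V_mono (by omega) (mul_mem (xSub_mem a) hg'))
      (V_mono (by omega) (mul_mem (ySub_mem _) h3)) ?_
    rw [map_mul, map_mul, ← hfg, ← hfg', mul_left_comm, hd.xSub_mul]
    ring
  obtain ⟨P, hP, rfl, rfl⟩ := exists_eq_toIdeal a b hd.onCurve h3 h4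
  exact ⟨P, hP, hfg, hfg', fun u hu => (step (m + 1 + (j - 2)) u hu (by omega) (mul_mem h3 hu)).2,
    hg'0⟩

theorem exists_of_mem_conductor (hd : D.IsDual v w a b) (hr : HighRate n k t j m)
    {f : Fin n → F} (hf : f ∈ D.conductor k t η) :
    ∃ P ∈ degreeLT F m, f * v = D.ev (toIdeal W a b P) ∧ f * w = D.ev (toIdeal' W a b P) ∧
      (∀ u ∈ V W (j - 2), twist W k t η (toIdeal W a b P * u) = 0) ∧
      twist W k t η (toIdeal' W a b P) = 0 := by
  have h : ∀ c ∈ orth (D.twistCode k t η), f * c ∈ D.twistCode k t η := fun c hc => by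
    have := mem_orth_mul.1 hf c hc
    rwa [orth_orth] at this
  exact hd.exists_of_mul_mem hr (fun u hu => h _ (hd.ev_mul_mem_orth hr hu)) (h _ (hd.mem_orth hr))

/-- The parameters of the elements of the conductor. -/
noncomputable def conductorPoly (D : Points W n) (v w : Fin n → F) (a b : F) (k t : ℕ) (η : F)
    (m : ℕ) : Submodule F F[X] :=
  degreeLT F m ⊓ ((D.conductor k t η).map
    ((LinearMap.mulRight F v).prod (LinearMap.mulRight F w))).comap
      ((D.ev.toLinearMap ∘ₗ toIdeal W a b).prod (D.ev.toLinearMap ∘ₗ toIdeal' W a b))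

theorem mem_conductorPoly {P : F[X]} :
    P ∈ conductorPoly D v w a b k t η m ↔ P ∈ degreeLT F m ∧ ∃ f ∈ D.conductor k t η,
      f * v = D.ev (toIdeal W a b P) ∧ f * w = D.ev (toIdeal' W a b P) := by
  refine and_congr Iff.rfl (exists_congr fun f => and_congr Iff.rfl ?_)
  exact Prod.ext_iff

theorem mulRight_injective (hd : D.IsDual v w a b) (hn : 3 ≤ n) :
    Function.Injective ((LinearMap.mulRight F v).prod (LinearMap.mulRight F w) :
      (Fin n → F) →ₗ[F] _) := fun f g h => by
  ext i
  by_cases hv : v i = 0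
  · exact mul_right_cancel₀ (hd.ne_zero hn i hv) (congrFun (congrArg Prod.snd h) i)
  · exact mul_right_cancel₀ hv (congrFun (congrArg Prod.fst h) i)

theorem finrank_conductor_le (hd : D.IsDual v w a b) (hr : HighRate n k t j m) :
    finrank F (D.conductor k t η) ≤ finrank F (conductorPoly D v w a b k t η m) := by
  have hn : 3 ≤ n := by have := hr.hn; have := hr.hj; omega
  rw [(Submodule.equivMapOfInjective _ (hd.mulRight_injective hn) (D.conductor k t η)).finrank_eq]
  have : FiniteDimensional F (conductorPoly D v w a b k t η m) :=
    Submodule.finiteDimensional_of_le inf_le_left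
  refine (Submodule.finrank_mono ?_).trans
    (Submodule.finrank_map_le ((D.ev.toLinearMap ∘ₗ toIdeal W a b).prod
      (D.ev.toLinearMap ∘ₗ toIdeal' W a b)) (conductorPoly D v w a b k t η m))
  rintro _ ⟨f, hf, rfl⟩
  obtain ⟨P, hP, h1, h2, -⟩ := hd.exists_of_mem_conductor hr hf
  exact ⟨P, mem_conductorPoly.2 ⟨hP, f, hf, h1, h2⟩, Prod.ext h1.symm h2.symm⟩

theorem twist_eq_zero (hd : D.IsDual v w a b) (hr : HighRate n k t j m) {P : F[X]}
    (hP : P ∈ conductorPoly D v w a b k t η m) :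
    (∀ u ∈ V W (j - 2), twist W k t η (toIdeal W a b P * u) = 0) ∧
      twist W k t η (toIdeal' W a b P) = 0 := by
  obtain ⟨hP, f, hf, h1, h2⟩ := mem_conductorPoly.1 hP
  obtain ⟨P', hP', h1', h2', h3, h4⟩ := hd.exists_of_mem_conductor hr hf
  have hn := hr.hn
  have hj := hr.hj
  rw [D.eq_of_ev_eq (by omega) (toIdeal_mem hP) (toIdeal_mem hP') (h1.symm.trans h1'),
    D.eq_of_ev_eq (by omega) (toIdeal'_mem hP) (toIdeal'_mem hP') (h2.symm.trans h2')]
  exact ⟨h3, h4⟩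

variable (W k t η a b) in
/-- The functionals that vanish on the conductor. The one of index `1` comes from the dual code
word `w`, the one of another index `i` from the product of `v` by a monomial of order `i`. -/
noncomputable def twistPoly (i : ℕ) : F[X] →ₗ[F] F :=
  if i = 1 then twist W k t η ∘ₗ toIdeal' W a b
  else twist W k t η ∘ₗ LinearMap.mulRight F (mon W i) ∘ₗ toIdeal W a b

theorem twistPoly_one (P : F[X]) :
    twistPoly W k t η a b 1 P = twist W k t η (toIdeal' W a b P) := rfl

theorem twistPoly_of_ne_one {i : ℕ} (hi : i ≠ 1) (P : F[X]) :
    twistPoly W k t η a b i P = twist W k t η (toIdeal W a b P * mon W i) := by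
  rw [twistPoly, if_neg hi]; rfl

theorem twistPoly_eq_zero (hd : D.IsDual v w a b) (hr : HighRate n k t j m) {i : ℕ}
    (hi : i ≤ j - 2) {P : F[X]} (hP : P ∈ conductorPoly D v w a b k t η m) :
    twistPoly W k t η a b i P = 0 := by
  by_cases h1 : i = 1
  · rw [h1]; exact (hd.twist_eq_zero hr hP).2
  · rw [twistPoly_of_ne_one h1]; exact (hd.twist_eq_zero hr hP).1 _ (mon_mem hi)

/-- The functional of index 1, supplied by `w`, behaves like the missing monomial of order 1. The
triangular pattern therefore has no gap on either side. -/
theorem twistPoly_of_lt {i l : ℕ} (h : l + 2 + i < t) (htk : t ≤ k) :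
    twistPoly W k t η a b i (X ^ l) = 0 := by
  by_cases h1 : i = 1
  · rw [h1, twistPoly_one, toIdeal'_X_pow, twist_of_mem (V_mono (by omega) (idealBasis'_mem a b l)),
      idealBasis'_mem a b l _ (by omega)]
  · have h2 := mul_mem (idealBasis_mem (W := W) a b l) (mon_mem (le_refl i))
    rw [twistPoly_of_ne_one h1, toIdeal_X_pow, twist_of_mem (V_mono (by omega) h2), h2 _ h]

theorem twistPoly_of_eq {i l : ℕ} (h : l + 2 + i = t) (htk : t ≤ k) :
    twistPoly W k t η a b i (X ^ l) = 1 := by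
  by_cases h1 : i = 1
  · rw [h1, twistPoly_one, toIdeal'_X_pow, twist_of_mem (V_mono (by omega) (idealBasis'_mem a b l)),
      ← h, h1, coef_idealBasis']
  · have h2 := idealBasis_mem (W := W) a b l
    have h3 : mon W i ∈ V W i := mon_mem le_rfl
    rw [twistPoly_of_ne_one h1, toIdeal_X_pow, twist_of_mem (V_mono (by omega) (mul_mem h2 h3)),
      ← h, coef_mul h2 h3, coef_idealBasis, coef_mon_self h1, one_mul]

end IsDual

end Points

end EllipticCode

/-! ### Three conditions on the conductor when `D` is not equivalent to `n O` -/

namespace EllipticCode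

open Polynomial Module CoordRing

namespace CoordRing

variable {F : Type*} [Field F] {W : WeierstrassCurve F} {a b : F}

theorem mem_degreeLT_of_coeff_eq_zero {m : ℕ} {P : F[X]} (hP : P ∈ degreeLT F (m + 1))
    (h : P.coeff m = 0) : P ∈ degreeLT F m := by
  rw [mem_degreeLT, degree_lt_iff_coeff_zero] at hP ⊢
  intro i hi
  rcases Nat.lt_or_ge m i with h' | h'
  · exact hP i h'
  · rwa [le_antisymm h' hi]

theorem sub_coeff_smul_X_pow_mem {m : ℕ} {P : F[X]} (hP : P ∈ degreeLT F (m + 1)) :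
    P - P.coeff m • X ^ m ∈ degreeLT F m :=
  mem_degreeLT_of_coeff_eq_zero
    (sub_mem hP (Submodule.smul_mem _ _ (X_pow_mem_degreeLT m.lt_succ_self))) (by simp)

theorem coef_toIdeal {m : ℕ} {P : F[X]} (hP : P ∈ degreeLT F (m + 1)) :
    coef W (m + 2) (toIdeal W a b P) = P.coeff m := by
  have h := toIdeal_mem (W := W) (a := a) (b := b) (sub_coeff_smul_X_pow_mem hP) (m + 2) (by omega)
  rw [map_sub, map_sub, map_smul, map_smul, toIdeal_X_pow, coef_idealBasis, smul_eq_mul,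
    mul_one] at h
  exact sub_eq_zero.1 h

theorem toIdeal_injective : Function.Injective (toIdeal W a b) := by
  rw [injective_iff_map_eq_zero]
  intro P hP
  by_contra h0
  have h1 : P ∈ degreeLT F (P.natDegree + 1) := by
    rw [mem_degreeLT, degree_eq_natDegree h0]
    exact_mod_cast P.natDegree.lt_succ_self
  have h2 := coef_toIdeal (W := W) (a := a) (b := b) h1
  rw [hP, map_zero] at h2
  exact leadingCoeff_ne_zero.2 h0 h2.symm

theorem exists_eq_X_sq_mul {m : ℕ} {P : F[X]} (hP : P ∈ degreeLT F (m + 2)) :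
    ∃ P₁ ∈ degreeLT F m, P = P.coeff 0 • 1 + P.coeff 1 • X + X ^ 2 * P₁ := by
  refine ⟨P.divX.divX, ?_, ?_⟩
  · rw [mem_degreeLT, degree_lt_iff_coeff_zero] at hP ⊢
    intro i hi
    rw [coeff_divX, coeff_divX]
    exact hP _ (by omega)
  · have h1 := X_mul_divX_add P
    have h2 := X_mul_divX_add P.divX
    rw [coeff_divX, zero_add] at h2
    rw [smul_eq_C_mul, smul_eq_C_mul]
    conv_lhs => rw [← h1, ← h2]
    ring

variable {k t : ℕ} {η : F}

/-- The coefficients at the orders `0`, `2` and `3` do not see multiples of `x²`. -/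
theorem coef_mon_two_mul_mon_two_mul (ht : t = 0 ∨ t = 2 ∨ t = 3) (g : CoordRing W) :
    coef W t (mon W 2 * (mon W 2 * g)) = 0 := by
  rcases ht with rfl | rfl | rfl
  · exact coef_zero_mon_two_mul _
  · rw [coef_mon_two_mul 0, coef_zero_mon_two_mul]
  · exact coef_three_mon_two_mul _

end CoordRing

namespace Points

variable {F : Type*} [Field F] {W : WeierstrassCurve F} {n : ℕ} {D : Points W n}
variable {k t : ℕ} {η : F} {j m : ℕ}

namespace IsDual

variable {v w : Fin n → F} {a b : F}

/-- From index 4 on the basis elements are divisible by `x²`. -/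
theorem coef_mul_mon_eq_zero (ht : t = 0 ∨ t = 2 ∨ t = 3) {l : ℕ} (hl : 4 ≤ l) (g : CoordRing W) :
    coef W t (idealBasis W a b l * g) = 0 := by
  obtain ⟨l, rfl⟩ : ∃ l', l = l' + 2 + 2 := ⟨l - 4, by omega⟩
  rw [idealBasis_add_two, idealBasis_add_two, mul_assoc, mul_assoc]
  exact coef_mon_two_mul_mon_two_mul ht _

theorem twistPoly_of_ge (ht : t = 0 ∨ t = 2 ∨ t = 3) {i l : ℕ} (hl : 4 ≤ l) (h : l + 2 + i ≤ k) :
    twistPoly W k t η a b i (X ^ l) = 0 := by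
  by_cases h1 : i = 1
  · rw [h1, twistPoly_one, toIdeal'_X_pow, twist_of_mem (V_mono (by omega) (idealBasis'_mem a b l))]
    obtain ⟨l, rfl⟩ : ∃ l', l = l' + 2 + 2 := ⟨l - 4, by omega⟩
    rw [idealBasis'_add_two, idealBasis'_add_two]
    exact coef_mon_two_mul_mon_two_mul ht _
  · rw [twistPoly_of_ne_one h1, toIdeal_X_pow,
      twist_of_mem (V_mono (by omega) (mul_mem (idealBasis_mem a b l) (mon_mem (le_refl i))))]
    exact coef_mul_mon_eq_zero ht hl _

/-- At total order `k + 1` the coefficient at `t` is invisible and only the term with `η` survives.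
This supplies a condition for small `t`. -/
theorem twistPoly_top (ht : t = 0 ∨ t = 2 ∨ t = 3) {i l : ℕ} (hl : 4 ≤ l) (hi : i ≠ 1)
    (h : l + 2 + i = k + 1) : twistPoly W k t η a b i (X ^ l) = -η := by
  have h3 : mon W i ∈ V W i := mon_mem le_rfl
  rw [twistPoly_of_ne_one hi, toIdeal_X_pow, twist_apply, coef_mul_mon_eq_zero ht hl, ← h,
    coef_mul (idealBasis_mem a b l) h3, coef_idealBasis, coef_mon_self hi]
  ring

section

variable (hd : D.IsDual v w a b) (hr : HighRate n k t j m)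
include hd hr

theorem finrank_conductorPoly_of_lt (h4 : 4 ≤ t) (htk : t < k) :
    finrank F (conductorPoly D v w a b k t η m) + 3 ≤ m := by
  have key : ∀ i ≤ j - 2, ∀ P ∈ conductorPoly D v w a b k t η m, twistPoly W k t η a b i P = 0 :=
    fun i hi P hP => hd.twistPoly_eq_zero hr hi hP
  obtain ⟨hn, hk, hj, hm, ht, ht1, par⟩ := hr
  -- Three consecutive indices must stay at most `j - 2` and have complementary exponents below `m`;
  -- if `j < t`, the latter is the hypothesis `t < k`.
  obtain ⟨c, hc, hcj, hcm⟩ : ∃ c, c + 4 ≤ t ∧ c + 4 ≤ j ∧ t - c - 2 < m := ⟨min t j - 4, by omega⟩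
  conv_rhs => rw [← finrank_degreeLT (F := F) m]
  refine finrank_add_three_le inf_le_left (twistPoly W k t η a b c) (twistPoly W k t η a b (c + 1))
    (twistPoly W k t η a b (c + 2)) (key _ (by omega)) (key _ (by omega)) (key _ (by omega))
    (u₁ := X ^ (t - c - 2)) (u₂ := X ^ (t - c - 3)) (u₃ := X ^ (t - c - 4))
    (X_pow_mem_degreeLT (by omega)) (X_pow_mem_degreeLT (by omega)) (X_pow_mem_degreeLT (by omega))
    ?_ ?_ ?_ ?_ ?_ ?_
  · rw [twistPoly_of_eq (by omega) ht]; exact one_ne_zero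
  · exact twistPoly_of_lt (by omega) ht
  · exact twistPoly_of_lt (by omega) ht
  · rw [twistPoly_of_eq (by omega) ht]; exact one_ne_zero
  · exact twistPoly_of_lt (by omega) ht
  · rw [twistPoly_of_eq (by omega) ht]; exact one_ne_zero

theorem finrank_conductorPoly_of_eq (htk : t = k) :
    finrank F (conductorPoly D v w a b k t η m) + 3 ≤ m := by
  have key : ∀ i ≤ j - 2, ∀ P ∈ conductorPoly D v w a b k t η m, twistPoly W k t η a b i P = 0 :=
    fun i hi P hP => hd.twistPoly_eq_zero hr hi hP
  have hw := hd.mem_orth (η := η) hr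
  obtain ⟨hn, hk, hj, hm, ht, ht1, par⟩ := hr
  obtain ⟨z, hz⟩ := exists_pair_eq_twist (D := D) (k := k) (t := t) (η := η) (by omega)
  have hzT := mem_orth_twistCode_of_pair_eq hz
  obtain ⟨p, hp, c, rfl⟩ := exists_eq_mul_add_smul hd.pair_left hd.pair_right (by omega) (j - 1)
    (k - 1) (by omega) (by omega) z fun g hg => by
      rw [hz g (V_mono (by omega) hg), twist_of_mem (V_mono (by omega) hg), hg _ (by omega)]
  rw [show j - 1 + 1 = j by omega] at hp
  have hp1 : coef W j p = 1 := by
    have h1 := hz (mon W k) (mon_mem (by omega))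
    rw [pair_add, pair_smul, hd.pair_right _ (mon_mem (by omega)), coef_mon _ _ (by omega),
      if_neg (by omega), mul_zero, add_zero, pair_ev_mul,
      pair_mul_eq_coef hd.pair_left (a := j) (b := k) (by omega) hp
      (mon_mem le_rfl), twist_of_mem (mon_mem le_rfl), htk, coef_mon_self (by omega), mul_one] at h1
    exact h1
  -- Since `w` itself lies in the dual code, its contribution to the extra word can be discarded.
  have hpT : D.ev p * v ∈ orth (D.twistCode k t η) := by
    simpa using sub_mem hzT (Submodule.smul_mem _ c hw)
  -- As in the principal case, the third condition is orthogonality of `f` to the square of a dual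
  -- word; now `(m - 2) + 2 j = n`.
  let Ψ : F[X] →ₗ[F] F := D.pair v ∘ₗ LinearMap.mulRight F (p * p) ∘ₗ toIdeal W a b
  conv_rhs => rw [← finrank_degreeLT (F := F) m]
  refine finrank_add_three_le inf_le_left (twistPoly W k t η a b (j - 3))
    (twistPoly W k t η a b (j - 2)) Ψ
    (key _ (by omega)) (key _ (by omega)) ?_ (u₁ := X ^ (m - 1))
    (u₂ := X ^ (m - 2)) (u₃ := X ^ (m - 4)) (X_pow_mem_degreeLT (by omega))
    (X_pow_mem_degreeLT (by omega)) (X_pow_mem_degreeLT (by omega)) ?_ ?_ ?_ ?_ ?_ ?_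
  · intro P hP
    obtain ⟨hP, f, hf, hfP, -⟩ := mem_conductorPoly.1 hP
    have h1 := dotProduct_eq_zero_of_mem_conductor hf hpT hpT
    rw [← h1]
    change v ⬝ᵥ D.ev (toIdeal W a b P * (p * p)) = _
    rw [map_mul, map_mul, ← hfP]
    simp only [dotProduct, Pi.mul_apply]
    exact Finset.sum_congr rfl fun i _ => by ring
  · rw [twistPoly_of_eq (by omega) ht]; exact one_ne_zero
  · exact twistPoly_of_lt (by omega) ht
  · exact twistPoly_of_lt (by omega) ht
  · rw [twistPoly_of_eq (by omega) ht]; exact one_ne_zero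
  · exact twistPoly_of_lt (by omega) ht
  · change D.pair v (toIdeal W a b (X ^ (m - 4)) * (p * p)) ≠ 0
    rw [toIdeal_X_pow, pair_mul_eq_coef hd.pair_left (a := m - 4 + 2) (b := j + j) (by omega)
      (idealBasis_mem a b _) (mul_mem hp hp), coef_mul hp hp, hp1, coef_idealBasis, one_mul,
      one_mul]
    exact one_ne_zero

theorem finrank_conductorPoly_of_three (hη : η ≠ 0) (h3 : t = 3) :
    finrank F (conductorPoly D v w a b k t η m) + 3 ≤ m := by
  have key : ∀ i ≤ j - 2, ∀ P ∈ conductorPoly D v w a b k t η m, twistPoly W k t η a b i P = 0 :=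
    fun i hi P hP => hd.twistPoly_eq_zero hr hi hP
  obtain ⟨hn, hk, hj, hm, ht, ht1, par⟩ := hr
  have h' : t = 0 ∨ t = 2 ∨ t = 3 := by omega
  conv_rhs => rw [← finrank_degreeLT (F := F) m]
  refine finrank_add_three_le inf_le_left (twistPoly W k t η a b 0) (twistPoly W k t η a b 1)
    (twistPoly W k t η a b (j - 2)) (key _ (by omega)) (key _ (by omega)) (key _ (by omega))
    (u₁ := X ^ 1) (u₂ := X ^ 0) (u₃ := X ^ (m - 1))
    (X_pow_mem_degreeLT (by omega)) (X_pow_mem_degreeLT (by omega)) (X_pow_mem_degreeLT (by omega))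
    ?_ ?_ ?_ ?_ ?_ ?_
  · rw [twistPoly_of_eq (by omega) ht]; exact one_ne_zero
  · exact twistPoly_of_lt (by omega) ht
  · exact twistPoly_of_ge h' (by omega) (by omega)
  · rw [twistPoly_of_eq (by omega) ht]; exact one_ne_zero
  · exact twistPoly_of_ge h' (by omega) (by omega)
  · rw [twistPoly_top h' (by omega) (by omega) (by omega)]; exact neg_ne_zero.2 hη

/-- The index 0 and the top index give two conditions. The third is that of index 1, whose values on
the next three powers are, up to sign, the quantities in the hypothesis, or that of index 2, which
sees `b`. -/
theorem finrank_conductorPoly_of_two (hη : η ≠ 0) (h2 : t = 2)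
    (h : (a + W.a₂ ≠ 0 ∨ negY W a b ≠ 0 ∨ a ^ 2 + W.a₂ * a + W.a₄ ≠ 0) ∨ (5 ≤ j ∧ b ≠ 0)) :
    finrank F (conductorPoly D v w a b k t η m) + 3 ≤ m := by
  have key : ∀ i ≤ j - 2, ∀ P ∈ conductorPoly D v w a b k t η m, twistPoly W k t η a b i P = 0 :=
    fun i hi P hP => hd.twistPoly_eq_zero hr hi hP
  obtain ⟨hn, hk, hj, hm, ht, ht1, par⟩ := hr
  have h' : t = 0 ∨ t = 2 ∨ t = 3 := by omega
  conv_rhs => rw [← finrank_degreeLT (F := F) m]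
  have e1 : ∀ l ≤ 3, twistPoly W k t η a b 1 (X ^ l) = coef W 2 (idealBasis' W a b l) :=
    fun l hl => by
      rw [twistPoly_one, toIdeal'_X_pow,
        twist_of_mem (V_mono (by omega) (idealBasis'_mem a b l)), h2]
  rcases h with h | ⟨h5, hb⟩
  · obtain ⟨l, hl, hl'⟩ : ∃ l ≤ 3, twistPoly W k t η a b 1 (X ^ l) ≠ 0 := by
      rcases h with h | h | h
      · refine ⟨1, by omega, ?_⟩
        rw [e1 1 (by omega), show idealBasis' W a b 1 = mon W 0 * cofactor W a from rfl, mon_zero,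
          one_mul, coef_two]
        simp only [cofactor, coeff_add, coeff_C_mul, coeff_X_pow, coeff_X, coeff_C]
        simpa using h
      · refine ⟨2, by omega, ?_⟩
        rw [e1 2 (by omega), idealBasis'_add_two,
          show idealBasis' W a b 0 = mon W 0 * ySub W (negY W a b) from rfl, mon_zero,
          one_mul, coef_mon_two_mul 0, coef_zero]
        simpa [ySub] using h
      · refine ⟨3, le_rfl, ?_⟩
        rw [e1 3 le_rfl, idealBasis'_add_two,
          show idealBasis' W a b 1 = mon W 0 * cofactor W a from rfl, mon_zero,
          one_mul, coef_mon_two_mul 0, coef_zero]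
        simp only [cofactor, coeff_add, coeff_C_mul, coeff_X_pow, coeff_X, coeff_C]
        simpa using h
    refine finrank_add_three_le inf_le_left (twistPoly W k t η a b 1) (twistPoly W k t η a b 0)
      (twistPoly W k t η a b (j - 2)) (key _ (by omega)) (key _ (by omega)) (key _ (by omega))
      (u₁ := X ^ l) (u₂ := X ^ 0) (u₃ := X ^ (m - 1))
      (X_pow_mem_degreeLT (by omega)) (X_pow_mem_degreeLT (by omega))
      (X_pow_mem_degreeLT (by omega)) hl' ?_ ?_ ?_ ?_ ?_
    · rw [e1 0 (by omega), show idealBasis' W a b 0 = mon W 0 * ySub W (negY W a b) from rfl,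
        mon_zero, one_mul, coef_two]
      simp [ySub]
    · exact twistPoly_of_ge h' (by omega) (by omega)
    · rw [twistPoly_of_eq (by omega) ht]; exact one_ne_zero
    · exact twistPoly_of_ge h' (by omega) (by omega)
    · rw [twistPoly_top h' (by omega) (by omega) (by omega)]; exact neg_ne_zero.2 hη
  -- For `j = 4` the index 2 would coincide with the top index `j - 2`, hence the requirement `5 ≤
  -- j`.
  · refine finrank_add_three_le inf_le_left (twistPoly W k t η a b 0) (twistPoly W k t η a b 2)
      (twistPoly W k t η a b (j - 2)) (key _ (by omega)) (key _ (by omega)) (key _ (by omega))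
      (u₁ := X ^ 0) (u₂ := X ^ 1) (u₃ := X ^ (m - 1))
      (X_pow_mem_degreeLT (by omega)) (X_pow_mem_degreeLT (by omega))
      (X_pow_mem_degreeLT (by omega)) ?_ ?_ ?_ ?_ ?_ ?_
    · rw [twistPoly_of_eq (by omega) ht]; exact one_ne_zero
    · rw [twistPoly_of_ne_one (by omega), mon_zero, mul_one, toIdeal_X_pow,
        twist_of_mem (V_mono (by omega) (idealBasis_mem a b 1)),
        show idealBasis W a b 1 = mon W 0 * ySub W b from rfl, mon_zero, one_mul, h2, coef_two]
      simp [ySub]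
    · exact twistPoly_of_ge h' (by omega) (by omega)
    · rw [twistPoly_of_ne_one (by omega), mul_comm, toIdeal_X_pow, ← idealBasis_add_two,
        twist_of_mem (V_mono (by omega) (idealBasis_mem a b _)), h2, idealBasis_add_two,
        show idealBasis W a b 1 = mon W 0 * ySub W b from rfl, mon_zero, one_mul,
        coef_mon_two_mul 0, coef_zero]
      simpa [ySub] using hb
    · exact twistPoly_of_ge h' (by omega) (by omega)
    · rw [twistPoly_top h' (by omega) (by omega) (by omega)]; exact neg_ne_zero.2 hη

theorem finrank_conductorPoly_of_zero (hη : η ≠ 0) (h0 : t = 0)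
    (hW : W.a₄ = 0 → W.a₆ = 0 → W.a₃ ≠ 0) :
    finrank F (conductorPoly D v w a b k t η m) + 3 ≤ m := by
  have hfd : FiniteDimensional F (conductorPoly D v w a b k t η m) :=
    Submodule.finiteDimensional_of_le inf_le_left
  have key : ∀ i ≤ j - 2, ∀ P ∈ conductorPoly D v w a b k t η m, twistPoly W k t η a b i P = 0 :=
    fun i hi P hP => hd.twistPoly_eq_zero hr hi hP
  obtain ⟨hn, hk, hj, hm, ht, ht1, par⟩ := hr
  subst h0
  have hdec : ∀ P ∈ conductorPoly D v w a b k 0 η m, ∃ P₁ ∈ degreeLT F (m - 2),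
      P = P.coeff 0 • 1 + P.coeff 1 • X + X ^ 2 * P₁ := fun P hP =>
    exists_eq_X_sq_mul (by rw [show m - 2 + 2 = m by omega]; exact hP.1)
  -- two linear conditions on the two lowest coefficients
  have hc : ∀ P ∈ conductorPoly D v w a b k 0 η m,
      a * P.coeff 0 + b * P.coeff 1 = 0 ∧
        negY W a b * P.coeff 0 - (a ^ 2 + W.a₂ * a + W.a₄) * P.coeff 1 = 0 := fun P hP => by
    have h1 := key 0 (by omega) P hP
    have h2 := key 1 (by omega) P hP
    rw [twistPoly_of_ne_one (by omega), mon_zero, mul_one,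
      twist_of_mem (V_mono (by omega) (toIdeal_mem hP.1))] at h1
    rw [twistPoly_one, twist_of_mem (V_mono (by omega) (toIdeal'_mem hP.1))] at h2
    obtain ⟨P₁, -, hP₁⟩ := hdec P hP
    have e0 : toIdeal W a b 1 = xSub W a := by
      rw [← pow_zero X, toIdeal_X_pow]; exact (congrArg (· * _) mon_zero).trans (one_mul _)
    have e1 : toIdeal W a b X = ySub W b := by
      rw [← pow_one X, toIdeal_X_pow]; exact (congrArg (· * _) mon_zero).trans (one_mul _)
    have e0' : toIdeal' W a b 1 = ySub W (negY W a b) := by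
      rw [← pow_zero X, toIdeal'_X_pow]; exact (congrArg (· * _) mon_zero).trans (one_mul _)
    have e1' : toIdeal' W a b X = cofactor W a := by
      rw [← pow_one X, toIdeal'_X_pow]; exact (congrArg (· * _) mon_zero).trans (one_mul _)
    generalize P.coeff 0 = c₀ at *
    generalize P.coeff 1 = c₁ at *
    simp only [hP₁, map_add, map_smul, e0, e1, toIdeal_X_sq_mul, coef_zero_mon_two_mul] at h1
    rw [coef_zero, coef_zero] at h1
    simp only [hP₁, map_add, map_smul, e0', e1', toIdeal'_X_sq_mul, coef_zero_mon_two_mul] at h2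
    rw [coef_zero, coef_zero] at h2
    simp [xSub, ySub] at h1
    simp [ySub, cofactor, -map_pow] at h2
    constructor
    · linear_combination -h1
    · linear_combination -h2
  -- The two conditions have rank at least one, so fixing one lowest coefficient to 0 fixes both.
  -- The critical point is the origin, where the hypothesis on `W.a₃` is used.
  obtain ⟨i, hi⟩ : ∃ i, ∀ P ∈ conductorPoly D v w a b k 0 η m, P.coeff i = 0 →
      P.coeff 0 = 0 ∧ P.coeff 1 = 0 := by
    by_cases hb : b = 0
    · by_cases ha : a = 0
      · by_cases h4 : W.a₄ = 0
        · have h6 : W.a₆ = 0 := by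
            have := hd.onCurve
            unfold OnCurve at this
            simpa [ha, hb] using this.symm
          refine ⟨1, fun P hP h => ⟨?_, h⟩⟩
          have := (hc P hP).2
          rw [h, mul_zero, sub_zero, negY, ha, hb] at this
          simpa [hW h4 h6] using this
        · refine ⟨0, fun P hP h => ⟨h, ?_⟩⟩
          have := (hc P hP).2
          rw [h, ha] at this
          simpa [h4] using this
      · refine ⟨1, fun P hP h => ⟨?_, h⟩⟩
        have := (hc P hP).1
        rw [h, mul_zero, add_zero] at this
        exact (mul_eq_zero.1 this).resolve_left ha
    · refine ⟨0, fun P hP h => ⟨h, ?_⟩⟩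
      have := (hc P hP).1
      rw [h, mul_zero, zero_add] at this
      exact (mul_eq_zero.1 this).resolve_left hb
  have hfin := finrank_le_finrank_inf_ker_add_one (conductorPoly D v w a b k 0 η m) (lcoeff F i)
  have hdiv : ∀ P ∈ conductorPoly D v w a b k 0 η m ⊓ LinearMap.ker (lcoeff F i),
      ∃ P₁ ∈ degreeLT F (m - 3), P = X ^ 2 * P₁ := fun P hP => by
    obtain ⟨h1, h2⟩ := hi P hP.1 hP.2
    obtain ⟨P₁, hP₁, h3⟩ := hdec P hP.1
    rw [h1, h2, zero_smul, zero_smul, zero_add, zero_add] at h3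
    refine ⟨P₁, ?_, h3⟩
    rw [show m - 2 = m - 3 + 1 by omega] at hP₁
    refine mem_degreeLT_of_coeff_eq_zero hP₁ ?_
    -- The top index sees only the leading coefficient, so dividing by `X ^ 2` costs three
    -- dimensions instead of two.
    have h4 := key (j - 2) le_rfl P hP.1
    have h5 : mon W (j - 2) ∈ V W (j - 2) := mon_mem le_rfl
    rw [twistPoly_of_ne_one (by omega), h3, toIdeal_X_sq_mul, twist_apply, mul_assoc,
      coef_zero_mon_two_mul, show k + 1 = m - 3 + 1 + 1 + (j - 2) + 2 by omega, coef_mon_two_mul,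
      coef_mul (toIdeal_mem hP₁) h5, coef_mon_self (by omega), coef_toIdeal hP₁] at h4
    simpa [hη] using h4
  obtain ⟨z, hz⟩ := exists_pair_eq_twist (D := D) (k := k) (t := 0) (η := η) (by omega)
  -- Multiplication by `x` hides the coefficient at order 0, so `x z` is a combination `r v + c w`.
  have hxz : ∀ g ∈ V W (k - 1), D.pair (D.ev (mon W 2) * z) g = - η * coef W (k - 1) g :=
    fun g hg => by
      have hx1 : mon W 2 ∈ V W 2 := mon_mem le_rfl
      rw [pair_ev_mul, hz _ (V_mono (by omega) (mul_mem hx1 hg)), twist_apply,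
        coef_zero_mon_two_mul, show k + 1 = k - 1 + 2 by omega, coef_mon_two_mul]
      ring
  obtain ⟨r, hr, c, hxr⟩ := exists_eq_mul_add_smul hd.pair_left hd.pair_right (by omega) j (k - 2)
    (by omega) (by omega) _ fun g hg => by
      rw [hxz g (V_mono (by omega) hg), hg _ (by omega), mul_zero]
  have hr1 : coef W (j + 1) r = -η := by
    have h1 := hxz (mon W (k - 1)) (mon_mem le_rfl)
    rw [hxr, pair_add, pair_smul, hd.pair_right _ (mon_mem (by omega)),
      coef_mon (n - 1) _ (by omega), if_neg (by omega), mul_zero, add_zero, pair_ev_mul,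
      pair_mul_eq_coef hd.pair_left (a := j + 1) (b := k - 1) (by omega) hr
      (mon_mem le_rfl), coef_mon_self (by omega), mul_one, mul_one] at h1
    exact h1
  -- The function behind `f z` is computed from those behind `f v` and `f w` by cancelling `x`; the
  -- twist relation for it is the last condition.
  let Ψ : F[X] →ₗ[F] F :=
    twist W k 0 η ∘ₗ (LinearMap.mulRight F r ∘ₗ toIdeal W a b + c • toIdeal' W a b)
  have hΨ : Ψ (X ^ (m - 4)) ≠ 0 := by
    change twist W k 0 η (toIdeal W a b (X ^ (m - 4)) * r + c • toIdeal' W a b (X ^ (m - 4))) ≠ 0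
    have h1 : idealBasis' W a b (m - 4) ∈ V W k := V_mono (by omega) (idealBasis'_mem a b _)
    rw [toIdeal_X_pow, toIdeal'_X_pow, map_add, map_smul, twist_of_mem h1, twist_apply,
      show k + 1 = m - 4 + 2 + (j + 1) by omega, coef_mul (idealBasis_mem a b _) hr,
      coef_idealBasis, hr1, show m - 4 = m - 6 + 2 by omega, idealBasis_add_two,
      idealBasis'_add_two, mul_assoc, coef_zero_mon_two_mul, coef_zero_mon_two_mul]
    simpa using hη
  have h1 := finrank_inf_ker_add_one (J := degreeLT F (m - 3)) Ψ
    (X_pow_mem_degreeLT (by omega)) hΨ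
  rw [finrank_degreeLT] at h1
  have : FiniteDimensional F (degreeLT F (m - 3) ⊓ LinearMap.ker Ψ : Submodule F F[X]) :=
    Submodule.finiteDimensional_of_le inf_le_left
  have h2 : finrank F (conductorPoly D v w a b k 0 η m ⊓ LinearMap.ker (lcoeff F i) :
      Submodule F F[X]) ≤ finrank F (degreeLT F (m - 3) ⊓ LinearMap.ker Ψ : Submodule F F[X]) := by
    refine (Submodule.finrank_mono ?_).trans (Submodule.finrank_map_le
      (LinearMap.mulLeft F (X ^ 2)) (degreeLT F (m - 3) ⊓ LinearMap.ker Ψ))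
    intro P hP
    obtain ⟨P₁, hP₁, rfl⟩ := hdiv P hP
    refine ⟨P₁, ⟨hP₁, ?_⟩, rfl⟩
    obtain ⟨-, f, hf, hfv, hfw⟩ := mem_conductorPoly.1 hP.1
    obtain ⟨s, hs, hs', hfs⟩ := exists_eq_ev_of_mem_conductor hf (mem_orth_twistCode_of_pair_eq hz)
    rw [toIdeal_X_sq_mul] at hfv
    rw [toIdeal'_X_sq_mul] at hfw
    have h3 : toIdeal W a b P₁ * r + c • toIdeal' W a b P₁ ∈ V W (k + 1) :=
      add_mem (V_mono (by omega) (mul_mem (toIdeal_mem hP₁) hr))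
        (Submodule.smul_mem _ _ (V_mono (by omega) (toIdeal'_mem hP₁)))
    have h4 : mon W 2 * s = mon W 2 * (toIdeal W a b P₁ * r + c • toIdeal' W a b P₁) := by
      refine D.eq_of_ev_eq (m := k + 3) (by omega)
        (V_mono (by omega) (mul_mem (mon_mem (le_refl 2)) hs))
        (V_mono (by omega) (mul_mem (mon_mem (le_refl 2)) h3)) ?_
      rw [map_mul, ← hfs, mul_left_comm, hxr, mul_add, mul_left_comm, hfv, mul_smul_comm, hfw,
        mul_add, map_add, mul_smul_comm, map_smul, map_mul, map_mul, map_mul, map_mul]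
      ring
    have h5 : mon W 2 ≠ 0 := fun h0 => by
      have := coef_mon_self (W := W) (m := 2) (by omega)
      rw [h0, map_zero] at this
      exact zero_ne_one this
    have h6 := mul_left_cancel₀ h5 h4
    change twist W k 0 η (toIdeal W a b P₁ * r + c • toIdeal' W a b P₁) = 0
    rw [← h6, hs']
  omega

/-- For `t = 2` and `j = 4` all three quantities seen by `w` may vanish. The equation of the curve
then forces `W.a₄ = W.a₆ = 0`, which gives the special curves of the exceptional case. -/
theorem finrank_conductor (hη : η ≠ 0) (hW : W.a₄ = 0 → W.a₆ = 0 → W.a₁ = 0 ∧ W.a₃ ≠ 0) :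
    finrank F (D.conductor k t η) + 3 ≤ m ∨
      (t = 2 ∧ j = 4 ∧ W.a₄ = 0 ∧ W.a₆ = 0 ∧ a + W.a₂ = 0 ∧ negY W a b = 0 ∧ b ≠ 0) := by
  have hle := hd.finrank_conductor_le (η := η) hr
  suffices h : finrank F (conductorPoly D v w a b k t η m) + 3 ≤ m ∨
      (t = 2 ∧ j = 4 ∧ W.a₄ = 0 ∧ W.a₆ = 0 ∧ a + W.a₂ = 0 ∧ negY W a b = 0 ∧ b ≠ 0) by
    rcases h with h | h
    · exact Or.inl (by omega)
    · exact Or.inr h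
  have ht1 := hr.ht1
  have ht := hr.ht
  by_cases h0 : t = 0
  · exact Or.inl (hd.finrank_conductorPoly_of_zero hr hη h0 fun h4 h6 => (hW h4 h6).2)
  by_cases h3 : t = 3
  · exact Or.inl (hd.finrank_conductorPoly_of_three hr hη h3)
  by_cases htk : t = k
  · exact Or.inl (hd.finrank_conductorPoly_of_eq hr htk)
  by_cases h2 : t = 2
  · by_cases h : a + W.a₂ ≠ 0 ∨ negY W a b ≠ 0 ∨ a ^ 2 + W.a₂ * a + W.a₄ ≠ 0
    · exact Or.inl (hd.finrank_conductorPoly_of_two hr hη h2 (Or.inl h))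
    push Not at h
    obtain ⟨e1, e2, e3⟩ := h
    have h4 : W.a₄ = 0 := by linear_combination e3 - a * e1
    have h6 : W.a₆ = 0 := by
      have := hd.onCurve
      unfold OnCurve at this
      rw [negY] at e2
      linear_combination -this - b * e2 - a ^ 2 * e1 - a * h4
    obtain ⟨h1, h3⟩ := hW h4 h6
    have hb : b ≠ 0 := fun hb => h3 (by rw [negY, hb, h1] at e2; linear_combination -e2)
    by_cases hj : j = 4
    · exact Or.inr ⟨h2, hj, h4, h6, e1, e2, hb⟩
    · exact Or.inl (hd.finrank_conductorPoly_of_two hr hη h2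
        (Or.inr ⟨by have := hr.hj; omega, hb⟩))
  · exact Or.inl (hd.finrank_conductorPoly_of_lt hr (by omega) (by omega))

end

end IsDual

end Points

end EllipticCode

namespace EllipticCode

open Polynomial Module CoordRing

/-! ### The curves `y (y - b) = x² (x - a)` -/

/-- The equation is `y (y - b) = x² (x - a)`. -/
structure IsSpecial {F : Type*} [Field F] (W : WeierstrassCurve F) (a b : F) : Prop where
  a₁ : W.a₁ = 0
  a₂ : W.a₂ = -a
  a₃ : W.a₃ = -b
  a₄ : W.a₄ = 0
  a₆ : W.a₆ = 0
  ne_zero : b ≠ 0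

namespace IsSpecial

variable {F : Type*} [Field F] {W : WeierstrassCurve F} {a b : F}

theorem cubic_eq (hs : IsSpecial W a b) : cubic W = X ^ 2 * (X - C a) := by
  rw [cubic, hs.a₂, hs.a₄, hs.a₆]
  simp
  ring

theorem linear_eq (hs : IsSpecial W a b) : linear W = -C b := by
  rw [linear, hs.a₁, hs.a₃]
  simp

theorem negY_eq (hs : IsSpecial W a b) : negY W a b = 0 := by
  rw [negY, hs.a₁, hs.a₃]
  ring

theorem ySub_zero : ySub W 0 = mon W 3 := by
  rw [mon_three, ySub]; simp

theorem cofactor_eq (hs : IsSpecial W a b) : cofactor W a = mon W 4 := by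
  rw [cofactor, hs.a₁, hs.a₂, hs.a₄, mon_even 2]
  ext1 <;> simp
  ring

theorem mon_three_mul (hs : IsSpecial W a b) (g : CoordRing W) :
    mon W 3 * g = ⟨X ^ 2 * (X - C a) * g.im, g.re + C b * g.im⟩ := by
  rw [mon_three]
  ext1
  · rw [QuadraticAlgebra.re_mul]
    simp only [zero_mul, zero_add, mul_one]
    exact congrArg (· * g.im) hs.cubic_eq
  · rw [QuadraticAlgebra.im_mul]
    simp only [zero_mul, zero_add, mul_one, one_mul]
    have := hs.linear_eq
    rw [eq_neg_iff_add_eq_zero] at this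
    linear_combination (-g.im) * this

/-- Modulo the equation, the part of `y g` free of `y` is a multiple of `x²`. -/
theorem coef_zero_mon_three_mul (hs : IsSpecial W a b) (g : CoordRing W) :
    coef W 0 (mon W 3 * g) = 0 := by
  rw [hs.mon_three_mul, coef_zero, mul_assoc, coeff_X_pow_mul', if_neg (by omega)]

theorem coef_two_mon_three_mul (hs : IsSpecial W a b) (g : CoordRing W) :
    coef W 2 (mon W 3 * g) = 0 := by
  rw [hs.mon_three_mul, coef_two, mul_assoc, coeff_X_pow_mul', if_neg (by omega)]

theorem mon_three_mul_ySub (hs : IsSpecial W a b) :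
    mon W 3 * ySub W b = xSub W a * mon W 4 := by
  rw [hs.mon_three_mul, ySub, xSub, mon_even 2]
  ext1 <;> simp
  ring

end IsSpecial

namespace Points

variable {F : Type*} [Field F] {W : WeierstrassCurve F} {n : ℕ} {D : Points W n}
variable {k : ℕ} {η : F} {m : ℕ}

namespace IsDual

variable {v w : Fin n → F} {a b : F}

section

variable (hd : D.IsDual v w a b)
include hd

/-- Here values determine functions one order further, since `v` reads the coefficient of order `n`
off the values. -/
theorem eq_of_ev_eq (hn : 1 ≤ n) {g g' : CoordRing W} (hg : g ∈ V W n) (hg' : g' ∈ V W n)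
    (h : D.ev g = D.ev g') : g = g' := by
  have h0 : D.ev (g - g') = 0 := by rw [map_sub, h, sub_self]
  have h1 := hd.pair_left _ (sub_mem hg hg')
  rw [pair_apply, h0, dotProduct_zero] at h1
  obtain ⟨N, rfl⟩ : ∃ N, n = N + 1 := ⟨n - 1, by omega⟩
  exact sub_eq_zero.1 (D.eq_zero_of_ev_eq_zero N.lt_succ_self
    (mem_V_of_coef_eq_zero (sub_mem hg hg') h1.symm) h0)

theorem mulRight_ext (hn : 3 ≤ n) {f f' : Fin n → F} (hv : f * v = f' * v) (hw : f * w = f' * w) :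
    f = f' :=
  hd.mulRight_injective hn (Prod.ext hv hw)

theorem eq_zero_of_mul_sq (hn : 3 ≤ n) {f : Fin n → F} (hv : f * (v * v) = 0)
    (hw : f * (w * w) = 0) : f = 0 := by
  ext i
  have h1 := congrFun hv i
  have h2 := congrFun hw i
  simp only [Pi.mul_apply, Pi.zero_apply, mul_eq_zero, or_self] at h1 h2
  rcases h1 with h1 | h1
  · exact h1
  · exact h2.resolve_right (hd.ne_zero hn i h1)

/-- Dividing by `v` or by `w`, whichever is nonzero, defines `f`. The two quotients are compatible
because `g w = g' v` at every point. -/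
theorem exists_mul_eq (hn : 3 ≤ n) (hb : b ≠ negY W a b) {g g' : CoordRing W}
    (hgg' : xSub W a * g' = ySub W (negY W a b) * g) :
    ∃ f : Fin n → F, f * v = D.ev g ∧ f * w = D.ev g' := by
  classical
  have hgg : ySub W b * g' = cofactor W a * g := by
    refine mul_left_cancel₀ (xSub_ne_zero a) ?_
    rw [mul_left_comm, hgg', ← mul_assoc, ← mul_assoc, xSub_mul_cofactor hd.onCurve]
  have hx : ∀ i, D.ev (xSub W a) i = D.fst i - a := fun i => by simp [ev_apply, xSub]
  have hy : ∀ c i, D.ev (ySub W c) i = D.snd i - c := fun c i => by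
    simp [ev_apply, ySub, neg_add_eq_sub]
  have key : ∀ i, D.ev g i * w i = D.ev g' i * v i := by
    intro i
    have e1 := congrFun hd.xSub_mul i
    have e2 := congrFun hd.ySub_mul i
    have e3 := congrFun (congrArg D.ev hgg') i
    have e4 := congrFun (congrArg D.ev hgg) i
    simp only [map_mul, Pi.mul_apply, hx, hy] at e1 e2 e3 e4
    -- At the point `(a, b)` itself both relations degenerate; as `b` differs from its opposite,
    -- both `v` and `g` vanish there.
    by_cases h1 : D.fst i - a = 0
    · by_cases h2 : D.snd i - b = 0
      · rw [h1, zero_mul, sub_eq_zero.1 h2] at e1 e3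
        rw [(mul_eq_zero.1 e1.symm).resolve_left (sub_ne_zero.2 hb),
          (mul_eq_zero.1 e3.symm).resolve_left (sub_ne_zero.2 hb)]
        ring
      · refine mul_left_cancel₀ h2 ?_
        linear_combination D.ev g i * e2 - v i * e4
    · refine mul_left_cancel₀ h1 ?_
      linear_combination D.ev g i * e1 - v i * e3
  refine ⟨fun i => if v i = 0 then D.ev g' i / w i else D.ev g i / v i, ?_, ?_⟩ <;> ext i <;>
    simp only [Pi.mul_apply] <;> split_ifs with h
  · have := key i
    rw [h, mul_zero] at this
    rw [h, mul_zero, (mul_eq_zero.1 this).resolve_right (hd.ne_zero hn i h)]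
  · exact div_mul_cancel₀ _ h
  · exact div_mul_cancel₀ _ (hd.ne_zero hn i h)
  · rw [div_mul_eq_mul_div, key i, mul_div_assoc, div_self h, mul_one]

end

variable (W η a b m) in
/-- The space that contains the parameters of the conductor for the twist of order `2`. -/
noncomputable def candidates : Submodule F F[X] :=
  (degreeLT F m ⊓ LinearMap.ker (coef W 2 ∘ₗ toIdeal W a b)) ⊓
    LinearMap.ker ((coef W 0 - η • coef W (m + 1)) ∘ₗ toIdeal W a b)

theorem mem_candidates {P : F[X]} : P ∈ candidates W η m a b ↔ P ∈ degreeLT F m ∧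
    coef W 2 (toIdeal W a b P) = 0 ∧
      coef W 0 (toIdeal W a b P) = η * coef W (m + 1) (toIdeal W a b P) := by
  rw [← sub_eq_zero (a := coef W 0 _)]
  exact and_assoc

section

variable (hs : IsSpecial W a b)
include hs

theorem finrank_candidates (hm : 6 ≤ m) : finrank F (candidates W η m a b) + 2 ≤ m := by
  conv_rhs => rw [← finrank_degreeLT (F := F) m]
  have e0 : toIdeal W a b (X ^ 0) = xSub W a := by
    rw [toIdeal_X_pow]; exact (congrArg (· * _) mon_zero).trans (one_mul _)
  have e1 : toIdeal W a b (X ^ 1) = ySub W b := by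
    rw [toIdeal_X_pow]; exact (congrArg (· * _) mon_zero).trans (one_mul _)
  refine finrank_add_two_le (inf_le_left.trans inf_le_left) (coef W 2 ∘ₗ toIdeal W a b)
    ((coef W 0 - η • coef W (m + 1)) ∘ₗ toIdeal W a b) (fun g hg => hg.1.2) (fun g hg => hg.2)
    (u₁ := X ^ 0) (u₂ := X ^ 1) (X_pow_mem_degreeLT (by omega)) (X_pow_mem_degreeLT (by omega))
    ?_ ?_ ?_
  · rw [LinearMap.comp_apply, e0, coef_xSub]; exact one_ne_zero
  · rw [LinearMap.comp_apply, e1, coef_two]; simp [ySub]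
  · rw [LinearMap.comp_apply, e1, LinearMap.sub_apply, LinearMap.smul_apply,
      ySub_mem b (m + 1) (by omega), smul_zero, sub_zero, coef_zero]
    simpa [ySub] using hs.ne_zero

end

section

variable (hd : D.IsDual v w a b) (hr : HighRate n k 2 4 m)
include hd hr

theorem exists_mem_candidates {f : Fin n → F}
    (hfv : ∀ u ∈ V W 2, f * (D.ev u * v) ∈ D.twistCode k 2 η) (hfw : f * w ∈ D.twistCode k 2 η) :
    ∃ P ∈ candidates W η m a b, f * v = D.ev (toIdeal W a b P) ∧
      f * w = D.ev (toIdeal' W a b P) := by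
  obtain ⟨P, hP, h1, h2, h3, -⟩ := hd.exists_of_mul_mem hr hfv hfw
  obtain ⟨hn, hk, hj, hm, ht, ht1, par⟩ := hr
  refine ⟨P, mem_candidates.2 ⟨hP, ?_, ?_⟩, h1, h2⟩
  · have h4 := h3 (mon W 0) (mon_mem (by omega))
    rwa [mon_zero, mul_one, twist_of_mem (V_mono (by omega) (toIdeal_mem hP))] at h4
  · have h4 := h3 (mon W 2) (mon_mem (by omega))
    rw [mul_comm, twist_apply, coef_mon_two_mul 0, show k + 1 = m + 1 + 2 by omega,
      coef_mon_two_mul] at h4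
    exact sub_eq_zero.1 h4

theorem conductorPoly_le_candidates :
    conductorPoly D v w a b k 2 η m ≤ candidates W η m a b := fun P hP => by
  have hn := hr.hn
  obtain ⟨hP, f, hf, h1, h2⟩ := mem_conductorPoly.1 hP
  have h : ∀ c ∈ orth (D.twistCode k 2 η), f * c ∈ D.twistCode k 2 η := fun c hc => by
    have := mem_orth_mul.1 hf c hc
    rwa [orth_orth] at this
  obtain ⟨P', hP', h1', -⟩ := hd.exists_mem_candidates hr
    (fun u hu => h _ (hd.ev_mul_mem_orth hr hu)) (h _ (hd.mem_orth hr))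
  rwa [toIdeal_injective (D.eq_of_ev_eq (by omega) (toIdeal_mem hP)
    (toIdeal_mem hP'.1.1) (h1.symm.trans h1'))]

variable (hs : IsSpecial W a b) (hX : candidates W η m a b ≤ conductorPoly D v w a b k 2 η m)
include hs hX

omit hr in
theorem exists_mem_conductor {g g' : CoordRing W} (hg : g ∈ V W (m + 1))
    (hgg' : xSub W a * g' = mon W 3 * g) (h2 : coef W 2 g = 0)
    (h0 : coef W 0 g = η * coef W (m + 1) g) :
    ∃ f ∈ D.conductor k 2 η, f * v = D.ev g ∧ f * w = D.ev g' := by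
  obtain ⟨P, hP, rfl, rfl⟩ := exists_eq_toIdeal a b hd.onCurve hg (g' := g')
    (by rw [hs.negY_eq, IsSpecial.ySub_zero, hgg'])
  exact (mem_conductorPoly.1 (hX (mem_candidates.2 ⟨hP, h2, h0⟩))).2

/-- Multiples of `y` have no coefficients at the orders 0 and 2, so only the coefficient at `m + 1`
has to vanish. -/
theorem exists_mem_conductor_mon_three_mul {g g' : CoordRing W} (hg : g ∈ V W (m - 2))
    (hgg' : xSub W a * g' = mon W 3 * g)
    (h : η * coef W (m + 1) (mon W 3 * g) = 0) :
    ∃ f ∈ D.conductor k 2 η, f * v = D.ev (mon W 3 * g) ∧ f * w = D.ev (mon W 3 * g') := by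
  have hm := hr.hm
  refine hd.exists_mem_conductor hs hX (V_mono (by omega) (mul_mem (mon_mem (le_refl 3)) hg)) ?_
    (hs.coef_two_mon_three_mul _) ?_
  · rw [mul_left_comm, hgg']
  · rw [hs.coef_zero_mon_three_mul, h]

/-- Assume that all candidates occur. Writing `y z = r v + c w` for the extra word `z`, each pair
`g`, `g'` gives the twist relation for `g r + c g'`. The pairs built from `x - a` and `y - b`
determine low coefficients, and a higher multiple then yields `η² = 0`. -/
theorem false_of_eight_le (hη : η ≠ 0) (h8 : 8 ≤ m) : False := by
  have hr' := hr
  obtain ⟨hn, hk, hj, hm, ht, ht1, par⟩ := hr'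
  obtain ⟨z, hz⟩ := exists_pair_eq_twist (D := D) (k := k) (t := 2) (η := η) (by omega)
  have hyz : ∀ g ∈ V W (k - 2), D.pair (D.ev (mon W 3) * z) g = - η * coef W (k - 2) g :=
    fun g hg => by
      have hx1 : mon W 3 ∈ V W 3 := mon_mem le_rfl
      rw [pair_ev_mul, hz _ (V_mono (by omega) (mul_mem hx1 hg)), twist_apply,
        hs.coef_two_mon_three_mul, show k + 1 = 3 + (k - 2) by omega, coef_mul hx1 hg,
        coef_mon_self (by omega)]
      ring
  obtain ⟨r, hrV, c, hyr⟩ := exists_eq_mul_add_smul hd.pair_left hd.pair_right (by omega) 5 (k - 3)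
    (by omega) (by omega) _ fun g hg => by
      rw [hyz g (V_mono (by omega) hg), hg _ (by omega), mul_zero]
  have hr1 : coef W 6 r = -η := by
    have h1 := hyz (mon W (k - 2)) (mon_mem le_rfl)
    rw [hyr, pair_add, pair_smul, hd.pair_right _ (mon_mem (by omega)),
      coef_mon (n - 1) _ (by omega), if_neg (by omega), mul_zero, add_zero, pair_ev_mul,
      pair_mul_eq_coef hd.pair_left (a := 6) (b := k - 2) (by omega) hrV
      (mon_mem le_rfl), coef_mon_self (by omega), mul_one, mul_one] at h1
    exact h1
  have key : ∀ g ∈ V W (m - 3), ∀ g' ∈ V W (m - 2), xSub W a * g' = mon W 3 * g →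
      twist W k 2 η (g * r + c • g') = 0 := fun g hg g' hg' hgg' => by
    have h3 : mon W 3 ∈ V W 3 := mon_mem le_rfl
    obtain ⟨f, hf, hfv, hfw⟩ := hd.exists_mem_conductor_mon_three_mul hr hs hX
      (V_mono (by omega) hg) hgg' (by rw [mul_mem h3 hg _ (by omega), mul_zero])
    obtain ⟨s, hsV, hs', hfs⟩ := exists_eq_ev_of_mem_conductor hf (mem_orth_twistCode_of_pair_eq hz)
    have h4 : g * r + c • g' ∈ V W (k + 1) :=
      add_mem (V_mono (by omega) (mul_mem hg hrV)) (Submodule.smul_mem _ _ (V_mono (by omega) hg'))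
    have h5 : mon W 3 * s = mon W 3 * (g * r + c • g') := by
      refine hd.eq_of_ev_eq (by omega) (V_mono (by omega) (mul_mem h3 hsV))
        (V_mono (by omega) (mul_mem h3 h4)) ?_
      rw [map_mul, ← hfs, mul_left_comm, hyr, mul_add, mul_left_comm, hfv, mul_smul_comm, hfw,
        mul_add, map_add, mul_smul_comm, map_smul, map_mul, map_mul, map_mul, map_mul]
      ring
    have h6 : mon W 3 ≠ 0 := fun h0 => by
      have := coef_mon_self (W := W) (m := 3) (by omega)
      rw [h0, map_zero] at this
      exact zero_ne_one this
    rw [← mul_left_cancel₀ h6 h5, hs']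
  have hσ := key (xSub W a) (V_mono (by omega) (xSub_mem a)) (mon W 3) (mon_mem (by omega))
    (mul_comm _ _)
  have hτ := key (ySub W b) (V_mono (by omega) (ySub_mem b)) (mon W 4) (mon_mem (by omega))
    hs.mon_three_mul_ySub.symm
  set σ := xSub W a * r + c • mon W 3
  set τ := ySub W b * r + c • mon W 4
  have hσV : σ ∈ V W 8 :=
    add_mem (mul_mem (xSub_mem a) hrV) (Submodule.smul_mem _ _ (mon_mem (by omega)))
  have hτV : τ ∈ V W 9 :=
    add_mem (mul_mem (ySub_mem b) hrV) (Submodule.smul_mem _ _ (mon_mem (by omega)))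
  have hτ1 : coef W 9 τ = -η := by
    rw [map_add, map_smul, coef_mon _ _ (by omega), if_neg (by omega), smul_zero, add_zero,
      show 9 = 3 + 6 by rfl, coef_mul (ySub_mem b) hrV, coef_ySub, one_mul, hr1]
  rw [twist_of_mem (V_mono (by omega) hσV)] at hσ
  rw [twist_of_mem (V_mono (by omega) hτV)] at hτ
  have hrel : xSub W a * τ = ySub W b * σ := by
    simp only [σ, τ]
    rw [mul_add, mul_add, mul_smul_comm, mul_smul_comm, ← hs.mon_three_mul_ySub]
    ring_nf
  have e1 : xSub W a = mon W 2 - a • 1 := by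
    rw [mon_two, ← mon_zero, mon]
    ext1 <;> simp [xSub, smul_eq_C_mul]
  have e2 : ySub W b = mon W 3 - b • 1 := by
    rw [mon_three, ← mon_zero, mon]
    ext1 <;> simp [ySub, smul_eq_C_mul]
  -- Compare the coefficients at order 2 in `(x - a) τ = (y - b) σ`.
  have hτ0 : coef W 0 τ = 0 := by
    have h1 := congrArg (coef W 2) hrel
    rw [e1, e2, sub_mul, sub_mul, map_sub, map_sub, smul_mul_assoc, smul_mul_assoc, one_mul,
      one_mul, map_smul, map_smul, hσ, hτ, hs.coef_two_mon_three_mul, coef_mon_two_mul 0] at h1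
    simpa using h1
  -- Multiplying by the order `m - 6` moves the leading term of `τ` exactly to order `k + 1 = m +
  -- 3`, while its coefficient at order 2 is 0.
  have hm6 : mon W (m - 6) ∈ V W (m - 6) := mon_mem le_rfl
  have h1 := key (mon W (m - 6) * ySub W b) (V_mono (by omega) (mul_mem hm6 (ySub_mem b)))
    (mon W (m - 6) * mon W 4) (V_mono (by omega) (mul_mem hm6 (mon_mem (le_refl 4))))
    (by rw [mul_left_comm, ← hs.mon_three_mul_ySub]; ring)
  rw [mul_assoc, ← mul_smul_comm, ← mul_add, twist_apply,
    show k + 1 = m - 6 + 9 by omega, coef_mul hm6 hτV, hτ1, coef_mon_self (by omega)] at h1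
  have h2 : coef W 2 (mon W (m - 6) * τ) = 0 := by
    rw [show m - 6 = 2 + (m - 8) by omega, ← mon_mul_mon (by omega) (by omega), mul_assoc,
      coef_mon_two_mul 0]
    by_cases h9 : m = 8
    · rw [h9, Nat.sub_self, mon_zero, one_mul, hτ0]
    · rw [show m - 8 = 2 + (m - 10) by omega, ← mon_mul_mon (by omega) (by omega), mul_assoc,
        coef_zero_mon_two_mul]
  change coef W 2 (mon W (m - 6) * τ) - _ = 0 at h1
  rw [h2] at h1
  simp [hη] at h1

/-- Three of the four vectors of a basis of the dual code. -/
noncomputable def subDual (D : Points W n) (v w : Fin n → F) : Submodule F (Fin n → F) :=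
  Submodule.span F {v, D.ev (mon W 2) * v, w}

omit hr hs hX hd in
theorem ev_mul_mem_subDual {u : CoordRing W} (hu : u ∈ V W 2) : D.ev u * v ∈ subDual D v w := by
  have h1 : u - coef W 2 u • mon W 2 ∈ V W 1 :=
    sub_coef_smul_mem hu (mon_mem le_rfl) (coef_mon_self (by omega))
  rw [V_one] at h1
  have h2 := eq_of_mem_V_zero h1
  rw [sub_eq_iff_eq_add] at h2
  rw [h2, map_add, map_smul, AlgHom.commutes, add_mul, smul_mul_assoc,
    Algebra.algebraMap_eq_smul_one, smul_mul_assoc, one_mul]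
  exact add_mem (Submodule.smul_mem _ _ (Submodule.subset_span (by simp)))
    (Submodule.smul_mem _ _ (Submodule.subset_span (by simp)))

omit hs hX in
theorem subDual_le : subDual D v w ≤ orth (D.twistCode k 2 η) := by
  rw [subDual, Submodule.span_le]
  rintro c (rfl | rfl | rfl)
  · have := hd.ev_mul_mem_orth (η := η) hr (u := 1) (by rw [← mon_zero]; exact mon_mem (by omega))
    rwa [map_one, one_mul] at this
  · exact hd.ev_mul_mem_orth hr (mon_mem (by omega))
  · exact hd.mem_orth hr

omit hs in
-- A vector multiplying `subDual` into the twisted code comes from a candidate, hence lies in the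
-- conductor by `hX`. So both products have the same dual.
theorem subDual_mul : subDual D v w * orth (D.twistCode k 2 η) =
    orth (D.twistCode k 2 η) * orth (D.twistCode k 2 η) := by
  have hn := hr.hn
  refine le_antisymm (mul_le_mul' (hd.subDual_le hr) le_rfl) ?_
  rw [← orth_orth (subDual D v w * _), ← orth_orth (orth (D.twistCode k 2 η) * _)]
  refine orth_anti fun f hf => ?_
  have h : ∀ c ∈ subDual D v w, f * c ∈ D.twistCode k 2 η := fun c hc => by
    have := mem_orth_mul.1 hf c hc
    rwa [orth_orth] at this
  obtain ⟨P, hP, h1, h2⟩ := hd.exists_mem_candidates hr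
    (fun u hu => h _ (ev_mul_mem_subDual hu))
    (h _ (Submodule.subset_span (by simp)))
  obtain ⟨-, f', hf', h1', h2'⟩ := mem_conductorPoly.1 (hX hP)
  rwa [hd.mulRight_ext (by omega) (h1.trans h1'.symm) (h2.trans h2'.symm)]

/-- For `a = 0` the rule is `x w = y v`. The vector `f` that formally equals `(x / v)²` multiplies
`subDual` into the conductor, so it is a nonzero vector orthogonal to the cube. -/
theorem mul_mul_ne_top (ha : a = 0) : orth (D.twistCode k 2 η) * orth (D.twistCode k 2 η) *
    orth (D.twistCode k 2 η) ≠ ⊤ := by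
  classical
  have hr' := hr
  obtain ⟨hn, hk, hj, hm, ht, ht1, par⟩ := hr'
  have hx0 : xSub W a = mon W 2 := by rw [ha, xSub, mon_two]; simp
  -- At zeros of `v` the formula `(y / w)²` takes over; both agree where defined.
  obtain ⟨f, hvv, hvw, hww⟩ : ∃ f : Fin n → F, f * (v * v) = D.ev (mon W 4) ∧
      f * (v * w) = D.ev (mon W 5) ∧ f * (w * w) = D.ev (mon W 3 * mon W 3) := by
    have e4 : D.ev (mon W 4) = D.ev (mon W 2) * D.ev (mon W 2) := by
      rw [← map_mul, mon_mul_mon (by omega) (by omega)]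
    have e5 : D.ev (mon W 5) = D.ev (mon W 2) * D.ev (mon W 3) := by
      rw [← map_mul, mon_mul_mon (by omega) (by omega)]
    have e1 := hd.xSub_mul
    rw [hs.negY_eq, IsSpecial.ySub_zero, hx0] at e1
    rw [e4, e5, map_mul]
    refine ⟨fun i => if v i = 0 then D.ev (mon W 3) i ^ 2 / w i ^ 2
      else D.ev (mon W 2) i ^ 2 / v i ^ 2, ?_, ?_, ?_⟩ <;> ext i <;>
    · have h1 := congrFun e1 i
      simp only [Pi.mul_apply] at h1 ⊢
      generalize D.ev (mon W 2) i = x at *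
      generalize D.ev (mon W 3) i = y at *
      split_ifs with h
      · have hw := hd.ne_zero (by omega) i h
        rw [h, mul_zero] at h1
        have hx := (mul_eq_zero.1 h1).resolve_right hw
        try simp only [h, hx]
        field_simp
        try simp
      · field_simp
        first | done | linear_combination x * h1 | linear_combination (x * w i + y * v i) * h1
  have hf : f ∈ orth (orth (D.twistCode k 2 η) * orth (D.twistCode k 2 η) *
      orth (D.twistCode k 2 η)) := by
    rw [← hd.subDual_mul hr hX, mul_assoc, mem_orth_mul]
    intro c hc
    -- The products of `f v` with `v`, `w` and `x v` are `x²`, `x y` and `x³`, whose orders 4, 5, 6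
    -- avoid the three orders in the candidate conditions.
    have hc0 : ∀ l ∈ ({4, 5, 6} : Set ℕ), mon W l ∈ V W (m + 1) ∧ coef W 2 (mon W l) = 0 ∧
        coef W 0 (mon W l) = η * coef W (m + 1) (mon W l) := by
      intro l hl
      have hl : 4 ≤ l ∧ l ≤ 6 := by rcases hl with rfl | rfl | rfl <;> omega
      refine ⟨mon_mem (by omega), ?_, ?_⟩
      · rw [coef_mon _ _ (by omega), if_neg (by omega)]
      · rw [coef_mon _ _ (by omega), coef_mon _ _ (by omega), if_neg (by omega), if_neg (by omega),
          mul_zero]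
    induction hc using Submodule.span_induction with
    | mem c hc =>
      rcases hc with rfl | rfl | rfl
      · obtain ⟨h1, h2, h3⟩ := hc0 4 (by simp)
        obtain ⟨f', hf', e1, e2⟩ := hd.exists_mem_conductor hs hX (g' := mon W 5) h1
          (by rw [hx0, mul_comm (mon W 3), mon_mul_mon (by omega) (by omega),
            mon_mul_mon (by omega) (by omega)]) h2 h3
        rwa [hd.mulRight_ext (by omega) (f := f * c) (f' := f') (by rw [e1, ← hvv, mul_assoc])
          (by rw [e2, ← hvw, mul_assoc])]
      · obtain ⟨h1, h2, h3⟩ := hc0 6 (by simp)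
        obtain ⟨f', hf', e1, e2⟩ := hd.exists_mem_conductor hs hX (g' := mon W 7) h1
          (by rw [hx0, mul_comm (mon W 3), mon_mul_mon (by omega) (by omega),
            mon_mul_mon (by omega) (by omega)]) h2 h3
        have e6 : D.ev (mon W 6) = D.ev (mon W 2) * D.ev (mon W 4) := by
          rw [← map_mul, mon_mul_mon (by omega) (by omega)]
        have e7 : D.ev (mon W 7) = D.ev (mon W 2) * D.ev (mon W 5) := by
          rw [← map_mul, mon_mul_mon (by omega) (by omega)]
        rwa [hd.mulRight_ext (by omega) (f := f * (D.ev (mon W 2) * v)) (f' := f')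
          (by rw [e1, e6, ← hvv]; ring) (by rw [e2, e7, ← hvw]; ring)]
      · obtain ⟨h1, h2, h3⟩ := hc0 5 (by simp)
        obtain ⟨f', hf', e1, e2⟩ := hd.exists_mem_conductor hs hX (g' := mon W 3 * mon W 3) h1
          (by rw [hx0, ← mul_assoc, mon_mul_mon (by omega) (by omega), mul_comm]) h2 h3
        rwa [hd.mulRight_ext (by omega) (f := f * c) (f' := f')
          (by rw [e1, ← hvw]; ring) (by rw [e2, ← hww]; ring)]
    | zero => rw [mul_zero]; exact zero_mem _
    | add c d _ _ hc hd => rw [mul_add]; exact add_mem hc hd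
    | smul r c _ hc => rw [mul_smul_comm]; exact Submodule.smul_mem _ _ hc
  intro h
  rw [h, orth_top, Submodule.mem_bot] at hf
  rw [hf, zero_mul] at hvv
  have := D.eq_of_ev_eq (m := 4) (by omega) (zero_mem _) (mon_mem le_rfl) ((map_zero _).trans hvv)
  have h4 := coef_mon_self (W := W) (m := 4) (by omega)
  rw [← this, map_zero] at h4
  exact zero_ne_one h4

end

end IsDual

end Points

end EllipticCode

/-! ### The special curves with `n = 12` and `k = 8` -/

namespace EllipticCode

open Polynomial Module CoordRing

namespace IsSpecial

variable {F : Type*} [Field F] {W : WeierstrassCurve F} {a b : F}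

theorem xSub_eq : xSub W a = mon W 2 - algebraMap F _ a := by
  rw [mon_two, Algebra.algebraMap_eq_smul_one, ← mon_zero, mon]
  ext1 <;> simp [xSub, smul_eq_C_mul]

theorem ySub_eq : ySub W b = mon W 3 - algebraMap F _ b := by
  rw [mon_three, Algebra.algebraMap_eq_smul_one, ← mon_zero, mon]
  ext1 <;> simp [ySub, smul_eq_C_mul]

theorem mon_four_eq : mon W 4 = mon W 2 * mon W 2 := by
  rw [mon_mul_mon (by omega) (by omega)]

theorem mon_ne_zero {l : ℕ} (hl : l ≠ 1) : mon W l ≠ 0 := fun h0 => by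
  have := coef_mon_self (W := W) hl
  rw [h0, map_zero] at this
  exact zero_ne_one this

end IsSpecial

open IsSpecial

namespace Points

namespace IsDual

variable {F : Type*} [Field F] {W : WeierstrassCurve F} {D : Points W 12}
variable {η : F} {v w : Fin 12 → F} {a b : F}

/-- On `V 9` a dual word is a multiple of the twist functional; after subtracting that multiple of
`z₀` it annihilates `V 9`. -/
theorem orth_twistCode_le (hd : D.IsDual v w a b) {z₀ : Fin 12 → F}
    (hz₀ : ∀ g ∈ V W (8 + 1), D.pair z₀ g = twist W 8 2 η g) :
    orth (D.twistCode 8 2 η) ≤ subDual D v w ⊔ Submodule.span F {z₀} := fun c hc => by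
  rw [mem_orth_twistCode] at hc
  have h2 : twist W 8 2 η (mon W 2) = 1 := by
    rw [twist_of_mem (mon_mem (by omega)), coef_mon_self (by omega)]
  obtain ⟨g, hg, r, h⟩ := exists_eq_mul_add_smul hd.pair_left hd.pair_right (by omega) 1 9
    (by omega) (by omega) (c - D.pair c (mon W 2) • z₀) fun g hg => by
      rw [pair_sub, pair_smul, hz₀ g hg]
      have h3 := hc (g - twist W 8 2 η g • mon W 2)
        ⟨sub_mem hg (Submodule.smul_mem _ _ (mon_mem (by omega))), by
          change twist W 8 2 η _ = 0
          rw [map_sub, map_smul, h2, smul_eq_mul, mul_one, sub_self]⟩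
      rw [map_sub, map_smul, smul_eq_mul] at h3
      linear_combination h3
  rw [sub_eq_iff_eq_add] at h
  rw [h]
  exact Submodule.add_mem_sup
    (add_mem (ev_mul_mem_subDual hg) (Submodule.smul_mem _ _ (Submodule.subset_span (by simp))))
    (Submodule.smul_mem _ _ (Submodule.mem_span_singleton_self _))

section

variable (hd : D.IsDual v w a b) (hs : IsSpecial W a b)
include hd hs

theorem mon_two_mul_right : D.ev (mon W 2) * w = D.ev (mon W 3) * v + D.ev (algebraMap F _ a) * w := by
  have := hd.xSub_mul
  rw [hs.negY_eq, ySub_zero, xSub_eq, map_sub] at this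
  linear_combination this

theorem mon_three_mul_right :
    D.ev (mon W 3) * w = D.ev (algebraMap F _ b) * w + D.ev (mon W 4) * v := by
  have := hd.ySub_mul
  rw [hs.cofactor_eq, ySub_eq, map_sub] at this
  linear_combination this

/-- Modulo `subDual` the extra word can be normalised so that `y z` and `x² z` are multiples of `v`.
Compatibility of the two, with the first multiplier free of `y`, forces the common factor `S`, a
polynomial in `x`. -/
theorem exists_generator (hr : HighRate 12 8 2 4 6) :
    ∃ z ∈ orth (D.twistCode 8 2 η), ∃ S ∈ V W 4, S.im = 0 ∧ coef W 4 S = -η ∧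
      orth (D.twistCode 8 2 η) ≤ subDual D v w ⊔ Submodule.span F {z} ∧
      D.ev (mon W 3) * z = D.ev (xSub W a * S) * v ∧
      D.ev (mon W 4) * z = D.ev (ySub W b * S) * v := by
  have hb := hs.ne_zero
  have h3 : mon W 3 ∈ V W 3 := mon_mem le_rfl
  have h4 : mon W 4 ∈ V W 4 := mon_mem le_rfl
  have hxw := hd.mon_two_mul_right hs
  have hyw := hd.mon_three_mul_right hs
  obtain ⟨z₀, hz₀⟩ := exists_pair_eq_twist (D := D) (k := 8) (t := 2) (η := η) (by omega)
  have hyz : ∀ g ∈ V W 6, D.pair (D.ev (mon W 3) * z₀) g = - η * coef W 6 g :=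
    fun g hg => by
      rw [pair_ev_mul, hz₀ _ (V_mono (by omega) (CoordRing.mul_mem h3 hg)), twist_apply,
        hs.coef_two_mon_three_mul, show 8 + 1 = 3 + 6 by omega, coef_mul h3 hg,
        coef_mon_self (by omega)]
      ring
  obtain ⟨r, hrV, c, hyr⟩ := exists_eq_mul_add_smul hd.pair_left hd.pair_right (by omega) 5 5
    (by omega) (by omega) _ fun g hg => by
      rw [hyz g (V_mono (by omega) hg), hg _ (by omega), mul_zero]
  have hr1 : coef W 6 r = -η := by
    have h1 := hyz (mon W 6) (mon_mem le_rfl)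
    rw [hyr, pair_add, pair_smul, hd.pair_right _ (mon_mem (by omega)),
      coef_mon (12 - 1) _ (by omega), if_neg (by omega), mul_zero, add_zero, pair_ev_mul,
      pair_mul_eq_coef hd.pair_left (a := 6) (b := 6) (by omega) hrV
      (mon_mem le_rfl), coef_mon_self (by omega), mul_one, mul_one] at h1
    exact h1
  obtain ⟨r₂, hr₂V, c₂, hxr⟩ := exists_eq_mul_add_smul hd.pair_left hd.pair_right (by omega) 6 4
    (by omega) (by omega) (D.ev (mon W 4) * z₀) fun g hg => by
      rw [pair_ev_mul, hz₀ _ (V_mono (by omega) (CoordRing.mul_mem h4 hg)),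
        twist_of_mem (CoordRing.mul_mem h4 hg), mon_four_eq, mul_assoc, coef_mon_two_mul 0,
        coef_zero_mon_two_mul]
  -- remove the contributions of `v`, `x v` and `w`
  set d := c / b with hdb
  have hdc : d * b = c := div_mul_cancel₀ c hb
  set α := coef W 3 r
  set β := coef W 5 r
  set u : CoordRing W := α • mon W 0 + β • mon W 2 with hu
  have huV : u ∈ V W 2 := add_mem (Submodule.smul_mem _ _ (mon_mem (by omega)))
    (Submodule.smul_mem _ _ (mon_mem le_rfl))
  clear_value u
  set z := z₀ - D.ev u * v - d • w with hz
  set p := r - d • mon W 4 - mon W 3 * u with hp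
  have hpV : p ∈ V W 6 := sub_mem (sub_mem hrV (Submodule.smul_mem _ _ (mon_mem (by omega))))
    (V_mono (by omega) (CoordRing.mul_mem h3 huV))
  have hp6 : coef W 6 p = -η := by
    rw [hp, map_sub, map_sub, map_smul, hr1, coef_mon _ _ (by omega), if_neg (by omega),
      CoordRing.mul_mem h3 huV _ (by omega)]
    simp
  have hpim : p.im = 0 := by
    have e : (mon W 3 * u).im = C α + C β * X := by
      rw [hs.mon_three_mul, hu, mon_two, mon_zero]
      have h1 : (1 : CoordRing W).re = 1 := rfl
      have h2 : (1 : CoordRing W).im = 0 := rfl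
      simp [h1, h2, smul_eq_C_mul]
    have e4 : (mon W 4).im = 0 := by rw [mon_even 2]
    have hi : ∀ i, 2 ≤ i → r.im.coeff i = 0 := fun i hi => im_weight hrV i (by omega)
    ext i
    rw [hp, QuadraticAlgebra.im_sub, QuadraticAlgebra.im_sub, e, QuadraticAlgebra.im_smul, e4]
    rcases i with _ | _ | i
    · simp [α, coef_three]
    · simp [β, show coef W 5 r = r.im.coeff 1 from coef_odd 1 r]
    · simp [hi (i + 2) (by omega)]
  have hK : ∀ (e : F) (f : Fin 12 → F), e • f = D.ev (algebraMap F _ e) * f := fun e f => by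
    rw [AlgHom.commutes, Algebra.smul_def]
  have hyz' : D.ev (mon W 3) * z = D.ev p * v := by
    have e : D.ev (algebraMap F _ d) * D.ev (algebraMap F _ b) = D.ev (algebraMap F _ c) := by
      rw [← map_mul, ← map_mul, hdc]
    simp only [hz, hp, map_sub, map_smul, map_mul, hK]
    rw [hK] at hyr
    linear_combination hyr - D.ev (algebraMap F _ d) * hyw - w * e
  obtain ⟨r', hr'V, c', hxr'⟩ : ∃ r' ∈ V W 7, ∃ c' : F,
      D.ev (mon W 4) * z = D.ev r' * v + c' • w := by
    refine ⟨r₂ - mon W 4 * u - d • (mon W 2 * mon W 3 + a • mon W 3),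
      sub_mem (sub_mem hr₂V (V_mono (by omega) (CoordRing.mul_mem h4 huV)))
        (Submodule.smul_mem _ _ (add_mem (V_mono (by omega)
          (CoordRing.mul_mem (mon_mem (le_refl 2)) h3))
          (Submodule.smul_mem _ _ (mon_mem (by omega))))), c₂ - d * a ^ 2, ?_⟩
    simp only [hz, map_sub, map_add, map_smul, map_mul, map_pow, hK, mon_four_eq]
    rw [hK, mon_four_eq, map_mul] at hxr
    linear_combination hxr - D.ev (algebraMap F _ d) * (D.ev (mon W 2) +
      D.ev (algebraMap F _ a)) * hxw
  -- Computing `x² y z` in two ways gives a relation between `w` and `v`, which must be trivial.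
  obtain ⟨hc'b, hrel⟩ := smul_eq_ev_mul hd.pair_left hd.pair_right (by omega) (m := 10) (by omega)
    (B := mon W 4 * p - mon W 3 * r' - c' • mon W 4) (r := c' * b)
    (sub_mem (sub_mem (CoordRing.mul_mem h4 hpV) (CoordRing.mul_mem h3 hr'V))
      (Submodule.smul_mem _ _ (mon_mem (by omega)))) (by
      rw [hK] at hxr'
      rw [map_sub, map_sub, map_mul, map_mul, map_smul, hK, hK, map_mul, map_mul]
      linear_combination D.ev (mon W 4) * hyz' - D.ev (mon W 3) * hxr' -
        D.ev (algebraMap F _ c') * hyw)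
  have hc' : c' = 0 := (mul_eq_zero.1 hc'b).resolve_right hb
  rw [hc', zero_smul, sub_zero, sub_eq_zero] at hrel
  rw [hc', zero_smul, add_zero] at hxr'
  have hrel2 : xSub W a * r' = ySub W b * p := by
    refine mul_left_cancel₀ (mon_ne_zero (W := W) (l := 3) (by omega)) ?_
    rw [mul_left_comm, ← hrel, ← mul_assoc, ← mul_assoc, hs.mon_three_mul_ySub]
  set S : CoordRing W := ⟨r'.im, 0⟩ with hS
  -- Because `p` has no `y`-part, comparing the coefficients of `y` in `(x - a) r' = (y - b) p`
  -- suffices.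
  have hpS : p = xSub W a * S := by
    have h1 := congrArg QuadraticAlgebra.im hrel2
    have h2 : (xSub W a * r').im = (X - C a) * r'.im := by simp [xSub]
    have h3 : (ySub W b * p).im = p.re := by simp [ySub, hpim]
    rw [h2, h3] at h1
    ext1
    · rw [← h1, hS]; simp [xSub]
    · rw [hpim, hS]; simp [xSub]
  have hrS : r' = ySub W b * S := by
    refine mul_left_cancel₀ (xSub_ne_zero a) ?_
    rw [hrel2, hpS, mul_left_comm]
  have hSV : S ∈ V W 4 := mem_V_of_mul_mem (ySub_mem b) (by rw [coef_ySub]; exact one_ne_zero)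
    (by rw [mul_comm, ← hrS]; exact hr'V)
  have hzU : z - z₀ ∈ subDual D v w := by
    rw [hz, show z₀ - D.ev u * v - d • w - z₀ = - (D.ev u * v + d • w) by abel]
    exact neg_mem (add_mem (ev_mul_mem_subDual huV)
      (Submodule.smul_mem _ _ (Submodule.subset_span (by simp))))
  refine ⟨z, ?_, S, hSV, rfl, ?_, ?_, ?_, ?_⟩
  · have := add_mem (hd.subDual_le hr hzU) (mem_orth_twistCode_of_pair_eq hz₀)
    rwa [sub_add_cancel] at this
  · rw [← hp6, hpS, show 6 = 2 + 4 by rfl, coef_mul (xSub_mem a) hSV, coef_xSub, one_mul]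
  · refine (hd.orth_twistCode_le hz₀).trans (sup_le le_sup_left ?_)
    rw [Submodule.span_singleton_le_iff_mem]
    have := Submodule.add_mem_sup (neg_mem hzU) (Submodule.mem_span_singleton_self (R := F) z)
    rwa [neg_sub, sub_add_cancel] at this
  · rw [hyz', hpS]
  · rw [hxr', hrS]

omit hd hs in
theorem exists_of_mem_subDual {c : Fin 12 → F} (hc : c ∈ subDual D v w) :
    ∃ α ∈ V W 2, ∃ r : F, c = D.ev α * v + D.ev (algebraMap F _ r) * w := by
  rw [subDual] at hc
  induction hc using Submodule.span_induction with
  | mem c hc =>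
    rcases hc with rfl | rfl | rfl
    · exact ⟨mon W 0, mon_mem (by omega), 0, by rw [mon_zero]; simp⟩
    · exact ⟨mon W 2, mon_mem le_rfl, 0, by simp⟩
    · exact ⟨0, zero_mem _, 1, by simp⟩
  | zero => exact ⟨0, zero_mem _, 0, by simp⟩
  | add c d _ _ hc hd =>
    obtain ⟨α, hα, r, rfl⟩ := hc
    obtain ⟨β, hβ, s, rfl⟩ := hd
    exact ⟨α + β, add_mem hα hβ, r + s, by simp only [map_add]; ring⟩
  | smul e c _ hc =>
    obtain ⟨α, hα, r, rfl⟩ := hc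
    refine ⟨e • α, Submodule.smul_mem _ _ hα, e * r, ?_⟩
    rw [map_smul, map_mul, map_mul, AlgHom.commutes, AlgHom.commutes, Algebra.smul_def,
      Algebra.smul_def]
    ring

/-- The rule for `x w` absorbs the mixed term `x v w` into `y v²` and `a v w`. -/
theorem exists_of_mem_subDual_mul {c : Fin 12 → F} (hc : c ∈ subDual D v w * subDual D v w) :
    ∃ β ∈ V W 4, ∃ r s : F, c = D.ev β * (v * v) + D.ev (algebraMap F _ r) * (v * w) +
      D.ev (algebraMap F _ s) * (w * w) := by
  induction hc using Submodule.mul_induction_on' with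
  | mem_mul_mem c hc d hd' =>
    obtain ⟨p, hp, r, rfl⟩ := exists_of_mem_subDual hc
    obtain ⟨q, hq, s, rfl⟩ := exists_of_mem_subDual hd'
    have hdec : ∀ p ∈ V W 2, ∃ p₁ p₀ : F, p = algebraMap F _ p₁ * mon W 2 + algebraMap F _ p₀ :=
      fun p hp => by
        have h1 : p - coef W 2 p • mon W 2 ∈ V W 1 :=
          sub_coef_smul_mem hp (mon_mem le_rfl) (coef_mon_self (by omega))
        rw [V_one] at h1
        have h2 := eq_of_mem_V_zero h1
        rw [sub_eq_iff_eq_add', Algebra.smul_def] at h2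
        exact ⟨_, _, h2⟩
    obtain ⟨p₁, p₀, hp'⟩ := hdec p hp
    obtain ⟨q₁, q₀, hq'⟩ := hdec q hq
    refine ⟨p * q + (p₁ * s + q₁ * r) • mon W 3, add_mem (CoordRing.mul_mem hp hq)
      (Submodule.smul_mem _ _ (mon_mem (by omega))),
      p₀ * s + q₀ * r + (p₁ * s + q₁ * r) * a, r * s, ?_⟩
    have hxw := hd.mon_two_mul_right hs
    rw [Algebra.smul_def, hp', hq']
    simp only [map_mul, map_add]
    linear_combination (D.ev (algebraMap F _ p₁) * D.ev (algebraMap F _ s) +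
      D.ev (algebraMap F _ q₁) * D.ev (algebraMap F _ r)) * v * hxw
  | add c _ d _ hc hd =>
    obtain ⟨β, hβ, r, s, rfl⟩ := hc
    obtain ⟨β', hβ', r', s', rfl⟩ := hd
    exact ⟨β + β', add_mem hβ hβ', r + r', s + s', by simp only [map_add]; ring⟩

/-- If all candidates occur, the square of `z` lies in `subDual` times the dual code. Explicit
computation eliminates the terms with `v w` and `w²`, using `a ≠ 0`. What remains, multiplied by
`y²`, is a function of order 12 with leading coefficient `η²` that nevertheless pairs to 0 with `v`.
-/
theorem false_of_ne_zero (hr : HighRate 12 8 2 4 6)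
    (hX : candidates W η 6 a b ≤ conductorPoly D v w a b 8 2 η 6)
    (hη : η ≠ 0) (h2 : (2 : F) = 0) (ha : a ≠ 0) : False := by
  have hb := hs.ne_zero
  have h3 : mon W 3 ∈ V W 3 := mon_mem le_rfl
  have h4 : mon W 4 ∈ V W 4 := mon_mem le_rfl
  have hxw := hd.mon_two_mul_right hs
  have hyw := hd.mon_three_mul_right hs
  obtain ⟨z, hzT, S, hS, hSim, hS4, hle, hyz, hxz⟩ := hd.exists_generator (η := η) hs hr
  have hprod : ∀ f ∈ D.conductor 8 2 η, ∃ s ∈ V W 9, twist W 8 2 η s = 0 ∧ f * z = D.ev s :=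
    fun f hf => exists_eq_ev_of_mem_conductor hf hzT
  -- the conditions on the coefficients of `S`
  have hcoef : ∀ g ∈ V W 3, ∀ g', xSub W a * g' = mon W 3 * g →
      twist W 8 2 η (g * (xSub W a * S)) = 0 := fun g hg g' hgg' => by
    obtain ⟨f, hf, hfv, -⟩ := hd.exists_mem_conductor_mon_three_mul hr hs hX (V_mono (by omega) hg)
      hgg' (by rw [CoordRing.mul_mem h3 hg _ (by omega), mul_zero])
    obtain ⟨s, hsV, hs', hfs⟩ := hprod f hf
    have hxS := CoordRing.mul_mem (xSub_mem (W := W) a) hS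
    have h5 : mon W 3 * s = mon W 3 * (g * (xSub W a * S)) := by
      refine hd.eq_of_ev_eq (by omega) (CoordRing.mul_mem h3 hsV)
        (CoordRing.mul_mem h3 (CoordRing.mul_mem hg hxS)) ?_
      rw [map_mul, ← hfs, mul_left_comm, hyz, mul_left_comm, hfv]
      simp only [map_mul]
      ring
    rw [← mul_left_cancel₀ (mon_ne_zero (by omega)) h5, hs']
  have hre2 : ∀ i, 2 < i → S.re.coeff i = 0 := fun i hi => re_weight hS i (by omega)
  have hs1 : S.re.coeff 1 = 0 := by
    have h5 := hcoef (xSub W a) (V_mono (by omega) (xSub_mem a)) (mon W 3) (mul_comm _ _)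
    have h6 : xSub W a * (xSub W a * S) ∈ V W 8 :=
      CoordRing.mul_mem (xSub_mem a) (CoordRing.mul_mem (xSub_mem a) hS)
    have h7 : (xSub W a * (xSub W a * S)).re = (X - C a) * ((X - C a) * S.re) := by simp [xSub]
    rw [twist_of_mem h6, coef_two, h7, sub_mul X, coeff_sub, coeff_X_mul, coeff_C_mul, sub_mul X,
      coeff_sub, coeff_sub, coeff_X_mul, coeff_C_mul, coeff_C_mul, mul_coeff_zero, coeff_X_zero]
      at h5
    -- Characteristic 2 removes the term with the constant coefficient of `S`.
    have h8 : a * (a * S.re.coeff 1) = 0 := by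
      linear_combination h5 + a * S.re.coeff 0 * h2
    simpa [ha] using h8
  have hs0 : -b * S.re.coeff 0 = η * S.re.coeff 2 := by
    have h5 := hcoef (ySub W b) (ySub_mem b) (mon W 4) hs.mon_three_mul_ySub.symm
    have h6 : (ySub W b * (xSub W a * S)).re = -C b * ((X - C a) * S.re) := by
      simp [xSub, ySub, hSim]
    have h7 : coef W (8 + 1) (ySub W b * (xSub W a * S)) = S.re.coeff 2 := by
      rw [show 8 + 1 = 3 + (2 + 4) by rfl,
        coef_mul (ySub_mem b) (CoordRing.mul_mem (xSub_mem a) hS), coef_mul (xSub_mem a) hS,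
        coef_ySub, coef_xSub, one_mul, one_mul, coef_four]
    rw [twist_apply, h7, coef_two, h6, ← C_neg, coeff_C_mul, sub_mul X, coeff_sub, coeff_X_mul,
      coeff_C_mul, hs1] at h5
    linear_combination h5
  -- `x² z² = c₄ v²`
  obtain ⟨c₄, hc₄, hc₄z⟩ : ∃ c₄ ∈ V W 9,
      D.ev (mon W 4) * (z * z) = D.ev c₄ * (v * v) := by
    have hr2 : ySub W b * S = ⟨-C b * S.re, S.re⟩ := by
      ext1
      · simp [ySub, hSim]
      · simp [ySub, hSim]
    -- The two relations for the coefficients of `S` are exactly the candidate conditions for `(y -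
    -- b) S`.
    obtain ⟨f, hf, hfv, -⟩ := hd.exists_mem_conductor hs hX (g := ySub W b * S)
      (g' := mon W 4 * S) (V_mono (by omega) (CoordRing.mul_mem (ySub_mem b) hS))
      (by rw [← mul_assoc, ← mul_assoc, hs.mon_three_mul_ySub])
      (by rw [hr2, coef_two, ← C_neg, coeff_C_mul, hs1, mul_zero])
      (by rw [hr2, coef_zero, ← C_neg, coeff_C_mul, hs0, show 6 + 1 = 2 * 2 + 3 by rfl, coef_odd])
    obtain ⟨c₄, hc₄, -, hfc⟩ := hprod f hf
    exact ⟨c₄, hc₄, by rw [← hfc, ← mul_assoc, hxz, ← hfv]; ring⟩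
  -- `z²` in terms of the other products
  obtain ⟨α, hα, r, β, hβ, b₁, b₂, hzz⟩ : ∃ α ∈ V W 2, ∃ r : F, ∃ β ∈ V W 4, ∃ b₁ b₂ : F,
      z * z = (D.ev α * v + D.ev (algebraMap F _ r) * w) * z + (D.ev β * (v * v) +
        D.ev (algebraMap F _ b₁) * (v * w) + D.ev (algebraMap F _ b₂) * (w * w)) := by
    have h5 : z * z ∈ subDual D v w * (subDual D v w ⊔ Submodule.span F {z}) := by
      refine mul_le_mul' le_rfl hle ?_
      rw [hd.subDual_mul hr hX]
      exact Submodule.mul_mem_mul hzT hzT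
    rw [Submodule.mul_sup, Submodule.mem_sup] at h5
    obtain ⟨e, he, e', he', h6⟩ := h5
    obtain ⟨u, hu, rfl⟩ := Submodule.mem_mul_span_singleton.1 he'
    obtain ⟨α, hα, r, rfl⟩ := exists_of_mem_subDual hu
    obtain ⟨β, hβ, b₁, b₂, rfl⟩ := hd.exists_of_mem_subDual_mul hs he
    exact ⟨α, hα, r, β, hβ, b₁, b₂, by rw [← h6, add_comm]⟩
  set K : F → Fin 12 → F := fun c => D.ev (algebraMap F _ c) with hK
  have hyw2 : D.ev (ySub W b) * w = D.ev (mon W 4) * v := by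
    rw [ySub_eq, map_sub]
    linear_combination hyw
  have hxw2 : D.ev (xSub W a) * w = D.ev (mon W 3) * v := by
    rw [xSub_eq, map_sub]
    linear_combination hxw
  set c₅ := c₄ - α * (ySub W b * S) - algebraMap F _ r * (S * mon W 4) - mon W 4 * β with hc₅
  have hc₅v : D.ev c₅ * (v * v) = D.ev (mon W 4) * (K b₁ * (v * w) + K b₂ * (w * w)) := by
    simp only [hc₅, map_sub, map_mul]
    rw [map_mul] at hxz
    linear_combination (-1) * hc₄z + D.ev (mon W 4) * hzz + (D.ev α * v + K r * w) * hxz +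
      K r * v * D.ev S * hyw2
  have hrV : ∀ c : F, algebraMap F (CoordRing W) c ∈ V W 0 := fun c => by
    rw [Algebra.algebraMap_eq_smul_one, ← mon_zero]
    exact Submodule.smul_mem _ _ (mon_mem le_rfl)
  have hc₅V : c₅ ∈ V W 9 := by
    refine sub_mem (sub_mem (sub_mem hc₄ ?_) ?_) ?_
    · exact CoordRing.mul_mem hα (CoordRing.mul_mem (ySub_mem b) hS)
    · exact V_mono (by omega) (CoordRing.mul_mem (hrV r) (CoordRing.mul_mem hS h4))
    · exact V_mono (by omega) (CoordRing.mul_mem h4 hβ)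
  -- Testing against the ideal element of complementary order isolates the leading coefficient; the
  -- other side has order at most 10, which neither `v` nor `w` reads.
  have hdown : ∀ l, 7 ≤ l → l ≤ 9 → c₅ ∈ V W l → coef W l c₅ = 0 := fun l hl hl' hcl => by
    obtain ⟨i, rfl⟩ : ∃ i, l = 10 - i := ⟨10 - l, by omega⟩
    obtain ⟨f, hfv, hfw⟩ := hd.exists_mul_eq (by omega) (by rw [hs.negY_eq]; exact hb)
      (xSub_mul_toIdeal' hd.onCurve (X ^ i))
    rw [toIdeal_X_pow] at hfv
    rw [toIdeal'_X_pow] at hfw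
    have hgV := idealBasis_mem (W := W) a b i
    have hgV' := CoordRing.mul_mem h4 (idealBasis'_mem (W := W) a b i)
    have h5 : D.pair v (idealBasis W a b i * c₅) = coef W (10 - i) c₅ := by
      rw [pair_mul_eq_coef hd.pair_left (a := i + 2) (b := 10 - i) (by omega) hgV hcl,
        coef_idealBasis, one_mul]
    have h6 : D.pair v (idealBasis W a b i * c₅) =
        b₁ * D.pair v (mon W 4 * idealBasis' W a b i) +
          b₂ * D.pair w (mon W 4 * idealBasis' W a b i) := by
      have h7 : ∀ c g, D.pair c g = ∑ l, (c * D.ev g) l := fun c g => rfl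
      have h8 : v * D.ev (idealBasis W a b i * c₅) =
          b₁ • (v * D.ev (mon W 4 * idealBasis' W a b i)) +
            b₂ • (w * D.ev (mon W 4 * idealBasis' W a b i)) := by
        rw [Algebra.smul_def, Algebra.smul_def, ← D.ev.commutes, ← D.ev.commutes, map_mul, map_mul,
          ← hfv, ← hfw]
        linear_combination f * hc₅v
      rw [h7, h7, h7, h8]
      simp only [Pi.add_apply, Pi.smul_apply, smul_eq_mul, Finset.sum_add_distrib, Finset.mul_sum]
    rw [← h5, h6, hd.pair_left _ (V_mono (by omega) hgV'),
      hd.pair_right _ (V_mono (by omega) hgV'), hgV' _ (by omega), hgV' _ (by omega), mul_zero,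
      mul_zero, add_zero]
  have hc₅6 : c₅ ∈ V W 6 := by
    have h8 := mem_V_of_coef_eq_zero hc₅V (hdown 9 (by omega) le_rfl hc₅V)
    have h7 := mem_V_of_coef_eq_zero h8 (hdown 8 (by omega) (by omega) h8)
    exact mem_V_of_coef_eq_zero h7 (hdown 7 (by omega) (by omega) h7)
  have hkill : ∀ {B : CoordRing W}, D.ev B * (v * v) = 0 → D.ev B * v = 0 := fun {B} h => by
    ext i
    have := congrFun h i
    simp only [Pi.mul_apply, Pi.zero_apply, mul_eq_zero, or_self] at this ⊢
    exact this
  -- Multiplication by `(x - a)²` replaces `w` by multiples of `v` and gives an identity of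
  -- functions of order at most 10.
  have hB := (smul_eq_ev_mul hd.pair_left hd.pair_right (by omega) (m := 10) (by omega) (r := 0)
    (B := xSub W a * (xSub W a * c₅) - mon W 4 * (algebraMap F _ b₁ * (xSub W a * mon W 3) +
      algebraMap F _ b₂ * (mon W 3 * mon W 3))) ?_ ?_).2
  rotate_left
  · refine sub_mem (CoordRing.mul_mem (xSub_mem a) (CoordRing.mul_mem (xSub_mem a) hc₅6))
      (CoordRing.mul_mem h4 (b := 6) (add_mem ?_ ?_))
    · exact V_mono (by omega) (CoordRing.mul_mem (hrV _) (CoordRing.mul_mem (xSub_mem a) h3))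
    · exact CoordRing.mul_mem (hrV _) (CoordRing.mul_mem h3 h3)
  · rw [zero_smul]
    refine (hkill ?_).symm
    simp only [map_sub, map_mul, map_add]
    linear_combination D.ev (xSub W a) ^ 2 * hc₅v + D.ev (mon W 4) * (K b₁ * D.ev (xSub W a) * v +
      K b₂ * (D.ev (xSub W a) * w + D.ev (mon W 3) * v)) * hxw2
  have ev1 : evalAt hd.onCurve (xSub W a) = 0 := by simp [evalAt_apply, xSub]
  have ev2 : evalAt hd.onCurve (mon W 3) = b := by rw [mon_three]; simp [evalAt_apply]
  have ev3 : evalAt hd.onCurve (mon W 4) = a ^ 2 := by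
    rw [mon_four_eq, map_mul, mon_two]; simp [evalAt_apply, pow_two]
  -- At the point `(a, b)` only the last term survives, with the nonzero factor `a² b²`. After
  -- cancelling `x - a`, the same argument works for `b₁`.
  have hb₂ : b₂ = 0 := by
    have := congrArg (evalAt hd.onCurve) hB
    simp only [map_sub, map_mul, map_add, map_zero, ev1, ev2, ev3, AlgHom.commutes] at this
    simpa [ha, hb] using this
  have hb₁ : b₁ = 0 := by
    rw [hb₂, map_zero, zero_mul, add_zero] at hB
    have h5 : xSub W a * (xSub W a * c₅ - mon W 4 * (algebraMap F _ b₁ * mon W 3)) = 0 := by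
      rw [← hB]; ring
    have := congrArg (evalAt hd.onCurve) ((mul_eq_zero.1 h5).resolve_left (xSub_ne_zero a))
    simp only [map_sub, map_mul, map_zero, ev1, ev2, ev3, AlgHom.commutes] at this
    simpa [ha, hb] using this
  set p := xSub W a * S with hp
  have hpV : p ∈ V W 6 := CoordRing.mul_mem (xSub_mem a) hS
  have hE : D.ev (p * p - mon W 3 * α * p - algebraMap F _ r * (mon W 3 * mon W 3 * S) -
      mon W 3 * mon W 3 * β) * (v * v) = 0 := by
    rw [hb₁, hb₂] at hzz
    simp only [map_zero, zero_mul, add_zero] at hzz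
    simp only [map_sub, map_mul]
    have h5 : D.ev p = D.ev (xSub W a) * D.ev S := map_mul _ _ _
    linear_combination D.ev (mon W 3) ^ 2 * hzz - (D.ev (mon W 3) * z + D.ev p * v -
      D.ev (mon W 3) * (D.ev α * v + K r * w)) * hyz + K r * w * D.ev (mon W 3) * v * h5 +
      K r * D.ev (mon W 3) * D.ev S * v * hxw2
  set E := p * p - mon W 3 * α * p - algebraMap F _ r * (mon W 3 * mon W 3 * S) -
      mon W 3 * mon W 3 * β with hEdef
  have q1 : mon W 3 * α * p ∈ V W 11 := CoordRing.mul_mem (CoordRing.mul_mem h3 hα) hpV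
  have q2 : algebraMap F _ r * (mon W 3 * mon W 3 * S) ∈ V W 10 :=
    CoordRing.mul_mem (hrV r) (CoordRing.mul_mem (CoordRing.mul_mem h3 h3) hS)
  have q3 : mon W 3 * mon W 3 * β ∈ V W 10 := CoordRing.mul_mem (CoordRing.mul_mem h3 h3) hβ
  have hEV : E ∈ V W 12 := sub_mem (sub_mem (sub_mem (CoordRing.mul_mem hpV hpV)
    (V_mono (by omega) q1)) (V_mono (by omega) q2)) (V_mono (by omega) q3)
  have hE12 : coef W 12 E = η * η := by
    have hp6 : coef W 6 p = -η := by
      rw [hp, show 6 = 2 + 4 by rfl, coef_mul (xSub_mem a) hS, coef_xSub, one_mul, hS4]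
    rw [hEdef, map_sub, map_sub, map_sub, q1 _ (by omega), q2 _ (by omega), q3 _ (by omega),
      show 12 = 6 + 6 by rfl, coef_mul hpV hpV, hp6]
    ring
  -- The values of `E` vanish wherever `v` does not, yet `v` reads the leading coefficient of `E`.
  have h9 := hd.pair_left E hEV
  rw [pair_apply, ← mul_one v, mul_dotProduct_eq, one_mul, hE12] at h9
  have h10 : v ⬝ᵥ D.ev E = 1 ⬝ᵥ (D.ev E * v) := by
    rw [← mul_dotProduct_eq, one_mul, dotProduct_comm]
  rw [h10, hkill hE, dotProduct_zero] at h9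
  exact hη (mul_self_eq_zero.1 h9.symm)

/-- The third power of the dual of the untwisted code is everything. -/
theorem mul_mul_eq_top :
    orth ((V W 8).map D.ev.toLinearMap) * orth ((V W 8).map D.ev.toLinearMap) *
      orth ((V W 8).map D.ev.toLinearMap) = ⊤ := by
  have h3 : mon W 3 ∈ V W 3 := mon_mem le_rfl
  have h2 : mon W 2 ∈ V W 2 := mon_mem le_rfl
  set U := orth ((V W 8).map D.ev.toLinearMap) with hU
  have hv : ∀ u ∈ V W 3, D.ev u * v ∈ U := fun u hu => D.mem_orth_map.2 fun g hg => by
    have h := CoordRing.mul_mem hu hg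
    rw [pair_ev_mul, hd.pair_left _ (V_mono (by omega) h)]
    exact h _ (by omega)
  have hv1 : v ∈ U := by
    have := hv (mon W 0) (mon_mem (by omega))
    rwa [mon_zero, map_one, one_mul] at this
  have hw : w ∈ U := D.mem_orth_map.2 fun g hg => by
    rw [hd.pair_right _ (V_mono (by omega) hg)]
    exact hg _ (by omega)
  refine eq_top_of_orth_eq_bot (eq_bot_iff.2 fun f hf => (Submodule.mem_bot F).2 ?_)
  have key : ∀ c ∈ U, ∀ d ∈ U, ∃ s ∈ V W 8, f * (c * d) = D.ev s := fun c hc d hd' => by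
    have := mem_orth_mul.1 hf _ (Submodule.mul_mem_mul hc hd')
    rw [hU, orth_orth] at this
    obtain ⟨s, hs, hs'⟩ := this
    exact ⟨s, hs, hs'.symm⟩
  -- Multiplying a product by a function of order `i` keeps it within `V 8` as long as its factors
  -- stay in `U`, so the original order drops to `8 - i`.
  have step : ∀ {c d : Fin 12 → F} {s u : CoordRing W} {i l : ℕ}, c ∈ U → d ∈ U →
      f * (c * d) = D.ev u * D.ev s → u * s ∈ V W l → l < 12 → u ∈ V W i → coef W i u = 1 →
      i ≤ 8 → s ∈ V W (8 - i) := fun {c d s u i l} hc hd' h hus hl hu hu1 hi => by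
    obtain ⟨s', hs', h'⟩ := key c hc d hd'
    have h5 : u * s = s' := D.eq_of_ev_eq (m := max l 8) (by omega) (V_mono (le_max_left _ _) hus)
      (V_mono (le_max_right _ _) hs') (by rw [map_mul, ← h, h'])
    refine mem_V_of_mul_mem hu (by rw [hu1]; exact one_ne_zero) ?_
    rwa [mul_comm, h5, Nat.sub_add_cancel hi]
  have c2 := coef_mon_self (W := W) (m := 2) (by omega)
  have c3 := coef_mon_self (W := W) (m := 3) (by omega)
  have hx := hv (mon W 2) (V_mono (by omega) h2)
  have hy := hv (mon W 3) h3
  -- The factors `x`, `x²`, `y²` lower the order of the function behind `f v²` from 8 to 6, 4 and 2,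
  -- each step keeping the next product below order 12.
  obtain ⟨p, hp, hfp⟩ := key v hv1 v hv1
  have hp : p ∈ V W 6 := step hv1 hx (by rw [← hfp]; ring) (CoordRing.mul_mem h2 hp)
    (by omega) h2 c2 (by omega)
  have hp : p ∈ V W 4 := step hx hx (i := 4) (u := mon W 2 * mon W 2)
    (by rw [← hfp, map_mul]; ring) (CoordRing.mul_mem (CoordRing.mul_mem h2 h2) hp)
    (by omega) (CoordRing.mul_mem h2 h2) ((coef_mul h2 h2).trans (by rw [c2, one_mul])) (by omega)
  have hp : p ∈ V W 2 := step hy hy (i := 6) (u := mon W 3 * mon W 3)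
    (by rw [← hfp, map_mul]; ring) (CoordRing.mul_mem (CoordRing.mul_mem h3 h3) hp)
    (by omega) (CoordRing.mul_mem h3 h3) ((coef_mul h3 h3).trans (by rw [c3, one_mul])) (by omega)
  obtain ⟨q, hq, hfq⟩ := key v hv1 w hw
  have hq : q ∈ V W 6 := step hx hw (by rw [← hfq]; ring) (CoordRing.mul_mem h2 hq)
    (by omega) h2 c2 (by omega)
  obtain ⟨r, hr, hfr⟩ := key w hw w hw
  have hxw : D.ev (xSub W a) * w = D.ev (mon W 3) * v := by
    rw [hd.xSub_mul, hs.negY_eq, ySub_zero]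
  have e1 : xSub W a * q = mon W 3 * p := by
    refine D.eq_of_ev_eq (m := 8) (by omega) (CoordRing.mul_mem (xSub_mem a) hq)
      (V_mono (by omega) (CoordRing.mul_mem h3 hp)) ?_
    rw [map_mul, map_mul, ← hfp, ← hfq]
    linear_combination f * v * hxw
  have e2 : xSub W a * r = mon W 3 * q := by
    refine D.eq_of_ev_eq (m := 10) (by omega) (CoordRing.mul_mem (xSub_mem a) hr)
      (V_mono (by omega) (CoordRing.mul_mem h3 hq)) ?_
    rw [map_mul, map_mul, ← hfr, ← hfq]
    linear_combination f * w * hxw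
  have ev1 : evalAt hd.onCurve (xSub W a) = 0 := by simp [evalAt_apply, xSub]
  have ev2 : evalAt hd.onCurve (mon W 3) = b := by rw [mon_three]; simp [evalAt_apply]
  -- `p` and `q` are constant multiples of `x - a` and `y`
  have hp1 : p - coef W 2 p • xSub W a ∈ V W 1 :=
    sub_coef_smul_mem hp (xSub_mem a) (coef_xSub a)
  rw [V_one] at hp1
  have hp2 := eq_of_mem_V_zero hp1
  -- Evaluating both relations at `(a, b)`, where `y` has the nonzero value `b`, shows that `p` and
  -- `q` vanish there.
  have hpe := congrArg (evalAt hd.onCurve) e1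
  have hqe := congrArg (evalAt hd.onCurve) e2
  have hpQ := congrArg (evalAt hd.onCurve) hp2
  rw [map_mul, map_mul, ev1, ev2, zero_mul] at hpe hqe
  have hpe := (mul_eq_zero.1 hpe.symm).resolve_left hs.ne_zero
  have hqe := (mul_eq_zero.1 hqe.symm).resolve_left hs.ne_zero
  rw [map_sub, map_smul, hpe, ev1, smul_zero, sub_zero, AlgHom.commutes] at hpQ
  rw [Algebra.algebraMap_self, RingHom.id_apply] at hpQ
  rw [← hpQ, map_zero, sub_eq_zero] at hp2
  have hq2 : q = coef W 2 p • mon W 3 := by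
    refine mul_left_cancel₀ (xSub_ne_zero a) ?_
    rw [e1, mul_smul_comm, mul_comm, hp2, smul_mul_assoc]
    congr 2
  have hc : coef W 2 p = 0 := by
    rw [hq2, map_smul, ev2, smul_eq_mul] at hqe
    exact (mul_eq_zero.1 hqe).resolve_right hs.ne_zero
  rw [hc, zero_smul] at hp2 hq2
  have hr0 : r = 0 := by
    rw [hq2, mul_zero] at e2
    exact (mul_eq_zero.1 e2).resolve_left (xSub_ne_zero a)
  exact hd.eq_zero_of_mul_sq (by omega) (by rw [hfp, hp2, map_zero]) (by rw [hfr, hr0, map_zero])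

end

/-- The candidates have dimension at most `m - 2`, so a larger conductor than claimed must consist
of all of them. -/
theorem finrank_conductor_or {F : Type*} [Field F] {W : WeierstrassCurve F} {n k m : ℕ}
    {D : Points W n} {η : F} {v w : Fin n → F} {a b : F} (hd : D.IsDual v w a b)
    (hr : HighRate n k 2 4 m) (hs : IsSpecial W a b) (hη : η ≠ 0) (h2 : (2 : F) = 0) :
    finrank F (D.conductor k 2 η) + 3 ≤ m ∨ (finrank F (D.conductor k 2 η) + 2 ≤ m ∧
      orth (D.twistCode k 2 η) * orth (D.twistCode k 2 η) * orth (D.twistCode k 2 η) ≠ ⊤ ∧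
      orth ((V W k).map D.ev.toLinearMap) * orth ((V W k).map D.ev.toLinearMap) *
        orth ((V W k).map D.ev.toLinearMap) = ⊤) := by
  have hm := hr.hm
  have hle := hd.finrank_conductor_le (η := η) hr
  have hc := finrank_candidates (η := η) hs hm
  have : FiniteDimensional F (candidates W η m a b) :=
    Submodule.finiteDimensional_of_le (inf_le_left.trans inf_le_left)
  have hle' := Submodule.finrank_mono (hd.conductorPoly_le_candidates (η := η) hr)
  by_contra! h
  obtain ⟨h1, h3⟩ := h
  have hX : candidates W η m a b ≤ conductorPoly D v w a b k 2 η m :=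
    (Submodule.eq_of_le_of_finrank_le (hd.conductorPoly_le_candidates hr) (by omega)).ge
  have hn := hr.hn
  have hk := hr.hk
  have hpar := hr.par
  -- The parity condition makes `k`, hence `m = k - 2`, even.
  obtain rfl | h8 : m = 6 ∨ 8 ≤ m := by omega
  · obtain rfl : n = 12 := by omega
    obtain rfl : k = 8 := by omega
    by_cases ha : a = 0
    · exact h3 (by omega) (hd.mul_mul_ne_top hr hs hX ha) (hd.mul_mul_eq_top hs)
    · exact hd.false_of_ne_zero hs hr hX hη h2 ha
  · exact hd.false_of_eight_le hr hs hX hη h8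

end IsDual

end Points

end EllipticCode

namespace EllipticCode

open Polynomial Module

/-! ### Monomial maps -/

section Monomial

variable {F : Type*} [Field F] {n : ℕ}

/-- The permutation of the coordinates by `σ`, followed by the multiplication by `v`. -/
def monomialMap (σ : Equiv.Perm (Fin n)) (v : Fin n → F) : (Fin n → F) →ₗ[F] (Fin n → F) where
  toFun c i := v i * c (σ i)
  map_add' c d := by ext i; simp [mul_add]
  map_smul' r c := by ext i; simp [mul_left_comm]

theorem monomialMap_apply (σ : Equiv.Perm (Fin n)) (v c : Fin n → F) (i : Fin n) :
    monomialMap σ v c i = v i * c (σ i) := rfl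

theorem monomialMap_mul (σ : Equiv.Perm (Fin n)) (v w c d : Fin n → F) :
    monomialMap σ (v * w) (c * d) = monomialMap σ v c * monomialMap σ w d := by
  ext i
  simp only [monomialMap_apply, Pi.mul_apply]
  ring

theorem monomialMap_injective (σ : Equiv.Perm (Fin n)) {v : Fin n → F} (hv : ∀ i, v i ≠ 0) :
    Function.Injective (monomialMap σ v) := fun c d h => by
  ext i
  have := congrFun h (σ.symm i)
  simp only [monomialMap_apply, Equiv.apply_symm_apply] at this
  exact mul_left_cancel₀ (hv _) this

theorem monomialMap_dotProduct (σ : Equiv.Perm (Fin n)) {v : Fin n → F} (hv : ∀ i, v i ≠ 0)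
    (c d : Fin n → F) : monomialMap σ v⁻¹ c ⬝ᵥ monomialMap σ v d = c ⬝ᵥ d := by
  simp only [dotProduct, monomialMap_apply, Pi.inv_apply]
  rw [← Equiv.sum_comp σ (fun i => c i * d i)]
  refine Finset.sum_congr rfl fun i _ => ?_
  have := hv i
  field_simp

theorem monomiallyEquivalent_iff {C₁ C₂ : Submodule F (Fin n → F)} :
    MonomiallyEquivalent C₁ C₂ ↔ ∃ (σ : Equiv.Perm (Fin n)) (v : Fin n → F), (∀ i, v i ≠ 0) ∧
      C₂ = C₁.map (monomialMap σ v) :=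
  exists₂_congr fun _ _ => and_congr_right fun _ => by
    rw [← SetLike.coe_set_eq (p := C₂)]
    rfl

theorem map_monomialMap_mul (σ : Equiv.Perm (Fin n)) (v w : Fin n → F)
    (A B : Submodule F (Fin n → F)) : (A * B).map (monomialMap σ (v * w)) =
      A.map (monomialMap σ v) * B.map (monomialMap σ w) := by
  apply le_antisymm
  · rw [Submodule.map_le_iff_le_comap, Submodule.mul_le]
    intro a ha b hb
    rw [Submodule.mem_comap, monomialMap_mul]
    exact Submodule.mul_mem_mul (Submodule.mem_map_of_mem ha) (Submodule.mem_map_of_mem hb)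
  · rw [Submodule.mul_le]
    rintro _ ⟨a, ha, rfl⟩ _ ⟨b, hb, rfl⟩
    rw [← monomialMap_mul]
    exact Submodule.mem_map_of_mem (Submodule.mul_mem_mul ha hb)

theorem finrank_map_monomialMap (σ : Equiv.Perm (Fin n)) {v : Fin n → F} (hv : ∀ i, v i ≠ 0)
    (A : Submodule F (Fin n → F)) : finrank F (A.map (monomialMap σ v)) = finrank F A :=
  (Submodule.equivMapOfInjective _ (monomialMap_injective σ hv) A).finrank_eq.symm

theorem orth_map_monomialMap (σ : Equiv.Perm (Fin n)) {v : Fin n → F} (hv : ∀ i, v i ≠ 0)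
    (A : Submodule F (Fin n → F)) :
    orth (A.map (monomialMap σ v)) = (orth A).map (monomialMap σ v⁻¹) := by
  refine (Submodule.eq_of_le_of_finrank_eq ?_ ?_).symm
  · rintro _ ⟨c, hc, rfl⟩ _ ⟨d, hd, rfl⟩
    rw [monomialMap_dotProduct σ hv]
    exact hc d hd
  · rw [finrank_map_monomialMap σ (v := v⁻¹) (fun i => inv_ne_zero (hv i)), finrank_orth, finrank_orth,
      finrank_map_monomialMap σ hv]

namespace MonomiallyEquivalent

variable {C₁ C₂ : Submodule F (Fin n → F)} (h : MonomiallyEquivalent C₁ C₂)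
include h

theorem finrank_eq : finrank F C₁ = finrank F C₂ := by
  obtain ⟨σ, v, hv, rfl⟩ := monomiallyEquivalent_iff.1 h
  rw [finrank_map_monomialMap σ hv]

theorem orth : MonomiallyEquivalent (orth C₁) (orth C₂) := by
  obtain ⟨σ, v, hv, rfl⟩ := monomiallyEquivalent_iff.1 h
  exact monomiallyEquivalent_iff.2 ⟨σ, v⁻¹, fun i => inv_ne_zero (hv i),
    orth_map_monomialMap σ hv _⟩

theorem sq : MonomiallyEquivalent (C₁ * C₁) (C₂ * C₂) := by
  obtain ⟨σ, v, hv, rfl⟩ := monomiallyEquivalent_iff.1 h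
  exact monomiallyEquivalent_iff.2 ⟨σ, v * v, fun i => mul_ne_zero (hv i) (hv i),
    (map_monomialMap_mul σ v v _ _).symm⟩

theorem cube : MonomiallyEquivalent (C₁ * C₁ * C₁) (C₂ * C₂ * C₂) := by
  obtain ⟨σ, v, hv, rfl⟩ := monomiallyEquivalent_iff.1 h
  exact monomiallyEquivalent_iff.2 ⟨σ, v * v * v,
    fun i => mul_ne_zero (mul_ne_zero (hv i) (hv i)) (hv i), by
      rw [map_monomialMap_mul, map_monomialMap_mul]⟩

end MonomiallyEquivalent

end Monomial

/-! ### Generalized Reed-Solomon codes -/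

section ReedSolomon

variable {F : Type*} [Field F] {n : ℕ}

/-- Evaluation of polynomials, with multipliers. -/
noncomputable def grsMap (α v : Fin n → F) : F[X] →ₗ[F] (Fin n → F) :=
  LinearMap.pi fun i => v i • (Polynomial.leval (α i) : F[X] →ₗ[F] F)

theorem grsMap_apply (α v : Fin n → F) (g : F[X]) (i : Fin n) :
    grsMap α v g i = v i * g.eval (α i) := rfl

theorem grs_eq (k : ℕ) (α v : Fin n → F) : grs k α v = (degreeLT F k).map (grsMap α v) := rfl

theorem finrank_grs_le (k : ℕ) (α v : Fin n → F) : finrank F (grs k α v) ≤ k := by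
  rw [grs_eq]
  have h := CoordRing.finrank_degreeLT (F := F) k
  exact (Submodule.finrank_map_le _ _).trans h.le

theorem grs_mul_grs_le (k : ℕ) (α v : Fin n → F) :
    grs k α v * grs k α v ≤ grs (2 * k - 1) α (v * v) := by
  rw [Submodule.mul_le]
  rintro _ ⟨f, hf, rfl⟩ _ ⟨g, hg, rfl⟩
  refine ⟨f * g, ?_, ?_⟩
  · rw [SetLike.mem_coe, mem_degreeLT] at hf hg ⊢
    by_cases h0 : f * g = 0
    · rw [h0, degree_zero]
      exact WithBot.bot_lt_coe _
    have hf0 := left_ne_zero_of_mul h0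
    have hg0 := right_ne_zero_of_mul h0
    rw [← natDegree_lt_iff_degree_lt h0, natDegree_mul hf0 hg0]
    rw [← natDegree_lt_iff_degree_lt hf0] at hf
    rw [← natDegree_lt_iff_degree_lt hg0] at hg
    omega
  · ext i
    change grsMap α (v * v) (f * g) i = grsMap α v f i * grsMap α v g i
    simp only [grsMap_apply, Pi.mul_apply, eval_mul]
    ring

theorem finrank_grs_mul_grs_le (k : ℕ) (α v : Fin n → F) :
    finrank F (grs k α v * grs k α v : Submodule F (Fin n → F)) ≤ 2 * k - 1 :=
  (Submodule.finrank_mono (grs_mul_grs_le k α v)).trans (finrank_grs_le _ _ _)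

theorem finrank_grs {k : ℕ} {α v : Fin n → F} (hα : Function.Injective α) (hv : ∀ i, v i ≠ 0)
    (hk : k ≤ n) : finrank F (grs k α v) = k := by
  have hinj : Function.Injective ((grsMap α v).domRestrict (degreeLT F k)) := by
    rw [injective_iff_map_eq_zero]
    rintro ⟨g, hg⟩ h
    ext1
    rw [mem_degreeLT] at hg
    refine Polynomial.eq_zero_of_degree_lt_of_eval_index_eq_zero (s := Finset.univ) (v := α)
      hα.injOn (hg.trans_le (by simpa using hk)) fun i _ => ?_
    exact (mul_eq_zero.1 (congrFun h i)).resolve_left (hv i)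
  rw [grs_eq, ← LinearMap.range_domRestrict, LinearMap.finrank_range_of_inj hinj,
    CoordRing.finrank_degreeLT]

/-- The dual of a generalized Reed-Solomon code is a generalized Reed-Solomon code. -/
theorem exists_orth_grs_eq {k : ℕ} {α v : Fin n → F} (hα : Function.Injective α)
    (hv : ∀ i, v i ≠ 0) (hk : k ≤ n) : ∃ u : Fin n → F, orth (grs k α v) = grs (n - k) α u := by
  classical
  -- These are the Lagrange denominators, the classical multipliers of the dual code.
  set w : Fin n → F := fun i => ∏ j ∈ Finset.univ.erase i, (α i - α j) with hw
  have hw0 : ∀ i, w i ≠ 0 := fun i => Finset.prod_ne_zero_iff.2 fun j hj =>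
    sub_ne_zero.2 fun h => (Finset.ne_of_mem_erase hj) (hα h).symm
  have hu : ∀ i, (v i * w i)⁻¹ ≠ 0 := fun i => inv_ne_zero (mul_ne_zero (hv i) (hw0 i))
  refine ⟨fun i => (v i * w i)⁻¹, (Submodule.eq_of_le_of_finrank_eq ?_ ?_).symm⟩
  · rintro _ ⟨f, hf, rfl⟩ _ ⟨g, hg, rfl⟩
    rw [SetLike.mem_coe, mem_degreeLT] at hf hg
    by_cases h0 : f * g = 0
    · refine Finset.sum_eq_zero fun i _ => ?_
      change (v i * w i)⁻¹ * f.eval (α i) * (v i * g.eval (α i)) = 0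
      have : f.eval (α i) * g.eval (α i) = 0 := by rw [← eval_mul, h0, eval_zero]
      linear_combination (v i * w i)⁻¹ * v i * this
    have hf0 := left_ne_zero_of_mul h0
    have hg0 := right_ne_zero_of_mul h0
    rw [← natDegree_lt_iff_degree_lt hf0] at hf
    rw [← natDegree_lt_iff_degree_lt hg0] at hg
    have hd := natDegree_mul hf0 hg0
    -- The dot product is the interpolation formula for the coefficient of degree `n - 1`, which
    -- exceeds the degree of the product.
    have key := Lagrange.coeff_eq_sum (s := Finset.univ) hα.injOn (P := f * g) (by
      rw [← natDegree_lt_iff_degree_lt h0, Finset.card_univ, Fintype.card_fin]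
      omega)
    rw [Finset.card_univ, Fintype.card_fin, coeff_eq_zero_of_natDegree_lt (by omega)] at key
    rw [key]
    refine Finset.sum_congr rfl fun i _ => ?_
    change (v i * w i)⁻¹ * f.eval (α i) * (v i * g.eval (α i)) = _ / w i
    have h1 := hv i
    have h2 := hw0 i
    rw [eval_mul]
    field_simp
  · rw [finrank_grs hα hu (Nat.sub_le _ _), finrank_orth, finrank_grs hα hv hk]

end ReedSolomon

end EllipticCode

namespace EllipticCode

open Polynomial Module CoordRing

/-! ### Squares of twisted codes of low rate -/

namespace CoordRing

variable {F : Type*} [Field F] {W : WeierstrassCurve F}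

/-- Functions with distinct pole orders are linearly independent. -/
theorem card_le_finrank_of_order (I : Finset ℕ) : ∀ (J : Submodule F (CoordRing W))
    [FiniteDimensional F J], (∀ i ∈ I, ∃ g ∈ J, g ∈ V W i ∧ coef W i g ≠ 0) →
    I.card ≤ finrank F J := by
  induction I using Finset.induction_on_max with
  | empty => simp
  | insert a s hs ih =>
    intro J _ hJ
    obtain ⟨g, hgJ, -, hg⟩ := hJ a (Finset.mem_insert_self a s)
    rw [Finset.card_insert_of_notMem fun h => lt_irrefl a (hs a h),
      ← finrank_inf_ker_add_one (coef W a) hgJ hg]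
    have : FiniteDimensional F (J ⊓ LinearMap.ker (coef W a) : Submodule F (CoordRing W)) :=
      Submodule.finiteDimensional_of_le inf_le_left
    refine Nat.add_le_add_right (ih _ fun i hi => ?_) 1
    obtain ⟨f, hfJ, hfi, hf⟩ := hJ i (Finset.mem_insert_of_mem hi)
    exact ⟨f, ⟨hfJ, hfi a (hs i hi)⟩, hfi, hf⟩

/-- Monomials of order at least 4 are subtracted from the top down, which does not touch the
coefficient at order 3. -/
theorem exists_mem_V_three {X : Submodule F (CoordRing W)} {N : ℕ}
    (hX : ∀ m, 4 ≤ m → m ≤ N → mon W m ∈ X) {g : CoordRing W} (hg : g ∈ V W N) (hgX : g ∈ X) :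
    ∃ g' ∈ X, g' ∈ V W 3 ∧ coef W 3 g' = coef W 3 g := by
  induction N generalizing g with
  | zero => exact ⟨g, hgX, V_mono (by omega) hg, rfl⟩
  | succ N ih =>
    rcases Nat.lt_or_ge N 3 with hN | hN
    · exact ⟨g, hgX, V_mono (by omega) hg, rfl⟩
    · obtain ⟨g', h1, h2, h3⟩ := ih (fun m hm hm' => hX m hm (by omega))
        (g := g - coef W (N + 1) g • mon W (N + 1))
        (sub_coef_smul_mem hg (mon_mem le_rfl) (coef_mon_self (by omega)))
        (sub_mem hgX (X.smul_mem _ (hX _ (by omega) le_rfl)))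
      refine ⟨g', h1, h2, h3.trans ?_⟩
      rw [map_sub, map_smul, coef_mon _ _ (by omega), if_neg (by omega), smul_zero, sub_zero]

variable {k t : ℕ} {η : F}

theorem twistSpace_le : twistSpace W k t η ≤ V W (k + 1) := inf_le_left

theorem mon_mem_twistSpace {m : ℕ} (hm : m ≤ k) (hmt : m ≠ t) (hm1 : m ≠ 1) :
    mon W m ∈ twistSpace W k t η :=
  ⟨mon_mem (by omega), by
    change twist W k t η _ = 0
    rw [twist_of_mem (mon_mem hm), coef_mon _ _ hm1, if_neg hmt.symm]⟩

theorem mon_add_smul_mem_twistSpace (htk : t ≤ k) (ht1 : t ≠ 1) (hk : 1 ≤ k) :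
    mon W (k + 1) + η • mon W t ∈ twistSpace W k t η := by
  refine ⟨add_mem (mon_mem le_rfl) (Submodule.smul_mem _ _ (mon_mem (by omega))), ?_⟩
  change twist W k t η _ = 0
  rw [twist_apply, map_add, map_add, map_smul, map_smul, coef_mon_self ht1,
    coef_mon_self (by omega), coef_mon _ _ (by omega), if_neg (by omega), coef_mon _ _ ht1,
    if_neg (by omega)]
  simp

theorem exists_order_twistSpace (htk : t ≤ k) (ht1 : t ≠ 1) (hk : 1 ≤ k) {m : ℕ}
    (hm : m ≤ k + 1) (hmt : m ≠ t) (hm1 : m ≠ 1) :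
    ∃ g ∈ twistSpace W k t η, g ∈ V W m ∧ coef W m g ≠ 0 := by
  by_cases h : m ≤ k
  · exact ⟨_, mon_mem_twistSpace h hmt hm1, mon_mem le_rfl, by simp [coef_mon_self hm1]⟩
  · obtain rfl : m = k + 1 := by omega
    refine ⟨_, mon_add_smul_mem_twistSpace htk ht1 hk,
      add_mem (mon_mem le_rfl) (Submodule.smul_mem _ _ (mon_mem htk.step)), ?_⟩
    rw [map_add, map_smul, coef_mon_self hm1, coef_mon _ _ ht1, if_neg hmt]
    simp

theorem finrank_twistSpace (htk : t ≤ k) (ht1 : t ≠ 1) :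
    finrank F (twistSpace W k t η) = k := by
  have h := finrank_inf_ker_add_one (twist W k t η) (J := V W (k + 1)) (mon_mem htk.step)
    (by rw [twist_of_mem (mon_mem htk), coef_mon_self ht1]; exact one_ne_zero)
  rw [finrank_V _ (by omega)] at h
  exact Nat.succ.inj h

theorem V_mul_V_le (a b : ℕ) : V W a * V W b ≤ V W (a + b) :=
  Submodule.mul_le.2 fun _ hf _ hg => CoordRing.mul_mem hf hg

theorem twistSpace_mul_le : twistSpace W k t η * twistSpace W k t η ≤ V W (2 * k + 2) :=
  (mul_le_mul' twistSpace_le twistSpace_le).trans ((V_mul_V_le _ _).trans (V_mono (by omega)))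

instance : FiniteDimensional F
    (twistSpace W k t η * twistSpace W k t η : Submodule F (CoordRing W)) :=
  Submodule.finiteDimensional_of_le twistSpace_mul_le

theorem exists_order_twistSpace_mul (htk : t ≤ k) (ht1 : t ≠ 1) (hk : 1 ≤ k) {a b m : ℕ}
    (ha : a ≤ k + 1) (hat : a ≠ t) (ha1 : a ≠ 1) (hb : b ≤ k + 1) (hbt : b ≠ t) (hb1 : b ≠ 1)
    (hab : a + b = m) : ∃ g ∈ twistSpace W k t η * twistSpace W k t η, g ∈ V W m ∧
      coef W m g ≠ 0 := by
  obtain ⟨f, hf, hfV, hf0⟩ := exists_order_twistSpace (W := W) (η := η) htk ht1 hk ha hat ha1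
  obtain ⟨g, hg, hgV, hg0⟩ := exists_order_twistSpace (W := W) (η := η) htk ht1 hk hb hbt hb1
  subst hab
  exact ⟨f * g, Submodule.mul_mem_mul hf hg, CoordRing.mul_mem hfV hgV,
    by rw [coef_mul hfV hgV]; exact mul_ne_zero hf0 hg0⟩

/-- The sumset of the available orders misses at most one order besides 1. -/
theorem exists_add_eq (hk : 4 ≤ k) (htk : t ≤ k) (ht : 2 ≤ t) (par : t % 2 = k % 2) :
    ∃ r, ∀ m ≤ 2 * k + 2, m ≠ 1 → m ≠ r → ∃ a b, (a ≤ k + 1 ∧ a ≠ t ∧ a ≠ 1) ∧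
      (b ≤ k + 1 ∧ b ≠ t ∧ b ≠ 1) ∧ a + b = m := by
  -- For `t = k` the sum `(k + 1) + k` is lost; for `t = 2, 3` the order `t` itself; otherwise
  -- nothing, and 1 is a dummy value.
  refine ⟨if t = k then 2 * k + 1 else if t ≤ 3 then t else 1, fun m hm hm1 hmr => ?_⟩
  rcases Nat.lt_or_ge (k + 1) m with h | h
  · rcases eq_or_ne m (k + 2) with rfl | h2
    · by_cases h3 : t = 2 ∨ t = k
      · exact ⟨3, k - 1, by omega, by omega, by omega⟩
      · exact ⟨2, k, by omega, by omega, by omega⟩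
    · rcases eq_or_ne m (k + 1 + t) with rfl | h3
      · have htk' : t ≠ k := fun h => by rw [if_pos h] at hmr; omega
        exact ⟨t + 1, k, by omega, by omega, by omega⟩
      · exact ⟨k + 1, m - (k + 1), by omega, by omega, by omega⟩
  · rcases eq_or_ne m t with rfl | h2
    · refine ⟨2, m - 2, ?_⟩
      split_ifs at hmr <;> omega
    · exact ⟨0, m, by omega, by omega, by omega⟩

theorem mon_mem_twistSpace_mul (hk : 4 ≤ k) {m : ℕ} (hm : 4 ≤ m) (hmk : m ≤ k + 4)
    (hpar : k % 2 = 0) : mon W m ∈ twistSpace W k 0 η * twistSpace W k 0 η := by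
  have key : ∀ a b, a % 2 = 0 → a + b = m → 2 ≤ a → a ≤ k → 2 ≤ b → b ≤ k →
      mon W m ∈ twistSpace W k 0 η * twistSpace W k 0 η := by
    intro a b ha hab ha2 hak hb2 hbk
    rw [← hab, ← mon_mul_mon ha (by omega)]
    exact Submodule.mul_mem_mul (mon_mem_twistSpace hak (by omega) (by omega))
      (mon_mem_twistSpace hbk (by omega) (by omega))
  by_cases h : m ≤ k + 2
  · exact key 2 (m - 2) (by omega) (by omega) (by omega) (by omega) (by omega) (by omega)
  · exact key 4 (m - 4) (by omega) (by omega) (by omega) (by omega) (by omega) (by omega)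

theorem le_finrank_twistSpace_mul (hk : 4 ≤ k) (htk : t ≤ k) (ht1 : t ≠ 1)
    (par : t % 2 = k % 2) (hη : η ≠ 0) :
    2 * k + 1 ≤ finrank F
      (twistSpace W k t η * twistSpace W k t η : Submodule F (CoordRing W)) := by
  rcases Nat.lt_or_ge t 2 with ht | ht
  · obtain rfl : t = 0 := by omega
    have hpar : k % 2 = 0 := by omega
    have hg0 := mon_add_smul_mem_twistSpace (W := W) (η := η) htk ht1 (by omega)
    have h4 := fun m h1 h2 => mon_mem_twistSpace_mul (W := W) (η := η) (m := m) hk h1 h2 hpar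
    have hmem : ∀ m, 2 ≤ m → m ≤ 3 → mon W m * mon W (k + 1) + η • mon W m ∈
        twistSpace W k 0 η * twistSpace W k 0 η := by
      intro m h2 h3
      have := Submodule.mul_mem_mul (mon_mem_twistSpace (W := W) (η := η) (m := m) (k := k) (t := 0)
        (by omega) (by omega) (by omega)) hg0
      rwa [mul_add, mul_smul_comm, mon_zero, mul_one] at this
    have hcard : (Finset.Icc 2 (2 * k + 2)).card = 2 * k + 1 := by
      rw [Nat.card_Icc]; omega
    rw [← hcard]
    refine card_le_finrank_of_order _ _ fun m hm => ?_
    rw [Finset.mem_Icc] at hm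
    obtain rfl | rfl | hm4 : m = 2 ∨ m = 3 ∨ 4 ≤ m := by omega
    · refine ⟨η • mon W 2, ?_, Submodule.smul_mem _ _ (mon_mem le_rfl), ?_⟩
      -- For `t = 0` the orders 2 and 3 are not sums of available orders. Multiplying the twisted
      -- element by `x` gives a monomial already in the square plus `η x`.
      · have h := hmem 2 le_rfl (by omega)
        rw [mon_mul_mon (by omega) (by omega)] at h
        exact (Submodule.add_mem_iff_right _ (h4 _ (by omega) (by omega))).1 h
      · rw [map_smul, coef_mon_self (by omega), smul_eq_mul, mul_one]
        exact hη
    -- The product of `y` with the monomial of odd order `k + 1` is not a monomial, but it is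
    -- divisible by `x` and so has no coefficient at order 3.
    · have h := hmem 3 (by omega) le_rfl
      have hc : coef W 3 (mon W 3 * mon W (k + 1) + η • mon W 3) = η := by
        rw [show k + 1 = 2 + (k - 1) by omega, ← mon_mul_mon (by omega) (by omega),
          mul_left_comm, map_add, coef_three_mon_two_mul, map_smul, coef_mon_self (by omega)]
        simp
      obtain ⟨g, h1, h2, h3⟩ := exists_mem_V_three (N := k + 4) h4
        (add_mem (V_mono (by omega) (CoordRing.mul_mem (mon_mem le_rfl) (mon_mem le_rfl)))
          (Submodule.smul_mem _ _ (mon_mem (by omega)))) h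
      exact ⟨g, h1, h2, by rw [h3, hc]; exact hη⟩
    · obtain ⟨a, b, ha, hb, hab⟩ : ∃ a b, (2 ≤ a ∧ a ≤ k + 1) ∧ (2 ≤ b ∧ b ≤ k + 1) ∧
          a + b = m := by
        by_cases h : m ≤ k + 3
        · exact ⟨2, m - 2, by omega⟩
        · exact ⟨k + 1, m - (k + 1), by omega⟩
      exact exists_order_twistSpace_mul htk ht1 (by omega) ha.2 (by omega) (by omega) hb.2
        (by omega) (by omega) hab
  · obtain ⟨r, hr⟩ := exists_add_eq hk htk ht par
    have hcard : 2 * k + 1 ≤ (((Finset.range (2 * k + 3)).erase 1).erase r).card := by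
      have h1 := Finset.pred_card_le_card_erase (s := (Finset.range (2 * k + 3)).erase 1) (a := r)
      rw [Finset.card_erase_of_mem (Finset.mem_range.2 (by omega)), Finset.card_range] at h1
      omega
    refine hcard.trans (card_le_finrank_of_order _ _ fun m hm => ?_)
    rw [Finset.mem_erase, Finset.mem_erase, Finset.mem_range] at hm
    obtain ⟨a, b, ha, hb, hab⟩ := hr m (by omega) hm.2.1 hm.1
    exact exists_order_twistSpace_mul htk ht1 (by omega) ha.1 ha.2.1 ha.2.2 hb.1 hb.2.1 hb.2.2 hab

end CoordRing

namespace Points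

variable {F : Type*} [Field F] {W : WeierstrassCurve F} {n : ℕ} (D : Points W n)
variable {k t : ℕ} {η : F}

theorem finrank_twistCode (hk : k + 1 < n) (htk : t ≤ k) (ht1 : t ≠ 1) :
    finrank F (D.twistCode k t η) = k := by
  rw [twistCode, D.finrank_map_ev hk twistSpace_le, finrank_twistSpace htk ht1]

theorem le_finrank_twistCode_mul (hk : 4 ≤ k) (hn : 2 * k + 2 < n) (htk : t ≤ k) (ht1 : t ≠ 1)
    (par : t % 2 = k % 2) (hη : η ≠ 0) :
    2 * k + 1 ≤ finrank F (D.twistCode k t η * D.twistCode k t η : Submodule F (Fin n → F)) := by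
  rw [twistCode, ← Submodule.map_mul, D.finrank_map_ev hn twistSpace_mul_le]
  exact le_finrank_twistSpace_mul hk htk ht1 par hη

/-! ### Squares of elliptic curve codes and of their duals -/

/-- The elliptic curve code: the values of the functions with a pole of order at most `k`. -/
noncomputable def code (k : ℕ) : Submodule F (Fin n → F) := (V W k).map D.ev.toLinearMap

theorem finrank_code (hk : 1 ≤ k) (hkn : k < n) : finrank F (D.code k) = k := by
  rw [code, D.finrank_map_ev hkn le_rfl, finrank_V k hk]

theorem finrank_code_le (hk : 1 ≤ k) : finrank F (D.code k) ≤ k :=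
  (Submodule.finrank_map_le _ _).trans (finrank_V k hk).le

theorem finrank_code_mul_le (hk : 1 ≤ k) :
    finrank F (D.code k * D.code k : Submodule F (Fin n → F)) ≤ 2 * k := by
  refine (Submodule.finrank_mono ?_).trans (D.finrank_code_le (k := 2 * k) (by omega))
  rw [code, ← Submodule.map_mul, two_mul]
  exact Submodule.map_mono (V_mul_V_le k k)

variable {D}

theorem finrank_map_mulRight_le (A : Submodule F (Fin n → F)) (c : Fin n → F) :
    finrank F (A.map (LinearMap.mulRight F c)) ≤ finrank F A :=
  Submodule.finrank_map_le _ _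

/-- The dual behaves like an elliptic code of degree `j`. In the principal case its square consists
of functions of order at most `2 j` times `v²`; otherwise the rule for `w` reduces all products to
the span below. -/
theorem finrank_orth_code_mul_le {j : ℕ} (hn : 9 ≤ n) (hj : 2 ≤ j) (hk : 2 ≤ k)
    (hkj : k + j = n) :
    finrank F (orth (D.code k) * orth (D.code k) : Submodule F (Fin n → F)) ≤ 2 * j := by
  have horth : ∀ {c}, c ∈ orth (D.code k) ↔ ∀ g ∈ V W k, D.pair c g = 0 := D.mem_orth_map
  rcases D.isPrincipal_or (by omega) with ⟨v, hv⟩ | ⟨v, hv⟩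
  · have hle : orth (D.code k) * orth (D.code k) ≤
        (D.code (2 * j)).map (LinearMap.mulRight F (v * v)) := by
      rw [Submodule.mul_le]
      intro c hc d hd
      obtain ⟨f, hf, rfl⟩ := hv.exists_eq_mul (by omega) j k hkj (by omega) c (horth.1 hc)
      obtain ⟨g, hg, rfl⟩ := hv.exists_eq_mul (by omega) j k hkj (by omega) d (horth.1 hd)
      refine ⟨D.ev (f * g), ⟨f * g, V_mono (by omega) (CoordRing.mul_mem hf hg), rfl⟩, ?_⟩
      rw [LinearMap.mulRight_apply, map_mul]
      ring
    exact (Submodule.finrank_mono hle).trans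
      ((finrank_map_mulRight_le _ _).trans (D.finrank_code_le (by omega)))
  · obtain ⟨w, a, b, hd⟩ := exists_isDual hn hv
    have hvw : ∀ g ∈ V W (j - 1), ∃ p ∈ V W j, ∃ r : F,
        D.ev g * w = D.ev p * v + r • w := fun g hg => by
      obtain ⟨p, hp, r, h⟩ := exists_eq_mul_add_smul hd.pair_left hd.pair_right (by omega)
        (j - 1) (k - 1) (by omega) (by omega) (D.ev g * w) fun u hu => by
          rw [pair_ev_mul, hd.pair_right _ (V_mono (by omega) (CoordRing.mul_mem hg hu))]
          exact CoordRing.mul_mem hg hu _ (by omega)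
      exact ⟨p, V_mono (by omega) hp, r, h⟩
    -- The dimension of this space is at most `(2 j - 2) + 1 + 1`.
    set L : Submodule F (Fin n → F) := (D.code (2 * j - 2)).map (LinearMap.mulRight F (v * v)) ⊔
      (F ∙ v * w) ⊔ F ∙ w * w with hL
    have h1 : ∀ f ∈ V W (2 * j - 2), D.ev f * (v * v) ∈ L := fun f hf =>
      Submodule.mem_sup_left (Submodule.mem_sup_left ⟨D.ev f, ⟨f, hf, rfl⟩, rfl⟩)
    have h2 : ∀ g ∈ V W (j - 1), D.ev g * (v * w) ∈ L := fun g hg => by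
      obtain ⟨p, hp, r, h⟩ := hvw g hg
      have e : D.ev g * (v * w) = D.ev p * (v * v) + r • (v * w) := by
        rw [mul_left_comm, h, mul_add, mul_smul_comm]
        ring
      rw [e]
      exact add_mem (h1 p (V_mono (by omega) hp)) (Submodule.mem_sup_left (Submodule.mem_sup_right
        (Submodule.smul_mem _ _ (Submodule.mem_span_singleton_self _))))
    have h3 : w * w ∈ L := Submodule.mem_sup_right (Submodule.mem_span_singleton_self _)
    have hle : orth (D.code k) * orth (D.code k) ≤ L := by
      rw [Submodule.mul_le]
      intro c hc d hd'
      obtain ⟨f, hf, r, rfl⟩ := exists_eq_mul_add_smul hd.pair_left hd.pair_right (by omega)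
        (j - 2) k (by omega) (by omega) c (horth.1 hc)
      obtain ⟨g, hg, s, rfl⟩ := exists_eq_mul_add_smul hd.pair_left hd.pair_right (by omega)
        (j - 2) k (by omega) (by omega) d (horth.1 hd')
      have e : (D.ev f * v + r • w) * (D.ev g * v + s • w) = D.ev (f * g) * (v * v) +
          D.ev (s • f + r • g) * (v * w) + (r * s) • (w * w) := by
        ext i
        simp only [map_mul, map_add, map_smul, Pi.mul_apply, Pi.add_apply, Pi.smul_apply,
          smul_eq_mul]
        ring
      rw [e]
      refine add_mem (add_mem (h1 _ ?_) (h2 _ ?_)) (L.smul_mem _ h3)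
      · exact V_mono (by omega) (CoordRing.mul_mem hf hg)
      · exact V_mono (by omega) (add_mem (Submodule.smul_mem _ _ hf) (Submodule.smul_mem _ _ hg))
    refine (Submodule.finrank_mono hle).trans ?_
    rw [hL]
    have e1 := Submodule.finrank_add_le_finrank_add_finrank
      ((D.code (2 * j - 2)).map (LinearMap.mulRight F (v * v)) ⊔ F ∙ v * w) (F ∙ w * w)
    have e2 := Submodule.finrank_add_le_finrank_add_finrank
      ((D.code (2 * j - 2)).map (LinearMap.mulRight F (v * v))) (F ∙ v * w)
    have e3 := finrank_map_mulRight_le (D.code (2 * j - 2)) (v * v)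
    have e4 := D.finrank_code_le (k := 2 * j - 2) (by omega)
    have e5 : finrank F (F ∙ v * w) ≤ 1 := (finrank_span_le_card (R := F) {v * w}).trans (by simp)
    have e6 : finrank F (F ∙ w * w) ≤ 1 := (finrank_span_le_card (R := F) {w * w}).trans (by simp)
    omega

end Points

end EllipticCode

/-! ### Comparison of twisted codes with GRS codes and elliptic curve codes -/

namespace EllipticCode

open Polynomial Module CoordRing

namespace Points

variable {F : Type*} [Field F] {W : WeierstrassCurve F} {n : ℕ} {D : Points W n}
variable {k t : ℕ} {η : F}

/-- The ranges of the dimension of the codes. -/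
theorem range_cases (hr : (4 ≤ k ∧ 2 * k + 4 ≤ n) ∨ (n + 4 ≤ 2 * k ∧ k + 4 ≤ n)) :
    9 ≤ n ∧ 4 ≤ k ∧ k + 1 < n := by omega

/-- Squares of the duals of twisted codes of high rate. -/
theorem le_finrank_orth_twistCode_mul (hW : W.a₄ = 0 → W.a₆ = 0 → W.a₁ = 0 ∧ W.a₃ ≠ 0 ∧ (2 : F) = 0)
    (hk : n + 4 ≤ 2 * k) (hkn : k + 4 ≤ n) (htk : t ≤ k) (ht1 : t ≠ 1) (par : t % 2 = k % 2)
    (hη : η ≠ 0) :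
    2 * (n - k) + 1 ≤ finrank F (orth (D.twistCode k t η) * orth (D.twistCode k t η) :
        Submodule F (Fin n → F)) ∨
      (2 * (n - k) ≤ finrank F (orth (D.twistCode k t η) * orth (D.twistCode k t η) :
        Submodule F (Fin n → F)) ∧ ((t = 0 ∧ n = 12 ∧ k = 8) ∨
      (orth (D.twistCode k t η) * orth (D.twistCode k t η) * orth (D.twistCode k t η) ≠ ⊤ ∧
        orth (D.code k) * orth (D.code k) * orth (D.code k) = ⊤))) := by
  have hr : HighRate n k t (n - k) (k + 2 - (n - k)) :=
    ⟨by omega, by omega, by omega, by omega, htk, ht1, par⟩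
  -- Since `n = 2 j + m - 2`, a conductor of dimension at most `m - 3` means a square of dimension
  -- at least `2 j + 1`.
  have hc : finrank F (D.conductor k t η) = n - finrank F (orth (D.twistCode k t η) *
      orth (D.twistCode k t η) : Submodule F (Fin n → F)) := finrank_orth _
  have hle := finrank_le (orth (D.twistCode k t η) * orth (D.twistCode k t η))
  rcases D.isPrincipal_or (by omega) with ⟨v, hv⟩ | ⟨v, hv⟩
  · rcases hv.finrank_conductor hr hη with h | ⟨h0, hn, hk', h⟩
    · left; omega
    · right; exact ⟨by omega, Or.inl ⟨h0, hn, hk'⟩⟩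
  · obtain ⟨w, a, b, hd⟩ := exists_isDual (by omega) hv
    rcases hd.finrank_conductor hr hη fun h4 h6 => ⟨(hW h4 h6).1, (hW h4 h6).2.1⟩ with
      h | ⟨rfl, hj, h4, h6, h2, hb, hb0⟩
    · left; omega
    · obtain ⟨h1, h3, hF⟩ := hW h4 h6
      have hs : IsSpecial W a b := by
        refine ⟨h1, eq_neg_of_add_eq_zero_right h2, ?_, h4, h6, hb0⟩
        rw [negY, h1] at hb
        linear_combination -hb
      rw [hj] at hr
      rcases hd.finrank_conductor_or hr hs hη hF with h | ⟨h, h'⟩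
      · left; omega
      · exact Or.inr ⟨by omega, Or.inr h'⟩

theorem not_monomiallyEquivalent_grs
    (hW : W.a₄ = 0 → W.a₆ = 0 → W.a₁ = 0 ∧ W.a₃ ≠ 0 ∧ (2 : F) = 0)
    (hr : (4 ≤ k ∧ 2 * k + 4 ≤ n) ∨ (n + 4 ≤ 2 * k ∧ k + 4 ≤ n)) (htk : t ≤ k) (ht1 : t ≠ 1)
    (par : t % 2 = k % 2) (hη : η ≠ 0) {α v : Fin n → F} (hα : Function.Injective α)
    (hv : ∀ i, v i ≠ 0) : ¬ MonomiallyEquivalent (D.twistCode k t η) (grs k α v) := by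
  intro h
  rcases hr with ⟨h4, hn⟩ | ⟨h1, h2⟩
  · have e1 := D.le_finrank_twistCode_mul h4 (by omega) htk ht1 par hη
    have e2 := finrank_grs_mul_grs_le k α v
    rw [h.sq.finrank_eq] at e1
    omega
  · obtain ⟨u, hu⟩ := exists_orth_grs_eq hα hv (k := k) (by omega)
    have e2 := finrank_grs_mul_grs_le (n - k) α u
    rw [← hu, ← h.orth.sq.finrank_eq] at e2
    rcases le_finrank_orth_twistCode_mul (D := D) hW h1 h2 htk ht1 par hη with e | ⟨e, -⟩ <;> omega

/-- An inclusion is enough as hypothesis: equivalence fixes the dimension, so `C` would equal the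
code of `V k`. -/
theorem not_monomiallyEquivalent_code
    (hW : W.a₄ = 0 → W.a₆ = 0 → W.a₁ = 0 ∧ W.a₃ ≠ 0 ∧ (2 : F) = 0)
    (hr : (4 ≤ k ∧ 2 * k + 4 ≤ n) ∨ (n + 4 ≤ 2 * k ∧ k + 4 ≤ n)) (htk : t ≤ k) (ht1 : t ≠ 1)
    (par : t % 2 = k % 2) (hη : η ≠ 0) (hne : ¬ (n = 12 ∧ k = 8 ∧ t = 0))
    {C : Submodule F (Fin n → F)} (hC : D.code k ≤ C) :
    ¬ MonomiallyEquivalent (D.twistCode k t η) C := by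
  intro h
  obtain ⟨hn, hk4, hkn⟩ := range_cases hr
  obtain rfl : D.code k = C := Submodule.eq_of_le_of_finrank_eq hC (by
    rw [D.finrank_code (by omega) (by omega), ← h.finrank_eq, D.finrank_twistCode hkn htk ht1])
  rcases hr with ⟨h4, hn⟩ | ⟨h1, h2⟩
  · have e1 := D.le_finrank_twistCode_mul h4 (by omega) htk ht1 par hη
    have e2 := D.finrank_code_mul_le (k := k) (by omega)
    rw [h.sq.finrank_eq] at e1
    omega
  · have e2 := finrank_orth_code_mul_le (D := D) (k := k) (j := n - k) (by omega) (by omega)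
      (by omega) (by omega)
    rw [← h.orth.sq.finrank_eq] at e2
    rcases le_finrank_orth_twistCode_mul (D := D) hW h1 h2 htk ht1 par hη with
      e | ⟨-, e | ⟨e1, e3⟩⟩
    · omega
    · exact hne ⟨e.2.1, e.2.2, e.1⟩
    -- When the squares of the duals are not known to differ, their cubes do.
    · have e4 := h.orth.cube.finrank_eq
      rw [e3, finrank_top] at e4
      exact e1 (Submodule.eq_top_of_finrank_eq e4)

end Points

end EllipticCode

namespace EllipticCode

open Polynomial Module CoordRing

/-! ### Function fields of Weierstrass curves -/

section FunctionField

variable {F K : Type*} [Field F] [Field K] [Algebra F K]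

/-- `K = F(X, Y)` is the function field of the Weierstrass curve `W`, which has no singular
rational points. -/
structure IsModel (W : WeierstrassCurve F) (X Y : K) : Prop where
  equation : Y ^ 2 + (algebraMap F K W.a₁ * X + algebraMap F K W.a₃) * Y =
    X ^ 3 + algebraMap F K W.a₂ * X ^ 2 + algebraMap F K W.a₄ * X + algebraMap F K W.a₆
  adjoin_eq_top : IntermediateField.adjoin F {X, Y} = ⊤
  smooth : ∀ a b, OnCurve W a b → 2 * b + W.a₁ * a + W.a₃ ≠ 0 ∨
    3 * a ^ 2 + 2 * W.a₂ * a + W.a₄ - W.a₁ * b ≠ 0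

namespace IsModel

variable {W : WeierstrassCurve F} {X Y : K} (hM : IsModel W X Y)

/-- The functions in the coordinate ring as elements of the function field. -/
noncomputable def incl : CoordRing W →ₐ[F] K where
  toFun g := aeval X g.re + aeval X g.im * Y
  map_one' := by
    have h1 : (1 : CoordRing W).re = 1 := rfl
    have h2 : (1 : CoordRing W).im = 0 := rfl
    simp [h1, h2]
  map_mul' g g' := by
    have h := hM.equation
    simp only [QuadraticAlgebra.re_mul, QuadraticAlgebra.im_mul, cubic, linear, map_add, map_mul,
      map_neg, map_pow, aeval_X, aeval_C]
    linear_combination (-aeval X g.im * aeval X g'.im) * h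
  map_zero' := by simp
  map_add' g g' := by simp; ring
  commutes' c := by
    have h1 : (algebraMap F (CoordRing W) c).re = C c := rfl
    have h2 : (algebraMap F (CoordRing W) c).im = 0 := rfl
    simp [h1, h2]

theorem incl_apply (g : CoordRing W) : hM.incl g = aeval X g.re + aeval X g.im * Y := rfl

theorem incl_mon_even (i : ℕ) : hM.incl (mon W (2 * i)) = X ^ i := by
  simp [incl_apply, mon_even]

theorem incl_mon_odd (i : ℕ) : hM.incl (mon W (2 * i + 3)) = X ^ i * Y := by
  simp [incl_apply, mon_odd]

theorem exists_eq_div (z : K) : ∃ f g : CoordRing W, z = hM.incl f / hM.incl g := by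
  have hz : z ∈ IntermediateField.adjoin F {X, Y} := hM.adjoin_eq_top ▸ IntermediateField.mem_top
  have hle : Algebra.adjoin F {X, Y} ≤ hM.incl.range := by
    refine Algebra.adjoin_le ?_
    rintro _ (rfl | rfl)
    · exact ⟨mon W (2 * 1), by simpa using hM.incl_mon_even 1⟩
    · exact ⟨mon W (2 * 0 + 3), by simpa using hM.incl_mon_odd 0⟩
  obtain ⟨r, hr, s, hs, h⟩ := IntermediateField.mem_adjoin_iff_div.1 hz
  obtain ⟨f, rfl⟩ := hle hr
  obtain ⟨g, rfl⟩ := hle hs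
  exact ⟨f, g, h⟩

end IsModel

namespace Place

variable (P : Place F K)

theorem valuation_algebraMap_le (c : F) : P.ring.valuation (algebraMap F K c) ≤ 1 :=
  (P.ring.valuation_le_one_iff _).2 (P.const_mem c)

theorem one_lt_valuation {X : K} (hX : X ∉ P.ring) : 1 < P.ring.valuation X := by
  rwa [← not_le, P.ring.valuation_le_one_iff]

theorem valuation_algebraMap {c : F} (hc : c ≠ 0) : P.ring.valuation (algebraMap F K c) = 1 := by
  refine le_antisymm (P.valuation_algebraMap_le c) ?_
  have h := P.valuation_algebraMap_le c⁻¹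
  rw [map_inv₀, map_inv₀] at h
  have h0 : P.ring.valuation (algebraMap F K c) ≠ 0 := by simpa using hc
  rwa [inv_le_one₀ (zero_lt_iff.2 h0)] at h

end Place

end FunctionField

/-! ### The place at infinity -/

namespace IsModel

variable {F K : Type*} [Field F] [Field K] [Algebra F K]
variable {W : WeierstrassCurve F} {X Y : K} (hM : IsModel W X Y) {O : Place F K}

/-- The value of the parameter `Y / X` of pole order `1`. -/
noncomputable def tau (O : Place F K) (X Y : K) : O.ring.ValueGroup := O.ring.valuation (Y / X)

theorem valuation_aux {Γ : Type*} [LinearOrderedCommGroupWithZero Γ] (v : Valuation K Γ)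
    (hc : ∀ c : F, v (algebraMap F K c) ≤ 1) (hX : 1 < v X) :
    v (X ^ 3 + algebraMap F K W.a₂ * X ^ 2 + algebraMap F K W.a₄ * X + algebraMap F K W.a₆) =
      v X ^ 3 ∧ v (algebraMap F K W.a₁ * X + algebraMap F K W.a₃) ≤ v X := by
  have hX0 : 0 < v X := zero_lt_one.trans hX
  have h12 : v X < v X ^ 2 := by
    rw [pow_two]; exact lt_mul_of_one_lt_left hX0 hX
  have h23 : v X ^ 2 < v X ^ 3 := by
    rw [pow_succ (v X) 2]; exact lt_mul_of_one_lt_right (pow_pos hX0 2) hX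
  constructor
  · rw [add_assoc, add_assoc, ← map_pow]
    refine v.map_add_eq_of_lt_left ?_
    rw [map_pow]
    refine lt_of_le_of_lt ?_ h23
    refine v.map_add_le ?_ (v.map_add_le ?_ ?_)
    · rw [map_mul, map_pow]; exact mul_le_of_le_one_left' (hc _)
    · rw [map_mul]; exact (mul_le_of_le_one_left' (hc _)).trans h12.le
    · exact (hc _).trans (hX.trans h12).le
  · refine v.map_add_le ?_ ((hc _).trans hX.le)
    rw [map_mul]
    exact mul_le_of_le_one_left' (hc _)

section

variable (hO : X ∉ O.ring)
include hM hO

/-- If `Y` did not dominate `X`, the left side of the equation would have value at most that of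
`X²`, but the right side has the value of `X³`. -/
theorem valuation_sq : O.ring.valuation Y ^ 2 = O.ring.valuation X ^ 3 ∧
    O.ring.valuation X < O.ring.valuation Y := by
  have hX := O.one_lt_valuation hO
  obtain ⟨h1, h2⟩ := valuation_aux (W := W) O.ring.valuation O.valuation_algebraMap_le hX
  have hX0 : 0 < O.ring.valuation X := zero_lt_one.trans hX
  rw [← hM.equation, pow_two, ← add_mul, map_mul] at h1
  have hlt : O.ring.valuation X < O.ring.valuation Y := by
    by_contra! hle
    have h3 := mul_le_mul' (O.ring.valuation.map_add_le hle h2) hle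
    rw [h1, ← pow_two] at h3
    refine absurd h3 (not_le.2 ?_)
    rw [pow_succ (O.ring.valuation X) 2]
    exact lt_mul_of_one_lt_right (pow_pos hX0 2) hX
  rw [Valuation.map_add_eq_of_lt_left _ (h2.trans_lt hlt), ← pow_two] at h1
  exact ⟨h1, hlt⟩

theorem one_lt_tau : 1 < tau O X Y := by
  have hX := O.one_lt_valuation hO
  rw [tau, map_div₀, one_lt_div₀ (zero_lt_one.trans hX)]
  exact (hM.valuation_sq hO).2

theorem valuation_X : O.ring.valuation X = tau O X Y ^ 2 := by
  have hX0 : O.ring.valuation X ≠ 0 := (zero_lt_one.trans (O.one_lt_valuation hO)).ne'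
  rw [tau, map_div₀, div_pow, (hM.valuation_sq hO).1]
  field_simp

theorem valuation_Y : O.ring.valuation Y = tau O X Y ^ 3 := by
  have hX0 : O.ring.valuation X ≠ 0 := (zero_lt_one.trans (O.one_lt_valuation hO)).ne'
  have hY0 : O.ring.valuation Y ≠ 0 :=
    ((zero_lt_one.trans (O.one_lt_valuation hO)).trans (hM.valuation_sq hO).2).ne'
  rw [tau, map_div₀, div_pow, ← (hM.valuation_sq hO).1]
  field_simp

theorem valuation_mon {m : ℕ} (hm : m ≠ 1) :
    O.ring.valuation (hM.incl (mon W m)) = tau O X Y ^ m := by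
  rcases order_cases m with ⟨i, rfl⟩ | rfl | ⟨i, rfl⟩
  · rw [incl_mon_even, map_pow, hM.valuation_X hO, pow_mul]
  · exact absurd rfl hm
  · rw [incl_mon_odd, map_mul, map_pow, hM.valuation_X hO, hM.valuation_Y hO, pow_add, pow_mul]

theorem valuation_incl_le {m : ℕ} {g : CoordRing W} (hg : g ∈ V W m) :
    O.ring.valuation (hM.incl g) ≤ tau O X Y ^ m := by
  have hτ := hM.one_lt_tau hO
  induction m generalizing g with
  | zero =>
    rw [eq_of_mem_V_zero hg, AlgHom.commutes, pow_zero]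
    exact O.valuation_algebraMap_le _
  | succ m ih =>
    have hmono : tau O X Y ^ m ≤ tau O X Y ^ (m + 1) := pow_le_pow_right₀ hτ.le m.le_succ
    by_cases hm : m = 0
    · subst hm
      rw [zero_add, V_one] at hg
      exact (ih hg).trans hmono
    · have h := ih (sub_coef_smul_mem hg (mon_mem le_rfl) (coef_mon_self (by omega)))
      rw [← sub_add_cancel g (coef W (m + 1) g • mon W (m + 1)), map_add]
      refine Valuation.map_add_le _ (h.trans hmono) ?_
      rw [map_smul, Algebra.smul_def, map_mul, hM.valuation_mon hO (by omega)]
      exact mul_le_of_le_one_left' (O.valuation_algebraMap_le _)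

theorem valuation_incl {m : ℕ} {g : CoordRing W} (hg : g ∈ V W m) (hg1 : coef W m g ≠ 0) :
    O.ring.valuation (hM.incl g) = tau O X Y ^ m := by
  have hτ := hM.one_lt_tau hO
  rcases m with _ | m
  · rw [eq_of_mem_V_zero hg, AlgHom.commutes, pow_zero, O.valuation_algebraMap hg1]
  · have hm : m + 1 ≠ 1 := fun h => hg1 (by rw [h, coef_one])
    have h := hM.valuation_incl_le hO (sub_coef_smul_mem hg (mon_mem le_rfl) (coef_mon_self hm))
    have h2 : O.ring.valuation (hM.incl (coef W (m + 1) g • mon W (m + 1))) =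
        tau O X Y ^ (m + 1) := by
      rw [map_smul, Algebra.smul_def, map_mul, hM.valuation_mon hO (by omega),
        O.valuation_algebraMap hg1, one_mul]
    have hlt : tau O X Y ^ m < tau O X Y ^ (m + 1) := pow_lt_pow_right₀ hτ m.lt_succ_self
    rw [← sub_add_cancel g (coef W (m + 1) g • mon W (m + 1)), map_add,
      Valuation.map_add_eq_of_lt_right _ (by rw [h2]; exact h.trans_lt hlt), h2]

theorem incl_injective : Function.Injective hM.incl := by
  rw [injective_iff_map_eq_zero]
  intro g hg
  by_contra h0
  obtain ⟨l, hl⟩ := exists_mem_V g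
  obtain ⟨d, -, -, hd, hd'⟩ := exists_order hl h0
  have h := hM.valuation_incl hO hd hd'
  rw [hg, map_zero] at h
  exact pow_ne_zero d (zero_lt_one.trans (hM.one_lt_tau hO)).ne' h.symm

end

include hM

/-- Every function has a pole order at infinity, that depends only on the function. -/
theorem exists_valuation_eq {z : K} (hz : z ≠ 0) : ∃ a b : ℕ, ∀ O' : Place F K, X ∉ O'.ring →
    O'.ring.valuation z = tau O' X Y ^ a / tau O' X Y ^ b := by
  obtain ⟨f, g, rfl⟩ := hM.exists_eq_div z
  have hf : f ≠ 0 := fun h => hz (by rw [h, map_zero, zero_div])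
  have hg : g ≠ 0 := fun h => hz (by rw [h, map_zero, div_zero])
  obtain ⟨l, hl⟩ := exists_mem_V f
  obtain ⟨a, -, -, ha, ha'⟩ := exists_order hl hf
  obtain ⟨l, hl⟩ := exists_mem_V g
  obtain ⟨b, -, -, hb, hb'⟩ := exists_order hl hg
  exact ⟨a, b, fun O' hO' => by
    rw [map_div₀, hM.valuation_incl hO' ha ha', hM.valuation_incl hO' hb hb']⟩

variable (hO : X ∉ O.ring)
include hO

/-- Membership in the valuation ring depends only on the pole orders of numerator and denominator,
so `X` has a single pole. -/
theorem place_eq_of_notMem {O' : Place F K} (hO' : X ∉ O'.ring) : O' = O := by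
  ext z
  by_cases hz : z = 0
  · rw [hz]; simp
  obtain ⟨a, b, h⟩ := hM.exists_valuation_eq hz
  have key : ∀ P : Place F K, X ∉ P.ring → (z ∈ P.ring ↔ a ≤ b) := fun P hP => by
    have hτ := hM.one_lt_tau hP
    rw [← P.ring.valuation_le_one_iff, h P hP, div_le_one₀ (pow_pos (zero_lt_one.trans hτ) _),
      pow_le_pow_iff_right₀ hτ]
  rw [key O hO, key O' hO']

/-- All values are quotients of powers of the value of `Y / X`, so a value below 1 is at most its
inverse. -/
theorem valuation_mul_tau_le {z : K} (hz : O.ring.valuation z < 1) :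
    O.ring.valuation z * tau O X Y ≤ 1 := by
  by_cases h0 : z = 0
  · rw [h0, map_zero, zero_mul]; exact zero_le
  obtain ⟨a, b, h⟩ := hM.exists_valuation_eq h0
  have hτ := hM.one_lt_tau hO
  rw [h O hO, div_lt_one₀ (pow_pos (zero_lt_one.trans hτ) _), pow_lt_pow_iff_right₀ hτ] at hz
  rw [h O hO, div_mul_eq_mul_div, ← pow_succ, div_le_one₀ (pow_pos (zero_lt_one.trans hτ) _)]
  exact pow_le_pow_right₀ hτ.le hz

theorem poleOrderLE {k : ℕ} {f : K} (hf : O.ring.valuation f ≤ tau O X Y ^ k) :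
    O.PoleOrderLE f k := by
  have key : ∀ k, ∀ a ∈ IsLocalRing.maximalIdeal O.ring ^ k,
      O.ring.valuation (a : K) * tau O X Y ^ k ≤ 1 := by
    intro k
    induction k with
    | zero => intro a _; rw [pow_zero, mul_one]; exact O.ring.valuation_le_one a
    | succ k ih =>
      intro a ha
      rw [pow_succ] at ha
      refine Submodule.mul_induction_on ha (fun b hb c hc => ?_) fun b c hb hc => ?_
      · have h1 := ih b hb
        have h2 := hM.valuation_mul_tau_le hO ((O.ring.valuation_lt_one_iff c).1 hc)
        have h3 := mul_le_mul' h1 h2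
        rw [one_mul] at h3
        refine le_trans (le_of_eq ?_) h3
        push_cast
        rw [map_mul, pow_succ]
        ac_rfl
      · have hτ := pow_pos (zero_lt_one.trans (hM.one_lt_tau hO)) (k + 1)
        rw [← le_div_iff₀ hτ] at hb hc ⊢
        push_cast
        exact Valuation.map_add_le _ hb hc
  intro a ha
  rw [← O.ring.valuation_le_one_iff, map_mul]
  exact (mul_le_mul' hf le_rfl).trans (by rw [mul_comm]; exact key k a ha)

/-- Away from the pole of `X` the equation makes `Y` integral. -/
theorem mem_ring_of_ne {P : Place F K} (hP : P ≠ O) : X ∈ P.ring ∧ Y ∈ P.ring := by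
  have hX : X ∈ P.ring := by
    by_contra h
    exact hP (hM.place_eq_of_notMem hO h)
  refine ⟨hX, ?_⟩
  have hc := fun c => P.const_mem c
  by_contra hY
  rw [← P.ring.valuation_le_one_iff, not_le] at hY
  have h1 : P.ring.valuation (algebraMap F K W.a₁ * X + algebraMap F K W.a₃) ≤ 1 :=
    (P.ring.valuation_le_one_iff _).2 (add_mem (mul_mem (hc _) hX) (hc _))
  have h2 : P.ring.valuation (X ^ 3 + algebraMap F K W.a₂ * X ^ 2 + algebraMap F K W.a₄ * X +
      algebraMap F K W.a₆) ≤ 1 := (P.ring.valuation_le_one_iff _).2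
    (add_mem (add_mem (add_mem (pow_mem hX 3) (mul_mem (hc _) (pow_mem hX 2)))
      (mul_mem (hc _) hX)) (hc _))
  rw [← hM.equation, pow_two, ← add_mul, map_mul,
    Valuation.map_add_eq_of_lt_left _ (h1.trans_lt hY)] at h2
  exact absurd h2 (not_le.2 (one_lt_mul'' hY hY))

theorem incl_mem_ring {P : Place F K} (hP : P ≠ O) (g : CoordRing W) : hM.incl g ∈ P.ring := by
  obtain ⟨hX, hY⟩ := hM.mem_ring_of_ne hO hP
  have key : ∀ p : F[X], aeval X p ∈ P.ring := fun p => by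
    rw [aeval_eq_sum_range]
    refine sum_mem fun i _ => ?_
    rw [Algebra.smul_def]
    exact mul_mem (P.const_mem _) (pow_mem hX i)
  exact add_mem (key _) (mul_mem (key _) hY)

theorem map_incl_V_le (k : ℕ) : (V W k).map hM.incl.toLinearMap ≤ O.riemannRoch k := by
  rintro _ ⟨g, hg, rfl⟩
  exact ⟨fun P hP => hM.incl_mem_ring hO hP g, hM.poleOrderLE hO (hM.valuation_incl_le hO hg)⟩

end IsModel

end EllipticCode

namespace EllipticCode

open Polynomial Module CoordRing

/-! ### Values at rational places -/

namespace Place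

variable {F K : Type*} [Field F] [Field K] [Algebra F K] {P : Place F K}

theorem hasValue_algebraMap (c : F) : P.HasValue (algebraMap F K c) c := by
  rw [HasValue, sub_self, map_zero]
  exact zero_lt_one

theorem HasValue.add {f g : K} {c d : F} (hf : P.HasValue f c) (hg : P.HasValue g d) :
    P.HasValue (f + g) (c + d) := by
  have h := Valuation.map_add_lt _ hf hg
  rwa [← add_sub_add_comm, ← map_add] at h

theorem HasValue.mem {f : K} {c : F} (hf : P.HasValue f c) : f ∈ P.ring := by
  have h := P.ring.add_mem _ _ (P.ring.mem_of_valuation_le_one _ (le_of_lt hf)) (P.const_mem c)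
  rwa [sub_add_cancel] at h

theorem HasValue.mul {f g : K} {c d : F} (hf : P.HasValue f c) (hg : P.HasValue g d) :
    P.HasValue (f * g) (c * d) := by
  have hf' : P.ring.valuation (f - algebraMap F K c) < 1 := hf
  have hg' : P.ring.valuation (g - algebraMap F K d) < 1 := hg
  rw [HasValue, map_mul, show f * g - algebraMap F K c * algebraMap F K d =
    (f - algebraMap F K c) * g + algebraMap F K c * (g - algebraMap F K d) by ring]
  refine Valuation.map_add_lt _ ?_ ?_
  · rw [map_mul]
    exact lt_of_le_of_lt (mul_le_of_le_one_right' ((P.ring.valuation_le_one_iff _).2 hg.mem)) hf'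
  · rw [map_mul]
    exact lt_of_le_of_lt (mul_le_of_le_one_left' (P.valuation_algebraMap_le c)) hg'

theorem HasValue.pow {f : K} {c : F} (hf : P.HasValue f c) (i : ℕ) :
    P.HasValue (f ^ i) (c ^ i) := by
  induction i with
  | zero => simpa using hasValue_algebraMap (P := P) (1 : F)
  | succ i ih => rw [pow_succ, pow_succ]; exact ih.mul hf

theorem HasValue.eq {f : K} {c d : F} (hc : P.HasValue f c) (hd : P.HasValue f d) : c = d := by
  by_contra hne
  have h := Valuation.map_sub_lt _ hd hc
  rw [sub_sub_sub_cancel_left, ← map_sub, P.valuation_algebraMap (sub_ne_zero.2 hne)] at h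
  exact lt_irrefl _ h

theorem HasValue.aeval {f : K} {c : F} (hf : P.HasValue f c) (p : F[X]) :
    P.HasValue (aeval f p) (p.eval c) := by
  induction p using Polynomial.induction_on' with
  | add p q hp hq => rw [map_add, eval_add]; exact hp.add hq
  | monomial i r =>
    rw [aeval_monomial, eval_monomial]
    exact (hasValue_algebraMap r).mul (hf.pow i)

end Place

namespace IsModel

variable {F K : Type*} [Field F] [Field K] [Algebra F K]
variable {W : WeierstrassCurve F} {X Y : K} (hM : IsModel W X Y) {P : Place F K} {a b : F}

theorem hasValue_incl (hX : P.HasValue X a) (hY : P.HasValue Y b) (g : CoordRing W) :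
    P.HasValue (hM.incl g) (g.re.eval a + g.im.eval a * b) :=
  (hX.aeval _).add ((hX.aeval _).mul hY)

include hM in
theorem onCurve_of_hasValue (hX : P.HasValue X a) (hY : P.HasValue Y b) : OnCurve W a b := by
  have hc := Place.hasValue_algebraMap (F := F) (P := P)
  have h1 := (hY.pow 2).add ((((hc W.a₁).mul hX).add (hc W.a₃)).mul hY)
  have h2 := (((hX.pow 3).add ((hc W.a₂).mul (hX.pow 2))).add ((hc W.a₄).mul hX)).add (hc W.a₆)
  rw [hM.equation] at h1
  exact h1.eq h2

/-! ### A place is determined by its center -/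

theorem sub_algebraMap_mem_span (h : OnCurve W a b) (g : CoordRing W) :
    ∃ f f' : CoordRing W, g = algebraMap F _ (evalAt h g) + f * xSub W a + f' * ySub W b := by
  obtain ⟨p, hp⟩ := X_sub_C_dvd_sub_C_eval (a := a) (p := g.re)
  obtain ⟨q, hq⟩ := X_sub_C_dvd_sub_C_eval (a := a) (p := g.im)
  refine ⟨⟨p + C b * q, 0⟩, ⟨g.im, 0⟩, ?_⟩
  have h1 : ∀ c : F, algebraMap F (CoordRing W) c = ⟨C c, 0⟩ := fun c => rfl
  rw [h1, evalAt_apply]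
  ext1
  · simp only [QuadraticAlgebra.re_add, QuadraticAlgebra.re_mul, xSub, ySub]
    simp only [map_add, map_mul, mul_zero, zero_mul, add_zero]
    linear_combination hp + C b * hq
  · simp only [QuadraticAlgebra.im_add, QuadraticAlgebra.im_mul, xSub, ySub]
    simp

/-- An element invertible modulo an ideal is invertible modulo its powers. This replaces a
localisation at the point. -/
theorem mem_of_mul_mem_pow {R : Type*} [CommRing R] {m : Ideal R} {A A' g : R}
    (hA : A * A' - 1 ∈ m) {e : ℕ} (h : A * g ∈ m ^ e) : g ∈ m ^ e := by
  have key : ∀ i ≤ e, g ∈ m ^ i := by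
    intro i
    induction i with
    | zero => simp
    | succ i ih =>
      intro hi
      have h1 : (A * A' - 1) * g ∈ m ^ (i + 1) := by
        rw [pow_succ']; exact Ideal.mul_mem_mul hA (ih (by omega))
      have h2 : A' * (A * g) ∈ m ^ (i + 1) :=
        Ideal.mul_mem_left _ _ (Ideal.pow_le_pow_right hi h)
      have h3 := sub_mem h2 h1
      rwa [show A' * (A * g) - (A * A' - 1) * g = g by ring] at h3
  exact key e le_rfl

/-- Nonzero functions factor as a power of a uniformizer times a unit at a smooth point. -/
theorem exists_mul_pow_eq {R : Type*} [CommRing R] [IsDomain R] [IsNoetherianRing R]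
    [Algebra F R]
    (ψ : R →ₐ[F] F) {A B u u' : R} (hA : ψ A ≠ 0) (hu : ψ u = 0) (hAB : A * u' = u * B)
    (hm : ∀ g, ψ g = 0 → ∃ f f', g = f * u + f' * u') {g : R} (hg : g ≠ 0) :
    ∃ e g', ψ g' ≠ 0 ∧ A ^ e * g = u ^ e * g' := by
  -- Otherwise `g` would be divisible by all powers of `u` up to such factors, and would lie in
  -- every power of the maximal ideal; Krull's intersection theorem excludes this.
  by_contra! hne
  have key : ∀ e, ∃ g', A ^ e * g = u ^ e * g' := by
    intro e
    induction e with
    | zero => exact ⟨g, by rw [pow_zero, pow_zero]⟩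
    | succ e ih =>
      obtain ⟨g', hg'⟩ := ih
      have h0 : ψ g' = 0 := by
        by_contra h0
        exact hne e g' h0 hg'
      obtain ⟨f, f', rfl⟩ := hm g' h0
      refine ⟨A * f + f' * B, ?_⟩
      rw [pow_succ, pow_succ]
      linear_combination A * hg' + u ^ e * f' * hAB
  have hmax : RingHom.ker ψ ≠ ⊤ := by
    rw [Ne, Ideal.eq_top_iff_one, RingHom.mem_ker, map_one]
    exact one_ne_zero
  have hinf := Ideal.iInf_pow_eq_bot_of_isDomain (RingHom.ker ψ) hmax
  refine hg ?_
  rw [← Ideal.mem_bot, ← hinf, Ideal.mem_iInf]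
  intro e
  obtain ⟨g', hg'⟩ := key e
  refine mem_of_mul_mem_pow (A := A ^ e) (A' := algebraMap F R ((ψ A)⁻¹ ^ e)) ?_ ?_
  · rw [RingHom.mem_ker, map_sub, map_mul, map_pow, map_one, AlgHom.commutes]
    change ψ A ^ e * (ψ A)⁻¹ ^ e - 1 = 0
    rw [← mul_pow, mul_inv_cancel₀ hA, one_pow, sub_self]
  · rw [hg']
    exact Ideal.mul_mem_right _ _ (Ideal.pow_mem_pow (by rwa [RingHom.mem_ker]) e)

instance : IsNoetherianRing (CoordRing W) := IsNoetherianRing.of_finite F[X] _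

include hM in
-- The two partial derivatives at the point are the values of `y - b'` and of the cofactor.
-- Whichever is nonzero makes `x - a`, respectively `y - b`, a uniformizer.
theorem exists_uniformizer (h : OnCurve W a b) : ∃ A B u u' : CoordRing W, evalAt h A ≠ 0 ∧
    evalAt h u = 0 ∧ A * u' = u * B ∧
      ∀ g, evalAt h g = 0 → ∃ f f', g = f * u + f' * u' := by
  have hx : evalAt h (xSub W a) = 0 := by simp [evalAt_apply, xSub]
  have hy : evalAt h (ySub W b) = 0 := by simp [evalAt_apply, ySub]
  have hrel := xSub_mul_cofactor h
  have hm : ∀ g, evalAt h g = 0 → ∃ f f', g = f * xSub W a + f' * ySub W b := fun g hg => by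
    obtain ⟨f, f', h'⟩ := sub_algebraMap_mem_span h g
    rw [hg, map_zero, zero_add] at h'
    exact ⟨f, f', h'⟩
  rcases hM.smooth a b h with h1 | h1
  · refine ⟨ySub W (negY W a b), cofactor W a, xSub W a, ySub W b, ?_, hx, ?_, hm⟩
    · simp only [evalAt_apply, ySub, negY, eval_neg, eval_C, eval_one]
      convert h1 using 1
      ring
    · rw [hrel, mul_comm]
  · refine ⟨cofactor W a, ySub W (negY W a b), ySub W b, xSub W a, ?_, hy, ?_, fun g hg => ?_⟩
    · simp only [evalAt_apply, cofactor, eval_add, eval_mul, eval_pow, eval_X, eval_neg, eval_C]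
      convert h1 using 1
      ring
    · rw [mul_comm, hrel]
    · obtain ⟨f, f', h'⟩ := hm g hg
      exact ⟨f', f, by rw [h', add_comm]⟩

include hM in
-- The value of any nonzero function is that of the uniformizer to an exponent not depending on the
-- place, so places with the same center have the same valuation ring.
theorem place_eq_of_hasValue {O : Place F K} (hO : X ∉ O.ring) {P' : Place F K}
    (hX : P.HasValue X a) (hY : P.HasValue Y b)
    (hX' : P'.HasValue X a) (hY' : P'.HasValue Y b) : P = P' := by
  have h := hM.onCurve_of_hasValue hX hY
  obtain ⟨A, B, u, u', hA, hu, hAB, hm⟩ := hM.exists_uniformizer h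
  have hu0 : u ≠ 0 := by
    rintro rfl
    rw [zero_mul] at hAB
    have hA0 : A ≠ 0 := by rintro rfl; exact hA (map_zero _)
    obtain ⟨f, f', h1⟩ := hm (xSub W a) (by simp [evalAt_apply, xSub])
    rw [(mul_eq_zero.1 hAB).resolve_left hA0, mul_zero, mul_zero, add_zero] at h1
    have h2 := coef_xSub (W := W) a
    rw [h1, map_zero] at h2
    exact zero_ne_one h2
  have hunit : ∀ (Q : Place F K), Q.HasValue X a → Q.HasValue Y b → ∀ g, evalAt h g ≠ 0 →
      Q.ring.valuation (hM.incl g) = 1 := by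
    intro Q hQX hQY g hg
    have h1 : Q.ring.valuation _ < 1 := hM.hasValue_incl hQX hQY g
    rw [← evalAt_apply h] at h1
    rw [← sub_add_cancel (hM.incl g) (algebraMap F K (evalAt h g)),
      Valuation.map_add_eq_of_lt_right _ (by rwa [Q.valuation_algebraMap hg]),
      Q.valuation_algebraMap hg]
  have huval : ∀ (Q : Place F K), Q.HasValue X a → Q.HasValue Y b →
      0 < Q.ring.valuation (hM.incl u) ∧ Q.ring.valuation (hM.incl u) < 1 := by
    intro Q hQX hQY
    constructor
    · rw [zero_lt_iff, Valuation.ne_zero_iff]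
      exact fun h0 => hu0 (hM.incl_injective hO (h0.trans (map_zero _).symm))
    · have h1 : Q.ring.valuation _ < 1 := hM.hasValue_incl hQX hQY u
      rwa [← evalAt_apply h, hu, map_zero, sub_zero] at h1
  have hval : ∀ g : CoordRing W, g ≠ 0 → ∃ e : ℕ, ∀ Q : Place F K, Q.HasValue X a →
      Q.HasValue Y b → Q.ring.valuation (hM.incl g) = Q.ring.valuation (hM.incl u) ^ e := by
    intro g hg
    obtain ⟨e, g', hg', h1⟩ := exists_mul_pow_eq (evalAt h) hA hu hAB hm hg
    refine ⟨e, fun Q hQX hQY => ?_⟩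
    have h2 := congrArg (fun f => Q.ring.valuation (hM.incl f)) h1
    simp only [map_mul, map_pow] at h2
    rwa [hunit Q hQX hQY A hA, hunit Q hQX hQY g' hg', one_pow, one_mul, mul_one] at h2
  ext z
  by_cases hz : z = 0
  · rw [hz]; simp
  obtain ⟨f, g, rfl⟩ := hM.exists_eq_div z
  have hf : f ≠ 0 := fun h => hz (by rw [h, map_zero, zero_div])
  have hg : g ≠ 0 := fun h => hz (by rw [h, map_zero, div_zero])
  obtain ⟨i, hi⟩ := hval f hf
  obtain ⟨l, hl⟩ := hval g hg
  have key : ∀ Q : Place F K, Q.HasValue X a → Q.HasValue Y b →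
      (hM.incl f / hM.incl g ∈ Q.ring ↔ l ≤ i) := by
    intro Q hQX hQY
    obtain ⟨h1, h2⟩ := huval Q hQX hQY
    rw [← Q.ring.valuation_le_one_iff, map_div₀, hi Q hQX hQY, hl Q hQX hQY,
      div_le_one₀ (pow_pos h1 _), pow_le_pow_iff_right_of_lt_one₀ h1 h2]
  rw [key P hX hY, key P' hX' hY']

/-! ### Evaluation codes -/

include hM in
/-- The centers of distinct rational places. -/
theorem exists_points {O : Place F K} (hO : X ∉ O.ring) {n : ℕ} {P : Fin n → Place F K}
    (hP : Function.Injective P) (hPO : ∀ i, P i ≠ O) (hPrat : ∀ i, (P i).IsRational) :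
    ∃ D : Points W n, ∀ A : Submodule F (CoordRing W),
      evalCode P (A.map hM.incl.toLinearMap) = A.map D.ev.toLinearMap := by
  have hmem := fun i => hM.mem_ring_of_ne hO (hPO i)
  choose a ha using fun i => hPrat i X (hmem i).1
  choose b hb using fun i => hPrat i Y (hmem i).2
  refine ⟨⟨a, b, fun i => hM.onCurve_of_hasValue (ha i) (hb i), fun i l h1 h2 =>
    hP (hM.place_eq_of_hasValue hO (ha i) (hb i) (h1 ▸ ha l) (h2 ▸ hb l))⟩, fun A => ?_⟩
  have hv := fun i => hM.hasValue_incl (ha i) (hb i)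
  ext c
  constructor
  · rintro ⟨_, ⟨g, hg, rfl⟩, hc⟩
    exact ⟨g, hg, funext fun i => (hv i g).eq (hc i)⟩
  · rintro ⟨g, hg, rfl⟩
    exact ⟨_, ⟨g, hg, rfl⟩, fun i => hv i g⟩

end IsModel

end EllipticCode

namespace EllipticCode

open Polynomial Module CoordRing

/-! ### The defining sets of twisted codes -/

section DefiningSet

variable {F K : Type*} [Field F] [Field K] [Algebra F K]

/-- The factor of the parameter of a twist when the functions are scaled by `c`. -/
def twistFactor (k ℓ : ℕ) (c : F) : F :=
  if Odd k then c ^ (ℓ + 1) * c⁻¹ ^ ((k + 1) / 2) else c ^ ℓ * c⁻¹ ^ ((k - 2) / 2 + 1)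

theorem twistFactor_ne_zero (k ℓ : ℕ) {c : F} (hc : c ≠ 0) : twistFactor k ℓ c ≠ 0 := by
  unfold twistFactor
  split_ifs <;> positivity

theorem twistFactor_inv (k ℓ : ℕ) {c : F} (hc : c ≠ 0) :
    twistFactor k ℓ c⁻¹ * twistFactor k ℓ c = 1 := by
  unfold twistFactor
  split_ifs
  all_goals
    simp only [inv_inv, inv_pow]
    field_simp

/-- Making the cubic monic multiplies `x` and `Y` by a constant; this only rescales the coefficients
and the twist parameter. -/
theorem definingSet_le_smul (x Y : K) (k ℓ : ℕ) (η : F) {c : F} (hc : c ≠ 0) :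
    definingSet x Y k ℓ η ≤ definingSet (c • x) (c • Y) k ℓ (twistFactor k ℓ c * η) := by
  rintro _ ⟨a, b, rfl⟩
  refine ⟨fun i => c⁻¹ ^ i * a i, fun j => c⁻¹ ^ (j + 1) * b j, ?_⟩
  have h1 : ∀ i (r : F), (c⁻¹ ^ i * r) • (c • x) ^ i = r • x ^ i := fun i r => by
    rw [_root_.smul_pow, smul_smul, mul_right_comm, ← mul_pow, inv_mul_cancel₀ hc, one_pow, one_mul]
  have h2 : ∀ j (r : F), (c⁻¹ ^ (j + 1) * r) • ((c • x) ^ j * c • Y) = r • (x ^ j * Y) :=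
    fun j r => by
      rw [_root_.smul_pow, smul_mul_smul_comm, ← pow_succ, smul_smul, mul_right_comm, ← mul_pow,
        inv_mul_cancel₀ hc, one_pow, one_mul]
  have h3 : ∀ i, c⁻¹ ^ i * c ^ i = 1 := fun i => by
    rw [← mul_pow, inv_mul_cancel₀ hc, one_pow]
  unfold twistedElement twistFactor
  split_ifs
  · have h4 : c⁻¹ ^ (ℓ + 1) * b ℓ * (c ^ (ℓ + 1) * c⁻¹ ^ ((k + 1) / 2) * η) =
        c⁻¹ ^ ((k + 1) / 2) * (b ℓ * η) := by
      linear_combination c⁻¹ ^ ((k + 1) / 2) * (b ℓ * η) * h3 (ℓ + 1)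
    simp only [h1, h2, h4]
  · have h4 : c⁻¹ ^ ℓ * a ℓ * (c ^ ℓ * c⁻¹ ^ ((k - 2) / 2 + 1) * η) =
        c⁻¹ ^ ((k - 2) / 2 + 1) * (a ℓ * η) := by
      linear_combination c⁻¹ ^ ((k - 2) / 2 + 1) * (a ℓ * η) * h3 ℓ
    simp only [h1, h2, h4]

theorem definingSet_smul (x Y : K) (k ℓ : ℕ) (η : F) {c : F} (hc : c ≠ 0) :
    definingSet (c • x) (c • Y) k ℓ (twistFactor k ℓ c * η) = definingSet x Y k ℓ η := by
  refine le_antisymm ?_ (definingSet_le_smul x Y k ℓ η hc)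
  have h := definingSet_le_smul (c • x) (c • Y) k ℓ (twistFactor k ℓ c * η) (inv_ne_zero hc)
  rwa [inv_smul_smul₀ hc, inv_smul_smul₀ hc, ← mul_assoc, twistFactor_inv k ℓ hc, one_mul] at h

variable {W : WeierstrassCurve F}

variable (W) in
/-- The function with given coefficients of `x ^ i`, `i < N`, and `x ^ j y`, `j < M`. -/
noncomputable def ofCoef (N M : ℕ) (a b : ℕ → F) : CoordRing W :=
  ⟨∑ i ∈ Finset.range N, C (a i) * X ^ i, ∑ j ∈ Finset.range M, C (b j) * X ^ j⟩

theorem coef_ofCoef_even (N M : ℕ) (a b : ℕ → F) (i : ℕ) :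
    coef W (2 * i) (ofCoef W N M a b) = if i < N then a i else 0 := by
  simp [coef_even, ofCoef, coeff_X_pow]

theorem coef_ofCoef_odd (N M : ℕ) (a b : ℕ → F) (j : ℕ) :
    coef W (2 * j + 3) (ofCoef W N M a b) = if j < M then b j else 0 := by
  simp [coef_odd, ofCoef, coeff_X_pow]

theorem ofCoef_mem_V {N M m : ℕ} (hN : 2 * N ≤ m + 2) (hM : 2 * M ≤ m - 1) (hm : 2 ≤ m)
    (a b : ℕ → F) : ofCoef W N M a b ∈ V W m := by
  intro l hl
  rcases order_cases l with ⟨i, rfl⟩ | rfl | ⟨i, rfl⟩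
  · rw [coef_ofCoef_even, if_neg (by omega)]
  · rw [coef_one]
  · rw [coef_ofCoef_odd, if_neg (by omega)]

theorem eq_ofCoef {N M m : ℕ} (hN : m < 2 * N) (hM : m < 2 * M + 3) {g : CoordRing W}
    (hg : g ∈ V W m) :
    g = ofCoef W N M (fun i => coef W (2 * i) g) (fun j => coef W (2 * j + 3) g) := by
  refine ext_coef fun l => ?_
  rcases order_cases l with ⟨i, rfl⟩ | rfl | ⟨i, rfl⟩
  · rw [coef_ofCoef_even]
    split_ifs with h
    · rfl
    · exact hg _ (by omega)
  · rw [coef_one, coef_one]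
  · rw [coef_ofCoef_odd]
    split_ifs with h
    · rfl
    · exact hg _ (by omega)

namespace IsModel

variable {x Y : K} (hM : IsModel W x Y)

theorem incl_ofCoef (N M : ℕ) (a b : ℕ → F) : hM.incl (ofCoef W N M a b) =
    ∑ i ∈ Finset.range N, a i • x ^ i + ∑ j ∈ Finset.range M, b j • (x ^ j * Y) := by
  simp only [incl_apply, ofCoef, map_sum, map_mul, map_pow, aeval_X, aeval_C, Algebra.smul_def,
    Finset.sum_mul, mul_assoc]

/-- The order of the twist with the parameter `ℓ`. -/
def twistOrder (k ℓ : ℕ) : ℕ := if Odd k then 2 * ℓ + 3 else 2 * ℓ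

/-- The twist says that the coefficient at order `k + 1` is `η` times the one at order `t`; solving
for the latter explains the inverse. -/
theorem definingSet_eq {k ℓ : ℕ} {η : F} (hη : η ≠ 0) (hk : 4 ≤ k) (hℓ : twistOrder k ℓ ≤ k) :
    definingSet x Y k ℓ η =
      (twistSpace W k (twistOrder k ℓ) η⁻¹).map hM.incl.toLinearMap := by
  rcases Nat.even_or_odd k with hpar | hpar
  · have hodd : ¬ Odd k := Nat.not_odd_iff_even.2 hpar
    obtain ⟨s, rfl⟩ := hpar
    rw [twistOrder, if_neg hodd] at hℓ ⊢
    obtain ⟨s, rfl⟩ : ∃ s', s = s' + 2 := ⟨s - 2, by omega⟩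
    have hel : ∀ a b, twistedElement x Y (s + 2 + (s + 2)) ℓ η a b =
        ∑ i ∈ Finset.range (s + 3), a i • x ^ i + ∑ j ∈ Finset.range (s + 1), b j • (x ^ j * Y) +
          (a ℓ * η) • (x ^ (s + 1) * Y) := fun a b => by
      rw [twistedElement, if_neg hodd, show (s + 2 + (s + 2)) / 2 + 1 = s + 3 by omega,
        show (s + 2 + (s + 2) - 4) / 2 + 1 = s + 1 by omega,
        show (s + 2 + (s + 2) - 2) / 2 = s + 1 by omega]
    apply le_antisymm
    · rintro _ ⟨a, b, rfl⟩
      refine ⟨ofCoef W (s + 3) (s + 2) a fun j => if j = s + 1 then a ℓ * η else b j, ⟨?_, ?_⟩, ?_⟩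
      · exact ofCoef_mem_V (by omega) (by omega) (by omega) _ _
      · change twist W _ _ _ _ = 0
        rw [twist_apply, coef_ofCoef_even, if_pos (by omega),
          show s + 2 + (s + 2) + 1 = 2 * (s + 1) + 3 by ring, coef_ofCoef_odd, if_pos (by omega),
          if_pos rfl]
        field_simp
        ring
      · rw [AlgHom.toLinearMap_apply, incl_ofCoef, hel, Finset.sum_range_succ _ (s + 1), if_pos rfl,
          ← add_assoc]
        congr 2
        refine Finset.sum_congr rfl fun j hj => ?_
        rw [if_neg (by rw [Finset.mem_range] at hj; omega)]
    · rintro _ ⟨g, ⟨hg, ht⟩, rfl⟩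
      have ht : twist W _ _ _ g = 0 := ht
      rw [twist_apply, sub_eq_zero, show s + 2 + (s + 2) + 1 = 2 * (s + 1) + 3 by ring] at ht
      refine ⟨fun i => coef W (2 * i) g, fun j => coef W (2 * j + 3) g, ?_⟩
      rw [AlgHom.toLinearMap_apply, hel, ht, eq_ofCoef (N := s + 3) (M := s + 2) (by omega)
        (by omega) hg, incl_ofCoef, ← eq_ofCoef (N := s + 3) (M := s + 2) (by omega)
        (by omega) hg, Finset.sum_range_succ _ (s + 1), ← add_assoc, mul_comm (η⁻¹),
        inv_mul_cancel_right₀ hη]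
  · obtain ⟨s, rfl⟩ := hpar
    have hodd : Odd (2 * s + 1) := odd_two_mul_add_one s
    rw [twistOrder, if_pos hodd] at hℓ ⊢
    obtain ⟨s, rfl⟩ : ∃ s', s = s' + 1 := ⟨s - 1, by omega⟩
    have hel : ∀ a b, twistedElement x Y (2 * (s + 1) + 1) ℓ η a b =
        ∑ i ∈ Finset.range (s + 2), a i • x ^ i + ∑ j ∈ Finset.range (s + 1), b j • (x ^ j * Y) +
          (b ℓ * η) • x ^ (s + 2) := fun a b => by
      rw [twistedElement, if_pos hodd, show (2 * (s + 1) + 1 - 1) / 2 + 1 = s + 2 by omega,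
        show (2 * (s + 1) + 1 - 3) / 2 + 1 = s + 1 by omega,
        show (2 * (s + 1) + 1 + 1) / 2 = s + 2 by omega]
    apply le_antisymm
    · rintro _ ⟨a, b, rfl⟩
      refine ⟨ofCoef W (s + 3) (s + 1) (fun i => if i = s + 2 then b ℓ * η else a i) b,
        ⟨?_, ?_⟩, ?_⟩
      · exact ofCoef_mem_V (by omega) (by omega) (by omega) _ _
      · change twist W _ _ _ _ = 0
        rw [twist_apply, coef_ofCoef_odd, if_pos (by omega),
          show 2 * (s + 1) + 1 + 1 = 2 * (s + 2) by ring, coef_ofCoef_even, if_pos (by omega),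
          if_pos rfl]
        field_simp
        ring
      · rw [AlgHom.toLinearMap_apply, incl_ofCoef, hel, Finset.sum_range_succ _ (s + 2), if_pos rfl,
          add_right_comm]
        congr 2
        refine Finset.sum_congr rfl fun j hj => ?_
        rw [if_neg (by rw [Finset.mem_range] at hj; omega)]
    · rintro _ ⟨g, ⟨hg, ht⟩, rfl⟩
      have ht : twist W _ _ _ g = 0 := ht
      rw [twist_apply, sub_eq_zero, show 2 * (s + 1) + 1 + 1 = 2 * (s + 2) by ring] at ht
      refine ⟨fun i => coef W (2 * i) g, fun j => coef W (2 * j + 3) g, ?_⟩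
      rw [AlgHom.toLinearMap_apply, hel, ht, eq_ofCoef (N := s + 3) (M := s + 1) (by omega)
        (by omega) hg, incl_ofCoef, ← eq_ofCoef (N := s + 3) (M := s + 1) (by omega)
        (by omega) hg, Finset.sum_range_succ _ (s + 2), mul_comm (η⁻¹),
        inv_mul_cancel_right₀ hη, add_right_comm]

end IsModel

end DefiningSet

/-! ### Weierstrass models of the elliptic function fields -/

section Model

variable {F K : Type*} [Field F] [Field K] [Algebra F K]

/-- A cubic equation in `x` and `Y` becomes a Weierstrass equation when `x` and `Y` are multiplied
by the leading coefficient of the cubic. -/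
theorem exists_isModel_of_equation {h₁ h₀ c f₂ f₁ f₀ : F} {x Y : K} (hc : c ≠ 0)
    (heq : Y ^ 2 + (algebraMap F K h₁ * x + algebraMap F K h₀) * Y = algebraMap F K c * x ^ 3 +
      algebraMap F K f₂ * x ^ 2 + algebraMap F K f₁ * x + algebraMap F K f₀)
    (hadj : IntermediateField.adjoin F {x, Y} = ⊤)
    (hs : ∀ a b : F, b ^ 2 + (h₁ * a + h₀) * b = c * a ^ 3 + f₂ * a ^ 2 + f₁ * a + f₀ →
      2 * b + h₁ * a + h₀ ≠ 0 ∨ 3 * c * a ^ 2 + 2 * f₂ * a + f₁ - h₁ * b ≠ 0)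
    (h2 : f₁ = 0 → f₀ = 0 → h₀ ≠ 0 → h₁ = 0 ∧ (2 : F) = 0) :
    ∃ W : WeierstrassCurve F, IsModel W (c • x) (c • Y) ∧
      (W.a₄ = 0 → W.a₆ = 0 → W.a₁ = 0 ∧ W.a₃ ≠ 0 ∧ (2 : F) = 0) := by
  refine ⟨⟨h₁, f₂, h₀ * c, c * f₁, c ^ 2 * f₀⟩, ⟨?_, ?_, fun a b hab => ?_⟩, fun h4 h6 => ?_⟩
  · simp only [Algebra.smul_def, map_mul, map_pow]
    linear_combination algebraMap F K c ^ 2 * heq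
  · rw [eq_top_iff, ← hadj, IntermediateField.adjoin_le_iff]
    have hx : c • x ∈ IntermediateField.adjoin F {c • x, c • Y} :=
      IntermediateField.subset_adjoin F _ (Set.mem_insert _ _)
    have hY : c • Y ∈ IntermediateField.adjoin F {c • x, c • Y} :=
      IntermediateField.subset_adjoin F _ (Set.mem_insert_of_mem _ rfl)
    rintro z (hz | hz)
    · rw [hz]
      have h := IntermediateField.smul_mem _ (x := c⁻¹) hx
      rwa [inv_smul_smul₀ hc] at h
    · rw [hz]
      have h := IntermediateField.smul_mem _ (x := c⁻¹) hY
      rwa [inv_smul_smul₀ hc] at h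
  · obtain ⟨a, rfl⟩ : ∃ a', a = c * a' := ⟨c⁻¹ * a, by field_simp⟩
    obtain ⟨b, rfl⟩ : ∃ b', b = c * b' := ⟨c⁻¹ * b, by field_simp⟩
    unfold OnCurve at hab
    dsimp only at hab ⊢
    have h := hs a b (mul_left_cancel₀ (pow_ne_zero 2 hc) (by linear_combination hab))
    refine h.imp (fun h h' => h (mul_left_cancel₀ hc ?_)) fun h h' => h (mul_left_cancel₀ hc ?_)
    · linear_combination h'
    · linear_combination h'
  · dsimp only at h4 h6 ⊢
    have h1 := (mul_eq_zero.1 h4).resolve_left hc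
    have h0 := (mul_eq_zero.1 h6).resolve_left (pow_ne_zero 2 hc)
    -- With `f₁ = f₀ = 0` the origin lies on the curve, and its smoothness forces `h₀ ≠ 0`.
    have hh : h₀ ≠ 0 := by
      rcases hs 0 0 (by rw [h0]; ring) with h | h
      · simpa using h
      · rw [h1] at h
        simp at h
    exact ⟨(h2 h1 h0 hh).1, mul_ne_zero hh hc, (h2 h1 h0 hh).2⟩

theorem eq_cubic {f : F[X]} (hf : f.natDegree = 3) :
    f = C (f.coeff 3) * X ^ 3 + C (f.coeff 2) * X ^ 2 + C (f.coeff 1) * X + C (f.coeff 0) := by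
  conv_lhs => rw [f.as_sum_range_C_mul_X_pow, hf]
  simp only [Finset.sum_range_succ, Finset.sum_range_zero]
  ring

theorem not_squarefree_of_eval_eq_zero {c f₂ f₁ f₀ a : F}
    (h0 : c * a ^ 3 + f₂ * a ^ 2 + f₁ * a + f₀ = 0)
    (h1 : 3 * c * a ^ 2 + 2 * f₂ * a + f₁ = 0) :
    ¬ Squarefree (C c * X ^ 3 + C f₂ * X ^ 2 + C f₁ * X + C f₀ : F[X]) := by
  intro h
  refine not_isUnit_X_sub_C a (h (X - C a) ⟨C c * X + C (f₂ + 2 * c * a), ?_⟩)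
  have e1 : f₁ = -(3 * c * a ^ 2 + 2 * f₂ * a) := by linear_combination h1
  have e0 : f₀ = 2 * c * a ^ 3 + f₂ * a ^ 2 := by linear_combination h0 - a * h1
  rw [e1, e0]
  simp only [map_add, map_mul, map_neg, map_pow, map_ofNat]
  ring

/-- The third type becomes a cubic after multiplication by `(a x + b)²`, with leading coefficient
`a²`. The case `W.a₄ = W.a₆ = 0` survives only for the second type: the first has no linear term,
and in the third the same `b` is both `f₀` and `h₀`. -/
theorem DefEq.IsFunctionField.exists_isModel {E : DefEq F} {x y : K} (hE : E.IsFunctionField x y) :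
    ∃ (W : WeierstrassCurve F) (c : F), c ≠ 0 ∧ IsModel W (c • x) (c • E.yFun x y) ∧
      (W.a₄ = 0 → W.a₆ = 0 → W.a₁ = 0 ∧ W.a₃ ≠ 0 ∧ (2 : F) = 0) := by
  obtain ⟨hval, htr, hadj, hholds⟩ := hE
  have two : ringChar F = 2 → (2 : F) = 0 := fun h => by
    have := ringChar.of_eq h
    exact CharTwo.two_eq_zero
  have hcub : ∀ f : F[X], f.natDegree = 3 → f.coeff 3 ≠ 0 ∧ aeval x f =
      algebraMap F K (f.coeff 3) * x ^ 3 + algebraMap F K (f.coeff 2) * x ^ 2 +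
        algebraMap F K (f.coeff 1) * x + algebraMap F K (f.coeff 0) := fun f hf => by
    constructor
    · rw [← hf]
      exact leadingCoeff_ne_zero.2 (by rintro rfl; simp at hf)
    · conv_lhs => rw [eq_cubic hf]
      simp
  cases E with
  | first f =>
    obtain ⟨hchar, hf, hsq⟩ := hval
    obtain ⟨hc, hfx⟩ := hcub f hf
    have h2 : (2 : F) ≠ 0 := Ring.two_ne_zero hchar
    obtain ⟨W, hW, hW'⟩ := exists_isModel_of_equation (h₁ := 0) (h₀ := 0) (f₂ := f.coeff 2)
      (f₁ := f.coeff 1) (f₀ := f.coeff 0) (x := x) (Y := y) hc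
      (by rw [map_zero, zero_mul, add_zero, zero_mul, add_zero, ← hfx]; exact hholds) hadj
      (fun a b hab => by
        by_contra! h
        have hb : b = 0 := (mul_eq_zero.1 (by linear_combination h.1 : 2 * b = 0)).resolve_left h2
        subst hb
        rw [eq_cubic hf] at hsq
        exact not_squarefree_of_eval_eq_zero (a := a) (by linear_combination -hab)
          (by linear_combination h.2) hsq)
      (fun _ _ h => absurd rfl h)
    exact ⟨W, _, hc, hW, hW'⟩
  | second f =>
    obtain ⟨hchar, hf⟩ := hval
    obtain ⟨hc, hfx⟩ := hcub f hf
    have h2 := two hchar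
    obtain ⟨W, hW, hW'⟩ := exists_isModel_of_equation (h₁ := 0) (h₀ := 1) (f₂ := f.coeff 2)
      (f₁ := f.coeff 1) (f₀ := f.coeff 0) (x := x) (Y := y) hc
      (by rw [map_zero, zero_mul, zero_add, map_one, one_mul, ← hfx]; exact hholds) hadj
      (fun a b _ => Or.inl (by rw [h2]; simp))
      (fun _ _ _ => ⟨rfl, h2⟩)
    exact ⟨W, _, hc, hW, hW'⟩
  | third a b =>
    obtain ⟨hchar, ha⟩ := hval
    have h2 := two hchar
    have hK : (2 : K) = 0 := by
      rw [← map_ofNat (algebraMap F K) 2]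
      exact (congrArg _ h2).trans (map_zero _)
    -- Transcendence of `x` is what allows clearing the denominator.
    have hL : algebraMap F K a * x + algebraMap F K b ≠ 0 := by
      intro h
      refine htr ⟨C a * X + C b, fun h0 => ha ?_, by simpa using h⟩
      simpa using congrArg (coeff · 1) h0
    obtain ⟨W, hW, hW'⟩ := exists_isModel_of_equation (h₁ := a) (h₀ := b) (c := a ^ 2) (f₂ := 0)
      (f₁ := b ^ 2 + a) (f₀ := b) (x := x) (Y := (algebraMap F K a * x + algebraMap F K b) * y)
      (pow_ne_zero 2 ha) (by
        have h : y ^ 2 + y = x + 1 / (algebraMap F K a * x + algebraMap F K b) := hholds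
        have h' : (algebraMap F K a * x + algebraMap F K b) *
            (1 / (algebraMap F K a * x + algebraMap F K b)) = 1 := mul_one_div_cancel hL
        simp only [map_pow, map_zero, map_add]
        linear_combination (algebraMap F K a * x + algebraMap F K b) ^ 2 * h +
          (algebraMap F K a * x + algebraMap F K b) * h' +
          algebraMap F K a * algebraMap F K b * x ^ 2 * hK) (by
        rw [eq_top_iff, ← hadj, IntermediateField.adjoin_le_iff]
        have hx : x ∈ IntermediateField.adjoin F
            {x, (algebraMap F K a * x + algebraMap F K b) * y} :=
          IntermediateField.subset_adjoin F _ (Set.mem_insert _ _)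
        have hy : (algebraMap F K a * x + algebraMap F K b) * y ∈ IntermediateField.adjoin F
            {x, (algebraMap F K a * x + algebraMap F K b) * y} :=
          IntermediateField.subset_adjoin F _ (Set.mem_insert_of_mem _ rfl)
        rintro z (hz | hz)
        · rwa [hz]
        · rw [hz]
          have h := MulMemClass.mul_mem (inv_mem (add_mem (MulMemClass.mul_mem
            (IntermediateField.algebraMap_mem _ a) hx) (IntermediateField.algebraMap_mem _ b))) hy
          rwa [inv_mul_cancel_left₀ hL] at h)
      (fun α β hαβ => by
        by_contra! h
        -- At a singular point the derivative in `y` gives `a α + b = 0`, then the equation gives `β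
        -- = 0`, and the derivative in `x` reduces to `a = 0`.
        have h1 : a * α + b = 0 := by linear_combination h.1 - β * h2
        have hβ : β = 0 := by
          refine pow_eq_zero_iff (n := 2) (by omega) |>.1 ?_
          linear_combination hαβ + ((a * α + b) * α + 1 - β) * h1 - a * b * α ^ 2 * h2
        subst hβ
        exact ha (by linear_combination h.2 - (a * α + b) * h1 + (a * b * α - a ^ 2 * α ^ 2) * h2))
      (fun h1 h0 hb => absurd h0 hb)
    exact ⟨W, _, pow_ne_zero 2 ha, hW, hW'⟩

end Model

end EllipticCode

/-! ### The theorem for function fields and places -/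

theorem mainTheorem4 {F K : Type*} [Field F] [Finite F] [Field K] [Algebra F K]
    (E : EllipticCode.DefEq F) (x y : K) (hE : E.IsFunctionField x y)
    (O : EllipticCode.Place F K) (hO : x ∉ O.ring)
    (n k ℓ : ℕ) (η : F) (hη : η ≠ 0)
    (P : Fin n → EllipticCode.Place F K) (hP : Function.Injective P)
    (hPO : ∀ i, P i ≠ O) (hPrat : ∀ i, (P i).IsRational)
    (hk : (4 ≤ k ∧ (k : ℚ) ≤ ((n : ℚ) - 4) / 2) ∨
      (((n : ℚ) + 4) / 2 ≤ (k : ℚ) ∧ (k : ℚ) ≤ (n : ℚ) - 4))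
    (hℓ_odd : Odd k → (ℓ : ℚ) ≤ ((k : ℚ) - 3) / 2)
    (hℓ_even : Even k → (ℓ : ℚ) ≤ (k : ℚ) / 2) :
    (∀ α v : Fin n → F, Function.Injective α → (∀ i, v i ≠ 0) →
      ¬ EllipticCode.MonomiallyEquivalent
        (EllipticCode.tecc E x y P k ℓ η) (EllipticCode.grs k α v)) ∧
    (¬ (n = 12 ∧ k = 8 ∧ ℓ = 0) →
      ¬ EllipticCode.MonomiallyEquivalent
        (EllipticCode.tecc E x y P k ℓ η) (EllipticCode.ecc P O k)) := by
  obtain ⟨W, c, hc, hM, hW⟩ := hE.exists_isModel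
  have hO' : c • x ∉ O.ring := fun h => hO (by
    have h' := O.ring.mul_mem _ _ (O.const_mem c⁻¹) h
    rwa [← Algebra.smul_def, inv_smul_smul₀ hc] at h')
  obtain ⟨D, hD⟩ := hM.exists_points hO' hP hPO hPrat
  have hr : (4 ≤ k ∧ 2 * k + 4 ≤ n) ∨ (n + 4 ≤ 2 * k ∧ k + 4 ≤ n) := by
    refine hk.imp (fun h => ⟨h.1, ?_⟩) fun h => ⟨?_, ?_⟩
    · have : (2 * k + 4 : ℚ) ≤ n := by linarith [h.2]
      exact_mod_cast this
    · have : (n + 4 : ℚ) ≤ 2 * k := by linarith [h.1]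
      exact_mod_cast this
    · have : (k + 4 : ℚ) ≤ n := by linarith [h.2]
      exact_mod_cast this
  obtain ⟨-, hk4, -⟩ := EllipticCode.Points.range_cases hr
  have ht : EllipticCode.IsModel.twistOrder k ℓ ≤ k ∧ EllipticCode.IsModel.twistOrder k ℓ ≠ 1 ∧
      EllipticCode.IsModel.twistOrder k ℓ % 2 = k % 2 ∧
        (k = 8 → EllipticCode.IsModel.twistOrder k ℓ = 0 → ℓ = 0) := by
    unfold EllipticCode.IsModel.twistOrder
    split_ifs with h
    · have h1 : (2 * ℓ + 3 : ℚ) ≤ k := by linarith [hℓ_odd h]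
      have h2 : 2 * ℓ + 3 ≤ k := by exact_mod_cast h1
      have h3 := Nat.odd_iff.1 h
      omega
    · rw [Nat.not_odd_iff_even] at h
      have h1 : (2 * ℓ : ℚ) ≤ k := by linarith [hℓ_even h]
      have h2 : 2 * ℓ ≤ k := by exact_mod_cast h1
      have h3 := Nat.even_iff.1 h
      omega
  obtain ⟨ht, ht1, par, ht0⟩ := ht
  set η' := EllipticCode.twistFactor k ℓ c * η
  have hη' : η' ≠ 0 := mul_ne_zero (EllipticCode.twistFactor_ne_zero k ℓ hc) hη
  have htecc : EllipticCode.tecc E x y P k ℓ η =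
      D.twistCode k (EllipticCode.IsModel.twistOrder k ℓ) η'⁻¹ := by
    rw [EllipticCode.tecc, ← EllipticCode.definingSet_smul _ _ k ℓ η hc,
      hM.definingSet_eq hη' hk4 ht, hD]
    rfl
  -- The reverse inclusion is not needed, because equivalent codes have equal dimensions.
  have hecc : D.code k ≤ EllipticCode.ecc P O k := by
    rw [EllipticCode.Points.code, ← hD]
    rintro d ⟨f, hf, hd⟩
    exact ⟨f, hM.map_incl_V_le hO' k hf, hd⟩
  rw [htecc]
  refine ⟨fun α v hα hv => ?_, fun hne => ?_⟩
  · exact EllipticCode.Points.not_monomiallyEquivalent_grs hW hr ht ht1 par (inv_ne_zero hη') hα hv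
  · exact EllipticCode.Points.not_monomiallyEquivalent_code hW hr ht ht1 par (inv_ne_zero hη')
      (fun h => hne ⟨h.1, h.2.1, ht0 h.2.1 h.2.2⟩) hecc
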